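/- **Setting.** A face-centered quad equation is an equation $Q(x;x_a,x_b,x_c,x_d;\boldsymbol\alpha,\boldsymbol\beta)=0$ over $\mathbb C$, with $\boldsymbol\alpha=(\alpha_1,\alpha_2)$, $\boldsymbol\beta=(\beta_1,\beta_2)$. Put $\theta_{ij}=\theta_i-\theta_j$, $(\theta_1,\theta_2,\theta_3,\theta_4)=(\alpha_1,\alpha_2,\beta_1,\beta_2)$, and $$\begin{aligned} A3_{(\delta)}={}&\tfrac{\delta}{4}\bigl(\tfrac{\alpha_1}{\alpha_2}-\tfrac{\alpha_2}{\alpha_1}\bigr)\bigl(\tfrac{\beta_1}{\beta_2}-\tfrac{\beta_2}{\beta_1}\bigr)\bigl(\tfrac{\beta_1\beta_2}{\alpha_1\alpha_2}-\tfrac{\alpha_1\alpha_2}{\beta_1\beta_2}\bigr)x\\ &+\Bigl(\bigl(\tfrac{\beta_1}{\beta_2}-\tfrac{\beta_2}{\beta_1}\bigr)(x_ax_b-x_cx_d)+\bigl(\tfrac{\alpha_1}{\alpha_2}-\tfrac{\alpha_2}{\alpha_1}\bigr)(x_ax_c-x_bx_d)-\bigl(\tfrac{\alpha_1\alpha_2}{\beta_1\beta_2}-\tfrac{\beta_1\beta_2}{\alpha_1\alpha_2}\bigr)(x_ax_d-x_bx_c)\Bigr)x\\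 &+\bigl(\tfrac{\alpha_2}{\beta_1}-\tfrac{\beta_1}{\alpha_2}\bigr)(x_ax^2-x_bx_cx_d)-\bigl(\tfrac{\alpha_2}{\beta_2}-\tfrac{\beta_2}{\alpha_2}\bigr)(x_bx^2-x_ax_cx_d)\\ &-\bigl(\tfrac{\alpha_1}{\beta_1}-\tfrac{\beta_1}{\alpha_1}\bigr)(x_cx^2-x_ax_bx_d)+\bigl(\tfrac{\alpha_1}{\beta_2}-\tfrac{\beta_2}{\alpha_1}\bigr)(x_dx^2-x_ax_bx_c)\\ &+\tfrac{\delta}{4}\Bigl(\bigl(\tfrac{\alpha_1}{\beta_1}-\tfrac{\beta_1}{\alpha_1}\bigr)\bigl(\tfrac{\alpha_2}{\beta_2}-\tfrac{\beta_2}{\alpha_2}\bigr)\bigl((\tfrac{\alpha_1}{\beta_2}-\tfrac{\beta_2}{\alpha_1})x_a+(\tfrac{\alpha_2}{\beta_1}-\tfrac{\beta_1}{\alpha_2})x_d\bigr)\\ &\qquad-\bigl(\tfrac{\alpha_1}{\beta_2}-\tfrac{\beta_2}{\alpha_1}\bigr)\bigl(\tfrac{\alpha_2}{\beta_1}-\tfrac{\beta_1}{\alpha_2}\bigr)\bigl((\tfrac{\alpha_1}{\beta_1}-\tfrac{\beta_1}{\alpha_1})x_b+(\tfrac{\alpha_2}{\beta_2}-\tfrac{\beta_2}{\alpha_2})x_c\bigr)\Bigr),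 \end{aligned}$$ $$\begin{aligned} A2_{(\delta_1;\delta_2)}={}&\bigl((\theta_{13}+\theta_{24})(x_bx_c-x_ax_d)+\theta_{12}(x_ax_c-x_bx_d)+\theta_{34}(x_ax_b-x_cx_d)\bigr)x\\ &+\theta_{23}(x_ax^2-x_bx_cx_d)-\theta_{24}(x_bx^2-x_ax_cx_d)-\theta_{13}(x_cx^2-x_ax_bx_d)+\theta_{14}(x_dx^2-x_ax_bx_c)\\ &+\delta_1x\,\theta_{12}\theta_{34}(\theta_{13}+\theta_{24})\bigl(x+x_a+x_b+x_c+x_d-\theta_{12}^2-\theta_{13}\theta_{23}-\theta_{14}\theta_{24}\bigr)^{\delta_2}\\ &+\delta_1\bigl(\theta_{14}\theta_{23}(\theta_{13}x_b+\theta_{24}x_c)(2x-\theta_{12}\theta_{34})^{\delta_2}-\theta_{13}\theta_{24}(\theta_{14}x_a+\theta_{23}x_d)(2x+\theta_{12}\theta_{34})^{\delta_2}\bigr)\\ &+\delta_2\Bigl(x_a\theta_{13}\theta_{14}(\theta_{24}\theta_{14}^2-\theta_{34}x_b)-x_b\theta_{13}\theta_{23}(\theta_{14}\theta_{13}^2-\theta_{12}x_d)-x_c\theta_{14}\theta_{24}(\theta_{23}\theta_{24}^2+\theta_{12}x_a)\\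 &\qquad+x_d\theta_{23}\theta_{24}(\theta_{13}\theta_{23}^2+\theta_{34}x_c)+\bigl(x_ax_d\theta_{13}\theta_{42}+x_bx_c\theta_{23}\theta_{14}+\textstyle\prod_{1\le i<j\le4}\theta_{ij}\bigr)(\theta_{13}+\theta_{24})\Bigr), \end{aligned}$$ $$\begin{aligned} C3_{(\delta_1;\delta_2;\delta_3)}={}&\Bigl(\alpha_2(\beta_1x_d-\beta_2x_c)-\delta_3\bigl(\alpha_2^2(\beta_1x_b-\beta_2x_a)+\beta_1\beta_2(\beta_1x_a-\beta_2x_b)\bigr)\alpha_1^{-1}\Bigr)x^2\\ &+\alpha_2x_ax_b(\beta_2x_d-\beta_1x_c)+\delta_1\alpha_1\bigl(\beta_1x_b-\beta_2x_a+\alpha_2^2(\tfrac{x_a}{\beta_2}-\tfrac{x_b}{\beta_1})\bigr)\\ &+\Bigl(\alpha_2^2(x_bx_c-x_ax_d)+\beta_1\beta_2(x_ax_c-x_bx_d)\\ &\qquad+\alpha_2(\tfrac{\beta_2}{\beta_1}-\tfrac{\beta_1}{\beta_2})\bigl(\delta_1\alpha_1-\delta_3\tfrac{\beta_1\beta_2}{\alpha_1}x_ax_b+\delta_2\tfrac{\beta_1\beta_2}{\alpha_1}x_cx_d\bigr)\Bigr)x\\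 &+\delta_2\Bigl(\tfrac{(\alpha_2^2-\beta_1^2)(\alpha_2^2-\beta_2^2)}{2\alpha_2\beta_1\beta_2}(\beta_2x_d-\beta_1x_c)+\tfrac{x_cx_d}{\alpha_1}\bigl(\beta_1\beta_2(\beta_1x_b-\beta_2x_a)+\alpha_2^2(\beta_1x_a-\beta_2x_b)\bigr)\Bigr), \end{aligned}$$ $$\begin{aligned} C2_{(\delta_1;\delta_2;\delta_3)}={}&(x_d-x_c)(x^2+x_ax_b)+\theta_{34}(x^2-x_ax_b)(\theta_{13}+\theta_{14})^{\delta_3}+2\delta_3(\theta_{23}x_a-\theta_{24}x_b)x^2\\ &+\bigl((x_a+x_b+2\delta_2\theta_{23}\theta_{24})(x_c-x_d)-(x_a-x_b)(\theta_{23}+\theta_{24})(\theta_{13}+\theta_{14})^{\delta_3}+2\delta_3\theta_{34}x_ax_b\bigr)x\\ &+\delta_1\bigl(\theta_{13}^{1+\delta_2+\delta_3}+\theta_{14}^{1+\delta_2+\delta_3}+2\delta_2x_cx_d-(x_c+x_d)(\theta_{13}+\theta_{14})^{\delta_2}\bigr)\bigl(\theta_{34}(\delta_2\theta_{23}\theta_{24}-x)-x_b\theta_{23}+x_a\theta_{24}\bigr)\\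 &+\delta_1\theta_{23}\theta_{24}\bigl(x_c-x_d+\theta_{34}(\theta_{13}+\theta_{14}-2x)^{\delta_3}\bigr)(x_a+x_b-\theta_{34}^2-\theta_{23}\theta_{24})^{\delta_2}, \end{aligned}$$ $$\begin{aligned} C1_{(\delta)}={}&(x_c-x_d)x^2+\bigl(2(\beta_1-\beta_2)(-\tfrac{x_c+x_d}{2})^{\delta}-(x_a+x_b)(x_c-x_d)\bigr)x\\ &+2(-\tfrac{x_c+x_d}{2})^{\delta}\bigl((\beta_2-\alpha_2)x_a+(\alpha_2-\beta_1)x_b\bigr)+\bigl(x_ax_b-\delta(\alpha_2-\beta_1)(\alpha_2-\beta_2)\bigr)(x_c-x_d). \end{aligned}$$ The type-A equations are $A3_{(0)},A3_{(1)},A2_{(0;0)},A2_{(1;0)},A2_{(1;1)}$ (set equal to $0$). "Generic" means: outside the zero set of some nonzero polynomial in the variables and parameter components concerned. **Four-leg forms.** $Q=0$ has the type-C four-leg form with legs $a,c$ (functions of $(x;y;\alpha,\beta)$) if, for generic $x,x_a,x_b,x_c,\boldsymbol\alpha,\boldsymbol\beta$, it has the same solutions $x_d$ as $$\frac{a(x;x_a;\alpha_2,\beta_1)\,c(x;x_d;\alpha_1,\beta_2)}{a(x;x_b;\alpha_2,\beta_2)\,c(x;x_c;\alpha_1,\beta_1)}=1,$$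 or, in the additive case, as $a(x;x_a;\alpha_2,\beta_1)+c(x;x_d;\alpha_1,\beta_2)-a(x;x_b;\alpha_2,\beta_2)-c(x;x_c;\alpha_1,\beta_1)=0$. The type-A four-leg form with leg $a$ is the case $c=a$. Let $\overline x=x+\sqrt{x^2-1}$ and consider the following legs: | type-C equation | form | $a(x;y;\alpha,\beta)$ | $c(x;y;\alpha,\beta)$ | |---|---|---|---| | $C3_{(0;0;0)}$ | mult. | $\frac{\beta x-\alpha y}{\alpha x-\beta y}$ | $y$ | | $C3_{(1;0;0)}$ | mult. | $\frac{\beta x-\alpha y}{\alpha x-\beta y}$ | $xy-\frac{\alpha}{\beta}$ | | $C3_{(\frac12;0;\frac12)}$ | mult. | $\frac{\beta x-\alpha y}{\alpha x-\beta y}$ | $\frac{\beta}{\alpha}x^2+\frac{\alpha}{\beta}-2xy$ | | $C3_{(\frac12;\frac12;0)}$ | mult. | $\frac{\alpha^2+\beta^2\overline x^2-2\alpha\beta\overline xy}{\beta^2+\alpha^2\overline x^2-2\alpha\beta\overline xy}$ | $\frac{\beta\overline xy-\alpha}{\beta y-\alpha\overline x}$ | | $C2_{(0;0;0)}$ | add.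 | $\frac{\alpha-\beta}{x-y}$ | $\frac{\alpha-\beta-y}{2x}$ | | $C2_{(1;0;0)}$ | mult. | $\frac{-x+y+\alpha-\beta}{x-y+\alpha-\beta}$ | $x+y-\alpha+\beta$ | | $C2_{(1;1;0)}$ | mult. | $\frac{(\sqrt x+\alpha-\beta)^2-y}{(\sqrt x-\alpha+\beta)^2-y}$ | $\frac{y-\sqrt x-\alpha+\beta}{y+\sqrt x-\alpha+\beta}$ | | $C2_{(1;0;1)}$ | mult. | $\frac{-x+y+\alpha-\beta}{x-y+\alpha-\beta}$ | $y-(x-\alpha+\beta)^2$ | | $C1_{(0)}$ | add. | $\frac{\alpha-\beta}{x-y}$ | $\frac y2$ | | $C1_{(1)}$ | mult. | $\frac{-x+y+\alpha-\beta}{x-y+\alpha-\beta}$ | $y$ | **CAFCC.** Equations $A,\overline A,C,\overline C$ satisfy CAFCC if, for generic $\alpha_1,\alpha_2,\beta_1,\beta_2,\gamma_1,\gamma_2$ and generic initial variables $x,x_a,x_b,x_c,z_n,z_w$, there are values of the other eight variables $x_d,y,y_a,y_b,y_c,y_d,z_e,z_s$ that satisfy the six face equations $$\begin{array}{lll}C(x;x_a,x_b,x_c,x_d;\boldsymbol\alpha,\boldsymbol\beta)=0,&C(z_w;y_a,x_a,y_c,x_c;\boldsymbol\alpha,\boldsymbol\gamma)=0,&A(z_n;y_a,y_b,x_a,x_b;\boldsymbol\gamma,\boldsymbol\beta)=0,\\C(y;y_a,y_b,y_c,y_d;\boldsymbol\alpha,\boldsymbol\beta)=0,&C(z_e;y_b,x_b,y_d,x_d;\boldsymbol\alpha,\boldsymbol\gamma)=0,&\overline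 A(z_s;y_c,y_d,x_c,x_d;\boldsymbol\gamma,\boldsymbol\beta)=0,\end{array}$$ and the eight corner equations $$\begin{array}{ll}A(x_a;z_w,y_a,x,z_n;(\beta_1,\gamma_2),(\alpha_2,\gamma_1))=0,&A(x_b;z_e,y_b,x,z_n;(\beta_2,\gamma_2),(\alpha_2,\gamma_1))=0,\\\overline C(x_c;z_s,y_c,x,z_w;(\alpha_1,\gamma_1),(\beta_1,\gamma_2))=0,&\overline C(x_d;y_d,z_s,z_e,x;(\alpha_1,\gamma_1),(\gamma_2,\beta_2))=0,\\A(y_a;z_w,x_a,y,z_n;(\beta_1,\gamma_1),(\alpha_2,\gamma_2))=0,&A(y_b;z_e,x_b,y,z_n;(\beta_2,\gamma_1),(\alpha_2,\gamma_2))=0,\\\overline C(y_c;x_c,z_s,z_w,y;(\alpha_1,\gamma_2),(\gamma_1,\beta_1))=0,&\overline C(y_d;x_d,z_s,z_e,y;(\alpha_1,\gamma_2),(\gamma_1,\beta_2))=0,\end{array}$$ and such that, successively: (i) the equations centered at $x_a$ and $x$ have $y_a$, respectively $x_d$, as unique solution for that variable; (ii) likewise those centered at $z_w,z_n,y_a$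 for $y_c,y_b,y$; (iii) both equations centered at $x_b,y_b$ have the same unique solution $z_e$; (iv) both equations centered at $y_c,x_c$ have the same unique solution $z_s$; (v) all four equations centered at $z_e,z_s,y,x_d$ have the same unique solution $y_d$; (vi) the equation centered at $y_d$ then holds. **Theorem.** Let $(A,\overline A,C,\overline C)$ be one of the ten rows | $A$ | $\overline A$ | $C$ | $\overline C$ | |---|---|---|---| | $A3_{(1)}$ | $A3_{(0)}$ | $C3_{(\frac12;\frac12;0)}$ | $C3_{(\frac12;0;\frac12)}$ | | $A3_{(0)}$ | $A3_{(1)}$ | $C3_{(\frac12;0;\frac12)}$ | $C3_{(\frac12;\frac12;0)}$ | | $A3_{(0)}$ | $A3_{(0)}$ | $C3_{(1;0;0)}$ | $C3_{(1;0;0)}$ | | $A3_{(0)}$ | $A3_{(0)}$ | $C3_{(0;0;0)}$ | $C3_{(0;0;0)}$ | | $A2_{(1;1)}$ | $A2_{(1;0)}$ | $C2_{(1;1;0)}$ | $C2_{(1;0;1)}$ | | $A2_{(1;0)}$ | $A2_{(1;1)}$ | $C2_{(1;0;1)}$ | $C2_{(1;1;0)}$ | | $A2_{(1;0)}$ | $A2_{(1;0)}$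 | $C2_{(1;0;0)}$ | $C2_{(1;0;0)}$ | | $A2_{(0;0)}$ | $A2_{(1;0)}$ | $C2_{(0;0;0)}$ | $C1_{(1)}$ | | $A2_{(1;0)}$ | $A2_{(0;0)}$ | $C1_{(1)}$ | $C2_{(0;0;0)}$ | | $A2_{(0;0)}$ | $A2_{(0;0)}$ | $C1_{(0)}$ | $C1_{(0)}$ | Then $C$ and $\overline C$ have the type-C four-leg forms listed above; $A$ is the unique one of the five type-A equations whose type-A four-leg form has the same leg function $a$ (and the same form, multiplicative or additive) as $C$, and $\overline A$ is the unique one that matches $\overline C$ in the same way. Moreover, any face-centered quad equation whose type-A four-leg form has the leg function $a$ of $C$ (of $\overline C$) has, for generic $x,x_a,x_b,x_c,\boldsymbol\alpha,\boldsymbol\beta$, the same solutions $x_d$ as $A$ (as $\overline A$). Finally, $A,\overline A,C,\overline C$ satisfy CAFCC. -/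

import Mathlib

/-- A face-centered quad equation `Q(x; x_a, x_b, x_c, x_d; α, β) = 0`, given by its left-hand
side `Q x x_a x_b x_c x_d α β`; here `x` is the face variable, `x_a, x_b, x_c, x_d` are the corner
variables, and `α = (α₁, α₂)`, `β = (β₁, β₂)` are the two-component parameters. -/
abbrev FCQuad : Type := ℂ → ℂ → ℂ → ℂ → ℂ → ℂ × ℂ → ℂ × ℂ → ℂ

/-- The polynomial `A3_(δ)`. -/
noncomputable def polyA3 (δ : ℂ) : FCQuad := fun x xa xb xc xd al be =>
  let α₁ := al.1
  let α₂ := al.2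
  let β₁ := be.1
  let β₂ := be.2
  δ / 4 * (α₁ / α₂ - α₂ / α₁) * (β₁ / β₂ - β₂ / β₁)
      * (β₁ * β₂ / (α₁ * α₂) - α₁ * α₂ / (β₁ * β₂)) * x
    + ((β₁ / β₂ - β₂ / β₁) * (xa * xb - xc * xd)
        + (α₁ / α₂ - α₂ / α₁) * (xa * xc - xb * xd)
        - (α₁ * α₂ / (β₁ * β₂) - β₁ * β₂ / (α₁ * α₂)) * (xa * xd - xb * xc)) * x
    + (α₂ / β₁ - β₁ / α₂) * (xa * x ^ 2 - xb * xc * xd)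
    - (α₂ / β₂ - β₂ / α₂) * (xb * x ^ 2 - xa * xc * xd)
    - (α₁ / β₁ - β₁ / α₁) * (xc * x ^ 2 - xa * xb * xd)
    + (α₁ / β₂ - β₂ / α₁) * (xd * x ^ 2 - xa * xb * xc)
    + δ / 4 *
      ((α₁ / β₁ - β₁ / α₁) * (α₂ / β₂ - β₂ / α₂)
          * ((α₁ / β₂ - β₂ / α₁) * xa + (α₂ / β₁ - β₁ / α₂) * xd)
        - (α₁ / β₂ - β₂ / α₁) * (α₂ / β₁ - β₁ / α₂)
          * ((α₁ / β₁ - β₁ / α₁) * xb + (α₂ / β₂ - β₂ / α₂) * xc))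

/-- The polynomial `A2_(δ₁; δ₂)`; `θᵢⱼ = θᵢ - θⱼ` with `(θ₁, θ₂, θ₃, θ₄) = (α₁, α₂, β₁, β₂)`. -/
def polyA2 (δ₁ δ₂ : ℕ) : FCQuad := fun x xa xb xc xd al be =>
  let θ₁₂ := al.1 - al.2
  let θ₁₃ := al.1 - be.1
  let θ₁₄ := al.1 - be.2
  let θ₂₃ := al.2 - be.1
  let θ₂₄ := al.2 - be.2
  let θ₃₄ := be.1 - be.2
  let θ₄₂ := be.2 - al.2
  ((θ₁₃ + θ₂₄) * (xb * xc - xa * xd) + θ₁₂ * (xa * xc - xb * xd) + θ₃₄ * (xa * xb - xc * xd)) * x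
    + θ₂₃ * (xa * x ^ 2 - xb * xc * xd) - θ₂₄ * (xb * x ^ 2 - xa * xc * xd)
    - θ₁₃ * (xc * x ^ 2 - xa * xb * xd) + θ₁₄ * (xd * x ^ 2 - xa * xb * xc)
    + (δ₁ : ℂ) * x * θ₁₂ * θ₃₄ * (θ₁₃ + θ₂₄)
        * (x + xa + xb + xc + xd - θ₁₂ ^ 2 - θ₁₃ * θ₂₃ - θ₁₄ * θ₂₄) ^ δ₂
    + (δ₁ : ℂ) *
      (θ₁₄ * θ₂₃ * (θ₁₃ * xb + θ₂₄ * xc) * (2 * x - θ₁₂ * θ₃₄) ^ δ₂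
        - θ₁₃ * θ₂₄ * (θ₁₄ * xa + θ₂₃ * xd) * (2 * x + θ₁₂ * θ₃₄) ^ δ₂)
    + (δ₂ : ℂ) *
      (xa * θ₁₃ * θ₁₄ * (θ₂₄ * θ₁₄ ^ 2 - θ₃₄ * xb) - xb * θ₁₃ * θ₂₃ * (θ₁₄ * θ₁₃ ^ 2 - θ₁₂ * xd)
        - xc * θ₁₄ * θ₂₄ * (θ₂₃ * θ₂₄ ^ 2 + θ₁₂ * xa) + xd * θ₂₃ * θ₂₄ * (θ₁₃ * θ₂₃ ^ 2 + θ₃₄ * xc)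
        + (xa * xd * θ₁₃ * θ₄₂ + xb * xc * θ₂₃ * θ₁₄ + θ₁₂ * θ₁₃ * θ₁₄ * θ₂₃ * θ₂₄ * θ₃₄)
          * (θ₁₃ + θ₂₄))

/-- The polynomial `C3_(δ₁; δ₂; δ₃)`. -/
noncomputable def polyC3 (δ₁ δ₂ δ₃ : ℂ) : FCQuad := fun x xa xb xc xd al be =>
  let α₁ := al.1
  let α₂ := al.2
  let β₁ := be.1
  let β₂ := be.2
  (α₂ * (β₁ * xd - β₂ * xc)
      - δ₃ * (α₂ ^ 2 * (β₁ * xb - β₂ * xa) + β₁ * β₂ * (β₁ * xa - β₂ * xb)) * α₁⁻¹) * x ^ 2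
    + α₂ * xa * xb * (β₂ * xd - β₁ * xc)
    + δ₁ * α₁ * (β₁ * xb - β₂ * xa + α₂ ^ 2 * (xa / β₂ - xb / β₁))
    + (α₂ ^ 2 * (xb * xc - xa * xd) + β₁ * β₂ * (xa * xc - xb * xd)
        + α₂ * (β₂ / β₁ - β₁ / β₂)
          * (δ₁ * α₁ - δ₃ * (β₁ * β₂ / α₁) * xa * xb + δ₂ * (β₁ * β₂ / α₁) * xc * xd)) * x
    + δ₂ *
      ((α₂ ^ 2 - β₁ ^ 2) * (α₂ ^ 2 - β₂ ^ 2) / (2 * α₂ * β₁ * β₂) * (β₂ * xd - β₁ * xc)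
        + xc * xd / α₁ * (β₁ * β₂ * (β₁ * xb - β₂ * xa) + α₂ ^ 2 * (β₁ * xa - β₂ * xb)))

/-- The polynomial `C2_(δ₁; δ₂; δ₃)`; the `θᵢⱼ` are as for `A2`. -/
def polyC2 (δ₁ δ₂ δ₃ : ℕ) : FCQuad := fun x xa xb xc xd al be =>
  let θ₁₃ := al.1 - be.1
  let θ₁₄ := al.1 - be.2
  let θ₂₃ := al.2 - be.1
  let θ₂₄ := al.2 - be.2
  let θ₃₄ := be.1 - be.2
  (xd - xc) * (x ^ 2 + xa * xb) + θ₃₄ * (x ^ 2 - xa * xb) * (θ₁₃ + θ₁₄) ^ δ₃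
    + 2 * (δ₃ : ℂ) * (θ₂₃ * xa - θ₂₄ * xb) * x ^ 2
    + ((xa + xb + 2 * (δ₂ : ℂ) * θ₂₃ * θ₂₄) * (xc - xd)
        - (xa - xb) * (θ₂₃ + θ₂₄) * (θ₁₃ + θ₁₄) ^ δ₃ + 2 * (δ₃ : ℂ) * θ₃₄ * xa * xb) * x
    + (δ₁ : ℂ) *
        (θ₁₃ ^ (1 + δ₂ + δ₃) + θ₁₄ ^ (1 + δ₂ + δ₃) + 2 * (δ₂ : ℂ) * xc * xd
          - (xc + xd) * (θ₁₃ + θ₁₄) ^ δ₂)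
        * (θ₃₄ * ((δ₂ : ℂ) * θ₂₃ * θ₂₄ - x) - xb * θ₂₃ + xa * θ₂₄)
    + (δ₁ : ℂ) * θ₂₃ * θ₂₄ * (xc - xd + θ₃₄ * (θ₁₃ + θ₁₄ - 2 * x) ^ δ₃)
        * (xa + xb - θ₃₄ ^ 2 - θ₂₃ * θ₂₄) ^ δ₂

/-- The polynomial `C1_(δ)`. -/
noncomputable def polyC1 (δ : ℕ) : FCQuad := fun x xa xb xc xd al be =>
  let α₂ := al.2
  let β₁ := be.1
  let β₂ := be.2
  (xc - xd) * x ^ 2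
    + (2 * (β₁ - β₂) * (-((xc + xd) / 2)) ^ δ - (xa + xb) * (xc - xd)) * x
    + 2 * (-((xc + xd) / 2)) ^ δ * ((β₂ - α₂) * xa + (α₂ - β₁) * xb)
    + (xa * xb - (δ : ℂ) * (α₂ - β₁) * (α₂ - β₂)) * (xc - xd)

/-- The five type-A equations `A3_(0)`, `A3_(1)`, `A2_(0;0)`, `A2_(1;0)`, `A2_(1;1)`. -/
inductive TypeA
  | A3_0 | A3_1 | A2_00 | A2_10 | A2_11

/-- The polynomial of a type-A equation. -/
noncomputable def TypeA.poly : TypeA → FCQuad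
  | .A3_0 => polyA3 0
  | .A3_1 => polyA3 1
  | .A2_00 => polyA2 0 0
  | .A2_10 => polyA2 1 0
  | .A2_11 => polyA2 1 1

/-- The ten type-C equations `C3_(0;0;0)`, `C3_(1;0;0)`, `C3_(1/2;1/2;0)`, `C3_(1/2;0;1/2)`,
`C2_(0;0;0)`, `C2_(1;0;0)`, `C2_(1;1;0)`, `C2_(1;0;1)`, `C1_(0)`, `C1_(1)`. -/
inductive TypeC
  | C3_000 | C3_100 | C3_hh0 | C3_h0h | C2_000 | C2_100 | C2_110 | C2_101 | C1_0 | C1_1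

/-- The polynomial of a type-C equation. -/
noncomputable def TypeC.poly : TypeC → FCQuad
  | .C3_000 => polyC3 0 0 0
  | .C3_100 => polyC3 1 0 0
  | .C3_hh0 => polyC3 (1 / 2) (1 / 2) 0
  | .C3_h0h => polyC3 (1 / 2) 0 (1 / 2)
  | .C2_000 => polyC2 0 0 0
  | .C2_100 => polyC2 1 0 0
  | .C2_110 => polyC2 1 1 0
  | .C2_101 => polyC2 1 0 1
  | .C1_0 => polyC1 0
  | .C1_1 => polyC1 1

/-- The property `S` holds for generic `v ∈ ℂⁿ`, i.e. on the complement of the zero set of some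
nonzero polynomial. -/
def Generically (n : ℕ) (S : (Fin n → ℂ) → Prop) : Prop :=
  ∃ P : MvPolynomial (Fin n) ℂ, P ≠ 0 ∧ ∀ v : Fin n → ℂ, MvPolynomial.eval v P ≠ 0 → S v

/-! ### Four-leg forms -/

/-- A leg function `(x, y, α, β) ↦ a(x; y; α, β)` with scalar parameters `α`, `β`. -/
abbrev LegFun : Type := ℂ → ℂ → ℂ → ℂ → ℂ

/-- Whether a four-leg form is multiplicative or additive. -/
inductive LegForm
  | mult | add

/-- The four-leg equation with legs `a, a` at the corners `x_a, x_b` and `c, c` at the corners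
`x_c, x_d`. -/
def FourLegEq (k : LegForm) (a c : LegFun) (x xa xb xc xd : ℂ) (al be : ℂ × ℂ) : Prop :=
  match k with
  | .mult => (a x xa al.2 be.1 * c x xd al.1 be.2) / (a x xb al.2 be.2 * c x xc al.1 be.1) = 1
  | .add => a x xa al.2 be.1 + c x xd al.1 be.2 - a x xb al.2 be.2 - c x xc al.1 be.1 = 0

/-- `Q = 0` has the type-C four-leg form with legs `a` and `c`: for generic values of the
parameters and of `x, x_a, x_b, x_c`, the two equations have the same solutions `x_d`. -/
def HasFourLegFormC (Q : FCQuad) (k : LegForm) (a c : LegFun) : Prop :=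
  Generically 8 fun v => ∀ xd : ℂ,
    Q (v 0) (v 1) (v 2) (v 3) xd (v 4, v 5) (v 6, v 7) = 0 ↔
      FourLegEq k a c (v 0) (v 1) (v 2) (v 3) xd (v 4, v 5) (v 6, v 7)

/-- `Q = 0` has the type-A four-leg form, in which all four legs are given by `a`. -/
def HasFourLegFormA (Q : FCQuad) (k : LegForm) (a : LegFun) : Prop :=
  HasFourLegFormC Q k a a

/-- Two face-centered quad equations agree: for generic values of the parameters and of
`x, x_a, x_b, x_c`, they have the same solutions `x_d`. -/
def FCQuad.Equivalent (Q R : FCQuad) : Prop :=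
  Generically 8 fun v => ∀ xd : ℂ,
    Q (v 0) (v 1) (v 2) (v 3) xd (v 4, v 5) (v 6, v 7) = 0 ↔
      R (v 0) (v 1) (v 2) (v 3) xd (v 4, v 5) (v 6, v 7) = 0

/-- `x̄ = x + √(x² - 1)`. -/
noncomputable def xbar (x : ℂ) : ℂ := x + Complex.sqrt (x ^ 2 - 1)

/-- The leg function `a(x; y; α, β)` occurring in the four-leg form of a type-C equation. -/
noncomputable def TypeC.legA : TypeC → LegFun
  | .C3_000 | .C3_100 | .C3_h0h => fun x y α β => (β * x - α * y) / (α * x - β * y)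
  | .C3_hh0 => fun x y α β =>
      (α ^ 2 + β ^ 2 * xbar x ^ 2 - 2 * α * β * xbar x * y) /
        (β ^ 2 + α ^ 2 * xbar x ^ 2 - 2 * α * β * xbar x * y)
  | .C2_000 | .C1_0 => fun x y α β => (α - β) / (x - y)
  | .C2_100 | .C2_101 | .C1_1 => fun x y α β => (-x + y + α - β) / (x - y + α - β)
  | .C2_110 => fun x y α β =>
      ((Complex.sqrt x + α - β) ^ 2 - y) / ((Complex.sqrt x - α + β) ^ 2 - y)

/-- The leg function `c(x; y; α, β)` occurring in the four-leg form of a type-C equation. -/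
noncomputable def TypeC.legC : TypeC → LegFun
  | .C3_000 => fun _ y _ _ => y
  | .C3_100 => fun x y α β => x * y - α / β
  | .C3_hh0 => fun x y α β => (β * xbar x * y - α) / (β * y - α * xbar x)
  | .C3_h0h => fun x y α β => β / α * x ^ 2 + α / β - 2 * x * y
  | .C2_000 => fun x y α β => (α - β - y) / (2 * x)
  | .C2_100 => fun x y α β => x + y - α + β
  | .C2_110 => fun x y α β =>
      (y - Complex.sqrt x - α + β) / (y + Complex.sqrt x - α + β)
  | .C2_101 => fun x y α β => y - (x - α + β) ^ 2
  | .C1_0 => fun _ y _ _ => y / 2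
  | .C1_1 => fun _ y _ _ => y

/-- Whether the four-leg form of a type-C equation is multiplicative or additive. -/
def TypeC.legForm : TypeC → LegForm
  | .C2_000 | .C1_0 => .add
  | _ => .mult

/-- The type-A equation `A` is uniquely fixed by the requirement that its four-leg form has the
leg function `a` in common with the four-leg form of the type-C equation `C`: it satisfies the
requirement, it is the only one of the type-A equations that does, and every face-centered quad
equation whose type-A four-leg form has this leg function agrees with it. -/
def FixedByLegs (A : TypeA) (C : TypeC) : Prop :=
  HasFourLegFormC C.poly C.legForm C.legA C.legC ∧
  HasFourLegFormA A.poly C.legForm C.legA ∧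
  (∀ B : TypeA, HasFourLegFormA B.poly C.legForm C.legA → B = A) ∧
  ∀ Q : FCQuad, HasFourLegFormA Q C.legForm C.legA → Q.Equivalent A.poly

/-! ### Consistency around a face-centered cube -/

/-- The fourteen equations on the face-centered cube: six on faces and eight on corners. -/
def FourteenEquations (A A' C C' : FCQuad) (α₁ α₂ β₁ β₂ γ₁ γ₂ : ℂ)
    (x xa xb xc xd y ya yb yc yd zn ze zs zw : ℂ) : Prop :=
  (C x xa xb xc xd (α₁, α₂) (β₁, β₂) = 0 ∧
    C y ya yb yc yd (α₁, α₂) (β₁, β₂) = 0 ∧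
    C zw ya xa yc xc (α₁, α₂) (γ₁, γ₂) = 0 ∧
    C ze yb xb yd xd (α₁, α₂) (γ₁, γ₂) = 0 ∧
    A zn ya yb xa xb (γ₁, γ₂) (β₁, β₂) = 0 ∧
    A' zs yc yd xc xd (γ₁, γ₂) (β₁, β₂) = 0) ∧
  (A xa zw ya x zn (β₁, γ₂) (α₂, γ₁) = 0 ∧
    A xb ze yb x zn (β₂, γ₂) (α₂, γ₁) = 0 ∧
    C' xc zs yc x zw (α₁, γ₁) (β₁, γ₂) = 0 ∧
    C' xd yd zs ze x (α₁, γ₁) (γ₂, β₂) = 0 ∧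
    A ya zw xa y zn (β₁, γ₁) (α₂, γ₂) = 0 ∧
    A yb ze xb y zn (β₂, γ₁) (α₂, γ₂) = 0 ∧
    C' yc xc zs zw y (α₁, γ₂) (γ₁, β₁) = 0 ∧
    C' yd xd zs ze y (α₁, γ₂) (γ₁, β₂) = 0)

/-- Consistency for given values of the six parameter components and the six initial variables
`x, x_a, x_b, x_c, z_n, z_w`: the remaining eight variables exist such that all fourteen equations
hold and, step by step, each listed equation uniquely determines the indicated variable. -/
def ConsistentAt (A A' C C' : FCQuad) (α₁ α₂ β₁ β₂ γ₁ γ₂ x xa xb xc zn zw : ℂ) : Prop :=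
  ∃ xd y ya yb yc yd ze zs : ℂ,
    FourteenEquations A A' C C' α₁ α₂ β₁ β₂ γ₁ γ₂ x xa xb xc xd y ya yb yc yd zn ze zs zw ∧
    -- step (i): determination of `y_a` and `x_d`
    ((∀ t, A xa zw t x zn (β₁, γ₂) (α₂, γ₁) = 0 ↔ t = ya) ∧
      (∀ t, C x xa xb xc t (α₁, α₂) (β₁, β₂) = 0 ↔ t = xd)) ∧
    -- step (ii): determination of `y_c`, `y_b` and `y`
    ((∀ t, C zw ya xa t xc (α₁, α₂) (γ₁, γ₂) = 0 ↔ t = yc) ∧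
      (∀ t, A zn ya t xa xb (γ₁, γ₂) (β₁, β₂) = 0 ↔ t = yb) ∧
      (∀ t, A ya zw xa t zn (β₁, γ₁) (α₂, γ₂) = 0 ↔ t = y)) ∧
    -- step (iii): two equations agree for the solution `z_e`
    ((∀ t, A xb t yb x zn (β₂, γ₂) (α₂, γ₁) = 0 ↔ t = ze) ∧
      (∀ t, A yb t xb y zn (β₂, γ₁) (α₂, γ₂) = 0 ↔ t = ze)) ∧
    -- step (iv): two equations agree for the solution `z_s`
    ((∀ t, C' yc xc t zw y (α₁, γ₂) (γ₁, β₁) = 0 ↔ t = zs) ∧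
      (∀ t, C' xc t yc x zw (α₁, γ₁) (β₁, γ₂) = 0 ↔ t = zs)) ∧
    -- step (v): four equations agree for the solution `y_d`
    ((∀ t, C ze yb xb t xd (α₁, α₂) (γ₁, γ₂) = 0 ↔ t = yd) ∧
      (∀ t, A' zs yc t xc xd (γ₁, γ₂) (β₁, β₂) = 0 ↔ t = yd) ∧
      (∀ t, C y ya yb yc t (α₁, α₂) (β₁, β₂) = 0 ↔ t = yd) ∧
      (∀ t, C' xd t zs ze x (α₁, γ₁) (γ₂, β₂) = 0 ↔ t = yd)) ∧
    -- step (vi): the remaining equation is satisfied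
    C' yd xd zs ze y (α₁, γ₂) (γ₁, β₂) = 0

/-- The equations `A, A', C, C'` satisfy CAFCC: they are consistent for generic values of the
six parameter components and the six initial variables. -/
def CAFCC (A A' C C' : FCQuad) : Prop :=
  Generically 12 fun v =>
    ConsistentAt A A' C C' (v 0) (v 1) (v 2) (v 3) (v 4) (v 5)
      (v 6) (v 7) (v 8) (v 9) (v 10) (v 11)

/-- The ten combinations of equations, as rows `(A, Ā, C, C̄)`. -/
def combinations : List (TypeA × TypeA × TypeC × TypeC) :=
  [(.A3_1, .A3_0, .C3_hh0, .C3_h0h),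
    (.A3_0, .A3_1, .C3_h0h, .C3_hh0),
    (.A3_0, .A3_0, .C3_100, .C3_100),
    (.A3_0, .A3_0, .C3_000, .C3_000),
    (.A2_11, .A2_10, .C2_110, .C2_101),
    (.A2_10, .A2_11, .C2_101, .C2_110),
    (.A2_10, .A2_10, .C2_100, .C2_100),
    (.A2_00, .A2_10, .C2_000, .C1_1),
    (.A2_10, .A2_00, .C1_1, .C2_000),
    (.A2_00, .A2_00, .C1_0, .C1_0)]

/-!
Each face-centered quad equation in the table arises from ordinary quad equations on squares, which
live on a bipartite cubic lattice with an extra vertical direction. If the four squares around a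
vertex `x` carry quad equations of the form `P Q' D = Q P' N`, in which `P`, `Q` depend only on an
edge at `x` and the parameters of that edge, then the edge factors cancel in the product of the four
equations, and what is left is a four-leg equation `(N N) / (D D) = (N N) / (D D)` centred at `x`
(`legs_product`). The type-A equations arise in this way inside a layer (`CentersA`), and the type-C
equations at the boundary between two layers carrying different quad equations (`CentersLower`,
`CentersUpper`).

The quad equations are consistent around cubes (the fields `cube_black` and `cube_white` of
`QuadEq` and `VertEq`). A six-dimensional cube with directions `α₁, α₂, β₁, β₂, γ₁, γ₂`, in which
`α₁` is the vertical direction, contains the fourteen vertices of the face-centered cube, and the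
four squares around each of them give precisely the fourteen equations
(`Block.fourteenEquations`). Given generic initial values, one auxiliary lattice variable is chosen
freely, all other lattice variables are then determined rationally, and cube consistency supplies
the remaining squares. Genericity of all the nondegeneracy conditions met on the way is certified by
a single solution with rational values at which none of them fails (`LatticeWitness.cafcc`): a
rational function that does not vanish at one point is generically nonzero
(`RegAt.eventually_ne_zero`).

The four-leg forms follow from polynomial identities between a four-leg equation with cleared
denominators and the given polynomial (`polyA3_zero_cleared` and the lemmas after it). Two equations
with the same four-leg form have generically the same solutions, so uniqueness of the type-A
equation amounts to telling the five type-A equations apart, which is done at one rational point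
(`TypeA.eq_of_equivalent`).
-/

/-! ### Generic points and rational functions -/

open Filter MvPolynomial

/-- The filter of generic sets in `ℂⁿ`: those containing the complement of the zero set of some
nonzero polynomial. -/
def genericFilter (n : ℕ) : Filter (Fin n → ℂ) where
  sets := {S | Generically n (· ∈ S)}
  univ_sets := ⟨1, one_ne_zero, fun _ _ => trivial⟩
  sets_of_superset := fun ⟨P, hP, h⟩ hST => ⟨P, hP, fun v hv => hST (h v hv)⟩
  inter_sets := fun ⟨P, hP, h⟩ ⟨R, hR, k⟩ => ⟨P * R, mul_ne_zero hP hR, fun v hv => by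
    rw [map_mul] at hv
    exact ⟨h v (left_ne_zero_of_mul hv), k v (right_ne_zero_of_mul hv)⟩⟩

theorem eventually_genericFilter {n : ℕ} {S : (Fin n → ℂ) → Prop} :
    (∀ᶠ v in genericFilter n, S v) ↔ Generically n S := Iff.rfl

instance genericFilter_neBot (n : ℕ) : (genericFilter n).NeBot := by
  refine ⟨fun h => ?_⟩
  have h0 : Generically n (fun v => v ∈ (∅ : Set (Fin n → ℂ))) := by
    have : (∅ : Set (Fin n → ℂ)) ∈ genericFilter n := by rw [h]; exact mem_bot
    exact this
  obtain ⟨P, hP, hv⟩ := h0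
  exact hP (MvPolynomial.funext fun v => by
    by_contra hne
    exact hv v (by simpa using hne))

theorem eventually_eval_ne_zero {n : ℕ} {P : MvPolynomial (Fin n) ℂ} (hP : P ≠ 0) :
    ∀ᶠ v in genericFilter n, eval v P ≠ 0 :=
  eventually_genericFilter.2 ⟨P, hP, fun _ hv => hv⟩

/-- The function `g` on `ℂⁿ` agrees generically with a rational function that is regular at the
point `p` and takes the value `c` there. The value `g p` itself plays no role. -/
def RegAt {n : ℕ} (p : Fin n → ℂ) (g : (Fin n → ℂ) → ℂ) (c : ℂ) : Prop :=
  ∃ P R : MvPolynomial (Fin n) ℂ, eval p R ≠ 0 ∧ eval p P = c * eval p R ∧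
    ∀ᶠ v in genericFilter n, g v * eval v R = eval v P

namespace RegAt

variable {n : ℕ} {p : Fin n → ℂ} {g h : (Fin n → ℂ) → ℂ} {c d : ℂ}

theorem const (c : ℂ) : RegAt p (fun _ => c) c :=
  ⟨C c, 1, by simp, by simp, Eventually.of_forall fun v => by simp⟩

theorem coord (i : Fin n) : RegAt p (fun v => v i) (p i) :=
  ⟨X i, 1, by simp, by simp, Eventually.of_forall fun v => by simp⟩

theorem add (hg : RegAt p g c) (hh : RegAt p h d) : RegAt p (fun v => g v + h v) (c + d) := by
  obtain ⟨P, R, hR, hP, e⟩ := hg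
  obtain ⟨P', R', hR', hP', e'⟩ := hh
  refine ⟨P * R' + P' * R, R * R', by simp [hR, hR'], by simp [hP, hP']; ring, ?_⟩
  filter_upwards [e, e'] with v h1 h2
  simp only [map_mul, map_add, ← h1, ← h2]
  ring

theorem mul (hg : RegAt p g c) (hh : RegAt p h d) : RegAt p (fun v => g v * h v) (c * d) := by
  obtain ⟨P, R, hR, hP, e⟩ := hg
  obtain ⟨P', R', hR', hP', e'⟩ := hh
  refine ⟨P * P', R * R', by simp [hR, hR'], by simp [hP, hP']; ring, ?_⟩
  filter_upwards [e, e'] with v h1 h2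
  simp only [map_mul, ← h1, ← h2]
  ring

theorem neg (hg : RegAt p g c) : RegAt p (fun v => -g v) (-c) := by
  simpa using (const (-1)).mul hg

theorem sub (hg : RegAt p g c) (hh : RegAt p h d) : RegAt p (fun v => g v - h v) (c - d) := by
  simpa [sub_eq_add_neg] using hg.add hh.neg

theorem pow (hg : RegAt p g c) (k : ℕ) : RegAt p (fun v => g v ^ k) (c ^ k) := by
  induction k with
  | zero => simpa using const (p := p) 1
  | succ k ih => simpa [pow_succ] using ih.mul hg

/-- A rational function with nonzero value at `p` is generically nonzero. -/
theorem eventually_ne_zero (hg : RegAt p g c) (hc : c ≠ 0) :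
    ∀ᶠ v in genericFilter n, g v ≠ 0 := by
  obtain ⟨P, R, hR, hP, e⟩ := hg
  have hP0 : P ≠ 0 := by
    rintro rfl
    exact mul_ne_zero hc hR (by rw [← hP]; simp)
  filter_upwards [e, eventually_eval_ne_zero hP0] with v h1 h2 h3
  exact h2 (by rw [← h1, h3, zero_mul])

theorem inv (hg : RegAt p g c) (hc : c ≠ 0) : RegAt p (fun v => (g v)⁻¹) c⁻¹ := by
  have hne := hg.eventually_ne_zero hc
  obtain ⟨P, R, hR, hP, e⟩ := hg
  refine ⟨R, P, by rw [hP]; exact mul_ne_zero hc hR, by rw [hP]; field_simp, ?_⟩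
  filter_upwards [e, hne] with v h1 h2
  rw [← h1]
  field_simp

theorem div (hg : RegAt p g c) (hh : RegAt p h d) (hd : d ≠ 0) :
    RegAt p (fun v => g v / h v) (c / d) := by
  simpa [div_eq_mul_inv] using hg.mul (hh.inv hd)

/-- Solving an equation that is affine in the unknown: a root at the point `p` at which the slope
does not vanish extends to a rational function that is generically a root. -/
theorem exists_root {q : (Fin n → ℂ) → ℂ → ℂ} {r : ℂ → ℂ}
    (hq : ∀ v t, q v t = q v 0 + t * (q v 1 - q v 0)) (hr : ∀ t, r t = r 0 + t * (r 1 - r 0))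
    (h0 : RegAt p (fun v => q v 0) (r 0)) (h1 : RegAt p (fun v => q v 1) (r 1))
    (hc : r c = 0) (hs : r 1 - r 0 ≠ 0) :
    ∃ t : (Fin n → ℂ) → ℂ, RegAt p t c ∧ ∀ᶠ v in genericFilter n, q v (t v) = 0 := by
  refine ⟨fun v => -q v 0 / (q v 1 - q v 0), ?_, ?_⟩
  · have : c = -r 0 / (r 1 - r 0) := by
      rw [eq_div_iff hs]
      linear_combination hc - hr c
    rw [this]
    exact h0.neg.div (h1.sub h0) hs
  · filter_upwards [(h1.sub h0).eventually_ne_zero hs] with v hv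
    rw [hq]
    field_simp
    ring

end RegAt

/-! ### Cleared four-leg equations -/

section Cleared

variable (x xa xb xc xd a b c d : ℂ)

theorem polyA3_zero_cleared (ha : a ≠ 0) (hb : b ≠ 0) (hc : c ≠ 0) (hd : d ≠ 0) :
    (c * x - b * xa) * (d * x - a * xd) * ((b * x - d * xb) * (a * x - c * xc))
      - (b * x - c * xa) * (a * x - d * xd) * ((d * x - b * xb) * (c * x - a * xc))
      = -(a * b * c * d * x) * polyA3 0 x xa xb xc xd (a, b) (c, d) := by
  simp only [polyA3]
  field_simp
  ring

theorem polyA3_one_cleared (s : ℂ) (ha : a ≠ 0) (hb : b ≠ 0) (hc : c ≠ 0) (hd : d ≠ 0)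
    (hs : s ≠ 0) (hx : x = (s ^ 2 + 1) / (2 * s)) :
    (b ^ 2 + c ^ 2 * s ^ 2 - 2 * b * c * s * xa) * (a ^ 2 + d ^ 2 * s ^ 2 - 2 * a * d * s * xd)
        * ((d ^ 2 + b ^ 2 * s ^ 2 - 2 * b * d * s * xb)
          * (c ^ 2 + a ^ 2 * s ^ 2 - 2 * a * c * s * xc))
      - (c ^ 2 + b ^ 2 * s ^ 2 - 2 * b * c * s * xa) * (d ^ 2 + a ^ 2 * s ^ 2 - 2 * a * d * s * xd)
        * ((b ^ 2 + d ^ 2 * s ^ 2 - 2 * b * d * s * xb)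
          * (a ^ 2 + c ^ 2 * s ^ 2 - 2 * a * c * s * xc))
      = -(8 * s ^ 3 * (s ^ 2 - 1) * (a * b * c * d) ^ 2)
        * polyA3 1 x xa xb xc xd (a, b) (c, d) := by
  simp only [polyA3, hx]
  field_simp
  ring

theorem polyA2_00_cleared :
    (b - c) * ((x - xb) * (x - xc) * (x - xd)) + (a - d) * ((x - xa) * (x - xb) * (x - xc))
      - (b - d) * ((x - xa) * (x - xc) * (x - xd)) - (a - c) * ((x - xa) * (x - xb) * (x - xd))
      = polyA2 0 0 x xa xb xc xd (a, b) (c, d) := by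
  simp only [polyA2]
  push_cast
  ring

theorem polyA2_10_cleared :
    (-x + xa + b - c) * (-x + xd + a - d) * ((x - xb + b - d) * (x - xc + a - c))
      - (x - xa + b - c) * (x - xd + a - d) * ((-x + xb + b - d) * (-x + xc + a - c))
      = -2 * polyA2 1 0 x xa xb xc xd (a, b) (c, d) := by
  simp only [polyA2]
  push_cast
  ring

theorem polyA2_11_cleared (s : ℂ) (hx : s ^ 2 = x) :
    ((s + b - c) ^ 2 - xa) * ((s + a - d) ^ 2 - xd)
        * (((s - b + d) ^ 2 - xb) * ((s - a + c) ^ 2 - xc))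
      - ((s - b + c) ^ 2 - xa) * ((s - a + d) ^ 2 - xd)
        * (((s + b - d) ^ 2 - xb) * ((s + a - c) ^ 2 - xc))
      = 4 * s * polyA2 1 1 x xa xb xc xd (a, b) (c, d) := by
  simp only [polyA2, ← hx]
  push_cast
  ring

theorem polyC3_000_cleared :
    (c * x - b * xa) * xd * (b * x - d * xb) - (b * x - c * xa) * ((d * x - b * xb) * xc)
      = polyC3 0 0 0 x xa xb xc xd (a, b) (c, d) := by
  simp only [polyC3]
  ring

theorem polyC3_100_cleared (ha : a ≠ 0) (hc : c ≠ 0) (hd : d ≠ 0) :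
    (c * x - b * xa) * (x * xd - a / d) * (b * x - d * xb)
      - (b * x - c * xa) * ((d * x - b * xb) * (x * xc - a / c))
      = x * polyC3 1 0 0 x xa xb xc xd (a, b) (c, d) := by
  simp only [polyC3]
  field_simp
  ring

theorem polyC3_h0h_cleared (ha : a ≠ 0) (hc : c ≠ 0) (hd : d ≠ 0) :
    (c * x - b * xa) * (d / a * x ^ 2 + a / d - 2 * x * xd) * (b * x - d * xb)
      - (b * x - c * xa) * ((d * x - b * xb) * (c / a * x ^ 2 + a / c - 2 * x * xc))
      = -2 * x * polyC3 (1 / 2) 0 (1 / 2) x xa xb xc xd (a, b) (c, d) := by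
  simp only [polyC3]
  field_simp
  ring

theorem polyC3_hh0_cleared (s : ℂ) (ha : a ≠ 0) (hb : b ≠ 0) (hc : c ≠ 0) (hd : d ≠ 0)
    (hs : s ≠ 0) (hx : x = (s ^ 2 + 1) / (2 * s)) :
    (b ^ 2 + c ^ 2 * s ^ 2 - 2 * b * c * s * xa) * (d * s * xd - a)
        * ((d ^ 2 + b ^ 2 * s ^ 2 - 2 * b * d * s * xb) * (c * xc - a * s))
      - (c ^ 2 + b ^ 2 * s ^ 2 - 2 * b * c * s * xa) * (d * xd - a * s)
        * ((b ^ 2 + d ^ 2 * s ^ 2 - 2 * b * d * s * xb) * (c * s * xc - a))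
      = -(4 * s ^ 2 * (s ^ 2 - 1) * (a * b * c * d))
        * polyC3 (1 / 2) (1 / 2) 0 x xa xb xc xd (a, b) (c, d) := by
  simp only [polyC3, hx]
  field_simp
  ring

theorem polyC2_000_cleared :
    2 * x * ((b - c) * (x - xb) - (b - d) * (x - xa))
      + ((a - d - xd) - (a - c - xc)) * ((x - xa) * (x - xb))
      = -polyC2 0 0 0 x xa xb xc xd (a, b) (c, d) := by
  simp only [polyC2]
  push_cast
  ring

theorem polyC2_100_cleared :
    (-x + xa + b - c) * (x + xd - a + d) * (x - xb + b - d)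
      - (x - xa + b - c) * ((-x + xb + b - d) * (x + xc - a + c))
      = -polyC2 1 0 0 x xa xb xc xd (a, b) (c, d) := by
  simp only [polyC2]
  push_cast
  ring

theorem polyC2_110_cleared (s : ℂ) (hx : s ^ 2 = x) :
    ((s + b - c) ^ 2 - xa) * (xd - s - a + d) * (((s - b + d) ^ 2 - xb) * (xc + s - a + c))
      - ((s - b + c) ^ 2 - xa) * (xd + s - a + d) * (((s + b - d) ^ 2 - xb) * (xc - s - a + c))
      = 2 * s * polyC2 1 1 0 x xa xb xc xd (a, b) (c, d) := by
  simp only [polyC2, ← hx]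
  push_cast
  ring

theorem polyC2_101_cleared :
    (-x + xa + b - c) * (xd - (x - a + d) ^ 2) * (x - xb + b - d)
      - (x - xa + b - c) * ((-x + xb + b - d) * (xc - (x - a + c) ^ 2))
      = -polyC2 1 0 1 x xa xb xc xd (a, b) (c, d) := by
  simp only [polyC2]
  push_cast
  ring

theorem polyC1_0_cleared :
    2 * ((b - c) * (x - xb) - (b - d) * (x - xa)) + (xd - xc) * ((x - xa) * (x - xb))
      = -polyC1 0 x xa xb xc xd (a, b) (c, d) := by
  simp only [polyC1]
  push_cast
  ring

theorem polyC1_1_cleared :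
    (-x + xa + b - c) * xd * (x - xb + b - d) - (x - xa + b - c) * ((-x + xb + b - d) * xc)
      = polyC1 1 x xa xb xc xd (a, b) (c, d) := by
  simp only [polyC1]
  push_cast
  ring

end Cleared

/-! ### Quad equations on a cubic lattice and their consistency around a cube -/

/-- A quad equation `q s t x u v y = 0` on the squares of a bipartite cubic lattice: `x`, `y` are
opposite corners of one colour and `u`, `v` those of the other colour, the edges `xu`, `vy` carry
the parameter `s` and the edges `xv`, `uy` carry `t`. The equation is affine in each corner, with
slopes recorded for `y` and `v`; it is invariant under interchanging the two directions (`swap`)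
and under the half turn of the square (`flip`). The fields `cube_black` and `cube_white` say that
the equation is consistent around a cube whose base point has the colour of `x`, respectively of
`u`. The polynomial `edge s x v` collects the factors attached to an edge that have to be nonzero
when quad equations around `x` are multiplied. -/
structure QuadEq where
  q : ℂ → ℂ → ℂ → ℂ → ℂ → ℂ → ℂ
  slopeY : ℂ → ℂ → ℂ → ℂ → ℂ → ℂ
  slopeV : ℂ → ℂ → ℂ → ℂ → ℂ → ℂ
  edge : ℂ → ℂ → ℂ → ℂ
  eq_y : ∀ s t x u v y, q s t x u v y = q s t x u v 0 + y * slopeY s t x u v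
  eq_v : ∀ s t x u v y, q s t x u v y = q s t x u 0 y + v * slopeV s t x u y
  swap : ∀ {s t x u v y}, q s t x u v y = 0 → q t s x v u y = 0
  flip : ∀ {s t x u v y}, q s t x u v y = 0 → q s t y v u x = 0
  reg : ∀ {n : ℕ} {p : Fin n → ℂ} {fs ft fx fu fv fy : (Fin n → ℂ) → ℂ} {s t x u v y : ℂ},
    RegAt p fs s → RegAt p ft t → RegAt p fx x → RegAt p fu u → RegAt p fv v → RegAt p fy y →
      RegAt p (fun z => q (fs z) (ft z) (fx z) (fu z) (fv z) (fy z)) (q s t x u v y)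
  reg_edge : ∀ {n : ℕ} {p : Fin n → ℂ} {fs fx fv : (Fin n → ℂ) → ℂ} {s x v : ℂ},
    RegAt p fs s → RegAt p fx x → RegAt p fv v →
      RegAt p (fun z => edge (fs z) (fx z) (fv z)) (edge s x v)
  cube_black : ∀ a b c x u v w xab xac xbc z,
    q a b x u v 0 + xab * slopeY a b x u v = 0 → slopeY a b x u v ≠ 0 →
    q a c x u w 0 + xac * slopeY a c x u w = 0 → slopeY a c x u w ≠ 0 →
    q b c x v w 0 + xbc * slopeY b c x v w = 0 → slopeY b c x v w ≠ 0 →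
    q b c xab u 0 xac + z * slopeV b c xab u xac = 0 → slopeV b c xab u xac ≠ 0 →
      q a c xab v 0 xbc + z * slopeV a c xab v xbc = 0
  cube_white : ∀ a b c v x y z wab wac wbc p,
    q a b x v 0 y + wab * slopeV a b x v y = 0 → slopeV a b x v y ≠ 0 →
    q a c x v 0 z + wac * slopeV a c x v z = 0 → slopeV a c x v z ≠ 0 →
    q b c y v 0 z + wbc * slopeV b c y v z = 0 → slopeV b c y v z ≠ 0 →
    q b c x wab wac 0 + p * slopeY b c x wab wac = 0 → slopeY b c x wab wac ≠ 0 →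
      q a c y wab wbc 0 + p * slopeY a c y wab wbc = 0

namespace QuadEq

variable (D : QuadEq)

theorem slopeY_eq (s t x u v : ℂ) : D.slopeY s t x u v = D.q s t x u v 1 - D.q s t x u v 0 := by
  rw [D.eq_y s t x u v 1]
  ring

theorem slopeV_eq (s t x u y : ℂ) : D.slopeV s t x u y = D.q s t x u 1 y - D.q s t x u 0 y := by
  rw [D.eq_v s t x u 1 y]
  ring

theorem black {a b c x u v w xab xac xbc z : ℂ}
    (h1 : D.q a b x u v xab = 0) (n1 : D.slopeY a b x u v ≠ 0)
    (h2 : D.q a c x u w xac = 0) (n2 : D.slopeY a c x u w ≠ 0)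
    (h3 : D.q b c x v w xbc = 0) (n3 : D.slopeY b c x v w ≠ 0)
    (h4 : D.q b c xab u z xac = 0) (n4 : D.slopeV b c xab u xac ≠ 0) :
    D.q a c xab v z xbc = 0 := by
  rw [D.eq_y] at h1 h2 h3
  rw [D.eq_v] at h4 ⊢
  exact D.cube_black a b c x u v w xab xac xbc z h1 n1 h2 n2 h3 n3 h4 n4

theorem white {a b c v x y z wab wac wbc p : ℂ}
    (h1 : D.q a b x v wab y = 0) (n1 : D.slopeV a b x v y ≠ 0)
    (h2 : D.q a c x v wac z = 0) (n2 : D.slopeV a c x v z ≠ 0)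
    (h3 : D.q b c y v wbc z = 0) (n3 : D.slopeV b c y v z ≠ 0)
    (h4 : D.q b c x wab wac p = 0) (n4 : D.slopeY b c x wab wac ≠ 0) :
    D.q a c y wab wbc p = 0 := by
  rw [D.eq_v] at h1 h2 h3
  rw [D.eq_y] at h4 ⊢
  exact D.cube_white a b c v x y z wab wac wbc p h1 n1 h2 n2 h3 n3 h4 n4

section Reg

variable {n : ℕ} {p : Fin n → ℂ} {fs ft fx fu fv fy : (Fin n → ℂ) → ℂ} {s t x u v y : ℂ}

theorem eventually_slopeY (hs : RegAt p fs s) (ht : RegAt p ft t) (hx : RegAt p fx x)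
    (hu : RegAt p fu u) (hv : RegAt p fv v) (h : D.slopeY s t x u v ≠ 0) :
    ∀ᶠ z in genericFilter n, D.slopeY (fs z) (ft z) (fx z) (fu z) (fv z) ≠ 0 := by
  simp only [slopeY_eq] at h ⊢
  exact ((D.reg hs ht hx hu hv (.const 1)).sub
    (D.reg hs ht hx hu hv (.const 0))).eventually_ne_zero h

theorem eventually_slopeV (hs : RegAt p fs s) (ht : RegAt p ft t) (hx : RegAt p fx x)
    (hu : RegAt p fu u) (hy : RegAt p fy y) (h : D.slopeV s t x u y ≠ 0) :
    ∀ᶠ z in genericFilter n, D.slopeV (fs z) (ft z) (fx z) (fu z) (fy z) ≠ 0 := by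
  simp only [slopeV_eq] at h ⊢
  exact ((D.reg hs ht hx hu (.const 1) hy).sub
    (D.reg hs ht hx hu (.const 0) hy)).eventually_ne_zero h

theorem eventually_edge (hs : RegAt p fs s) (hx : RegAt p fx x) (hv : RegAt p fv v)
    (h : D.edge s x v ≠ 0) :
    ∀ᶠ z in genericFilter n, D.edge (fs z) (fx z) (fv z) ≠ 0 :=
  (D.reg_edge hs hx hv).eventually_ne_zero h

theorem exists_y (hs : RegAt p fs s) (ht : RegAt p ft t) (hx : RegAt p fx x)
    (hu : RegAt p fu u) (hv : RegAt p fv v) (h0 : D.q s t x u v y = 0)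
    (h : D.slopeY s t x u v ≠ 0) :
    ∃ f : (Fin n → ℂ) → ℂ, RegAt p f y ∧
      ∀ᶠ z in genericFilter n, D.q (fs z) (ft z) (fx z) (fu z) (fv z) (f z) = 0 :=
  RegAt.exists_root (q := fun z t' => D.q (fs z) (ft z) (fx z) (fu z) (fv z) t')
    (r := fun t' => D.q s t x u v t')
    (fun z t' => by rw [D.eq_y, slopeY_eq]) (fun t' => by rw [D.eq_y, slopeY_eq])
    (D.reg hs ht hx hu hv (.const 0)) (D.reg hs ht hx hu hv (.const 1)) h0
    (by rwa [slopeY_eq] at h)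

theorem exists_v (hs : RegAt p fs s) (ht : RegAt p ft t) (hx : RegAt p fx x)
    (hu : RegAt p fu u) (hy : RegAt p fy y) (h0 : D.q s t x u v y = 0)
    (h : D.slopeV s t x u y ≠ 0) :
    ∃ f : (Fin n → ℂ) → ℂ, RegAt p f v ∧
      ∀ᶠ z in genericFilter n, D.q (fs z) (ft z) (fx z) (fu z) (f z) (fy z) = 0 :=
  RegAt.exists_root (q := fun z t' => D.q (fs z) (ft z) (fx z) (fu z) t' (fy z))
    (r := fun t' => D.q s t x u t' y)
    (fun z t' => by rw [D.eq_v, slopeV_eq]) (fun t' => by rw [D.eq_v, slopeV_eq])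
    (D.reg hs ht hx hu (.const 0) hy) (D.reg hs ht hx hu (.const 1) hy) h0
    (by rwa [slopeV_eq] at h)

end Reg

end QuadEq

/-- A quad equation `q r t x v u y = 0` on the vertical squares joining two layers of a bipartite
cubic lattice that carry the quad equations `L` (lower layer) and `U` (upper layer). The lower
edge `xv` and the upper edge `uy` carry the parameter `t`, the vertical edges `xu` and `vy` carry
`r`; the corners `x`, `y` are of one colour, `v`, `u` of the other. The fields `cube_black`,
`cube_white` say that the three equations are consistent around a cube with a lower horizontal
face, based at a lower corner of the colour of `x`, respectively of `v`; `edgeL` and `edgeU` are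
the analogues of `QuadEq.edge` for the vertical edges `xu` and `vy`. -/
structure VertEq (L U : QuadEq) where
  q : ℂ → ℂ → ℂ → ℂ → ℂ → ℂ → ℂ
  slopeY : ℂ → ℂ → ℂ → ℂ → ℂ → ℂ
  slopeU : ℂ → ℂ → ℂ → ℂ → ℂ → ℂ
  edgeL : ℂ → ℂ → ℂ → ℂ
  edgeU : ℂ → ℂ → ℂ → ℂ
  eq_y : ∀ r t x v u y, q r t x v u y = q r t x v u 0 + y * slopeY r t x v u
  eq_u : ∀ r t x v u y, q r t x v u y = q r t x v 0 y + u * slopeU r t x v y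
  reg : ∀ {n : ℕ} {p : Fin n → ℂ} {fr ft fx fv fu fy : (Fin n → ℂ) → ℂ} {r t x v u y : ℂ},
    RegAt p fr r → RegAt p ft t → RegAt p fx x → RegAt p fv v → RegAt p fu u → RegAt p fy y →
      RegAt p (fun z => q (fr z) (ft z) (fx z) (fv z) (fu z) (fy z)) (q r t x v u y)
  reg_edgeL : ∀ {n : ℕ} {p : Fin n → ℂ} {fr fx fu : (Fin n → ℂ) → ℂ} {r x u : ℂ},
    RegAt p fr r → RegAt p fx x → RegAt p fu u →
      RegAt p (fun z => edgeL (fr z) (fx z) (fu z)) (edgeL r x u)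
  reg_edgeU : ∀ {n : ℕ} {p : Fin n → ℂ} {fr fy fv : (Fin n → ℂ) → ℂ} {r y v : ℂ},
    RegAt p fr r → RegAt p fy y → RegAt p fv v →
      RegAt p (fun z => edgeU (fr z) (fy z) (fv z)) (edgeU r y v)
  cube_black : ∀ r a b x u v m xab ya yb z,
    L.q a b x u v 0 + xab * L.slopeY a b x u v = 0 → L.slopeY a b x u v ≠ 0 →
    q r a x u m 0 + ya * slopeY r a x u m = 0 → slopeY r a x u m ≠ 0 →
    q r b x v m 0 + yb * slopeY r b x v m = 0 → slopeY r b x v m ≠ 0 →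
    q r b xab u 0 ya + z * slopeU r b xab u ya = 0 → slopeU r b xab u ya ≠ 0 →
      q r a xab v 0 yb + z * slopeU r a xab v yb = 0 ∧
      U.q a b ya m 0 yb + z * U.slopeV a b ya m yb = 0
  cube_white : ∀ r a b v xa xb y w ua ub z,
    L.q a b xa v 0 xb + w * L.slopeV a b xa v xb = 0 → L.slopeV a b xa v xb ≠ 0 →
    q r a xa v 0 y + ua * slopeU r a xa v y = 0 → slopeU r a xa v y ≠ 0 →
    q r b xb v 0 y + ub * slopeU r b xb v y = 0 → slopeU r b xb v y ≠ 0 →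
    q r b xa w ua 0 + z * slopeY r b xa w ua = 0 → slopeY r b xa w ua ≠ 0 →
      q r a xb w ub 0 + z * slopeY r a xb w ub = 0 ∧
      U.q a b y ua ub 0 + z * U.slopeY a b y ua ub = 0

namespace VertEq

variable {L U : QuadEq} (V : VertEq L U)

theorem slopeY_eq (r t x v u : ℂ) : V.slopeY r t x v u = V.q r t x v u 1 - V.q r t x v u 0 := by
  rw [V.eq_y r t x v u 1]
  ring

theorem slopeU_eq (r t x v y : ℂ) : V.slopeU r t x v y = V.q r t x v 1 y - V.q r t x v 0 y := by
  rw [V.eq_u r t x v 1 y]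
  ring

theorem black {r a b x u v m xab ya yb z : ℂ}
    (h1 : L.q a b x u v xab = 0) (n1 : L.slopeY a b x u v ≠ 0)
    (h2 : V.q r a x u m ya = 0) (n2 : V.slopeY r a x u m ≠ 0)
    (h3 : V.q r b x v m yb = 0) (n3 : V.slopeY r b x v m ≠ 0)
    (h4 : V.q r b xab u z ya = 0) (n4 : V.slopeU r b xab u ya ≠ 0) :
    V.q r a xab v z yb = 0 ∧ U.q a b ya m z yb = 0 := by
  rw [L.eq_y] at h1
  rw [V.eq_y] at h2 h3
  rw [V.eq_u] at h4 ⊢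
  rw [U.eq_v]
  exact V.cube_black r a b x u v m xab ya yb z h1 n1 h2 n2 h3 n3 h4 n4

theorem white {r a b v xa xb y w ua ub z : ℂ}
    (h1 : L.q a b xa v w xb = 0) (n1 : L.slopeV a b xa v xb ≠ 0)
    (h2 : V.q r a xa v ua y = 0) (n2 : V.slopeU r a xa v y ≠ 0)
    (h3 : V.q r b xb v ub y = 0) (n3 : V.slopeU r b xb v y ≠ 0)
    (h4 : V.q r b xa w ua z = 0) (n4 : V.slopeY r b xa w ua ≠ 0) :
    V.q r a xb w ub z = 0 ∧ U.q a b y ua ub z = 0 := by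
  rw [L.eq_v] at h1
  rw [V.eq_u] at h2 h3
  rw [V.eq_y] at h4 ⊢
  rw [U.eq_y]
  exact V.cube_white r a b v xa xb y w ua ub z h1 n1 h2 n2 h3 n3 h4 n4

section Reg

variable {n : ℕ} {p : Fin n → ℂ} {fr ft fx fv fu fy : (Fin n → ℂ) → ℂ} {r t x v u y : ℂ}

theorem eventually_slopeY (hr : RegAt p fr r) (ht : RegAt p ft t) (hx : RegAt p fx x)
    (hv : RegAt p fv v) (hu : RegAt p fu u) (h : V.slopeY r t x v u ≠ 0) :
    ∀ᶠ z in genericFilter n, V.slopeY (fr z) (ft z) (fx z) (fv z) (fu z) ≠ 0 := by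
  simp only [slopeY_eq] at h ⊢
  exact ((V.reg hr ht hx hv hu (.const 1)).sub
    (V.reg hr ht hx hv hu (.const 0))).eventually_ne_zero h

theorem eventually_slopeU (hr : RegAt p fr r) (ht : RegAt p ft t) (hx : RegAt p fx x)
    (hv : RegAt p fv v) (hy : RegAt p fy y) (h : V.slopeU r t x v y ≠ 0) :
    ∀ᶠ z in genericFilter n, V.slopeU (fr z) (ft z) (fx z) (fv z) (fy z) ≠ 0 := by
  simp only [slopeU_eq] at h ⊢
  exact ((V.reg hr ht hx hv (.const 1) hy).sub
    (V.reg hr ht hx hv (.const 0) hy)).eventually_ne_zero h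

theorem exists_y (hr : RegAt p fr r) (ht : RegAt p ft t) (hx : RegAt p fx x)
    (hv : RegAt p fv v) (hu : RegAt p fu u) (h0 : V.q r t x v u y = 0)
    (h : V.slopeY r t x v u ≠ 0) :
    ∃ f : (Fin n → ℂ) → ℂ, RegAt p f y ∧
      ∀ᶠ z in genericFilter n, V.q (fr z) (ft z) (fx z) (fv z) (fu z) (f z) = 0 :=
  RegAt.exists_root (q := fun z t' => V.q (fr z) (ft z) (fx z) (fv z) (fu z) t')
    (r := fun t' => V.q r t x v u t')
    (fun z t' => by rw [V.eq_y, slopeY_eq]) (fun t' => by rw [V.eq_y, slopeY_eq])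
    (V.reg hr ht hx hv hu (.const 0)) (V.reg hr ht hx hv hu (.const 1)) h0
    (by rwa [slopeY_eq] at h)

theorem exists_u (hr : RegAt p fr r) (ht : RegAt p ft t) (hx : RegAt p fx x)
    (hv : RegAt p fv v) (hy : RegAt p fy y) (h0 : V.q r t x v u y = 0)
    (h : V.slopeU r t x v y ≠ 0) :
    ∃ f : (Fin n → ℂ) → ℂ, RegAt p f u ∧
      ∀ᶠ z in genericFilter n, V.q (fr z) (ft z) (fx z) (fv z) (f z) (fy z) = 0 :=
  RegAt.exists_root (q := fun z t' => V.q (fr z) (ft z) (fx z) (fv z) t' (fy z))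
    (r := fun t' => V.q r t x v t' y)
    (fun z t' => by rw [V.eq_u, slopeU_eq]) (fun t' => by rw [V.eq_u, slopeU_eq])
    (V.reg hr ht hx hv (.const 0) hy) (V.reg hr ht hx hv (.const 1) hy) h0
    (by rwa [slopeU_eq] at h)

end Reg

end VertEq

theorem VertEq.eventually_edgeL {L U : QuadEq} (V : VertEq L U) {n : ℕ} {p : Fin n → ℂ}
    {fr fx fu : (Fin n → ℂ) → ℂ} {r x u : ℂ} (hr : RegAt p fr r) (hx : RegAt p fx x)
    (hu : RegAt p fu u) (h : V.edgeL r x u ≠ 0) :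
    ∀ᶠ z in genericFilter n, V.edgeL (fr z) (fx z) (fu z) ≠ 0 :=
  (V.reg_edgeL hr hx hu).eventually_ne_zero h

theorem VertEq.eventually_edgeU {L U : QuadEq} (V : VertEq L U) {n : ℕ} {p : Fin n → ℂ}
    {fr fy fv : (Fin n → ℂ) → ℂ} {r y v : ℂ} (hr : RegAt p fr r) (hy : RegAt p fy y)
    (hv : RegAt p fv v) (h : V.edgeU r y v ≠ 0) :
    ∀ᶠ z in genericFilter n, V.edgeU (fr z) (fy z) (fv z) ≠ 0 :=
  (V.reg_edgeU hr hy hv).eventually_ne_zero h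

/-! ### From quad equations to equations centred at a vertex -/

/-- Regularity of a face-centered quad equation: it is affine in each corner variable, and at
nonzero parameters it preserves regularity of rational functions. -/
structure FCQuad.IsRegular (Q : FCQuad) : Prop where
  affine_a : ∀ x xa xb xc xd al be, Q x xa xb xc xd al be
    = Q x 0 xb xc xd al be + xa * (Q x 1 xb xc xd al be - Q x 0 xb xc xd al be)
  affine_b : ∀ x xa xb xc xd al be, Q x xa xb xc xd al be
    = Q x xa 0 xc xd al be + xb * (Q x xa 1 xc xd al be - Q x xa 0 xc xd al be)
  affine_c : ∀ x xa xb xc xd al be, Q x xa xb xc xd al be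
    = Q x xa xb 0 xd al be + xc * (Q x xa xb 1 xd al be - Q x xa xb 0 xd al be)
  affine_d : ∀ x xa xb xc xd al be, Q x xa xb xc xd al be
    = Q x xa xb xc 0 al be + xd * (Q x xa xb xc 1 al be - Q x xa xb xc 0 al be)
  reg : ∀ {n : ℕ} {p : Fin n → ℂ} {fx fa fb fc fd f1 f2 f3 f4 : (Fin n → ℂ) → ℂ}
    {x xa xb xc xd a b c d : ℂ}, RegAt p fx x → RegAt p fa xa → RegAt p fb xb → RegAt p fc xc →
    RegAt p fd xd → RegAt p f1 a → RegAt p f2 b → RegAt p f3 c → RegAt p f4 d →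
    a ≠ 0 → b ≠ 0 → c ≠ 0 → d ≠ 0 →
    RegAt p (fun v => Q (fx v) (fa v) (fb v) (fc v) (fd v) (f1 v, f2 v) (f3 v, f4 v))
      (Q x xa xb xc xd (a, b) (c, d))

/-- The product of the four quad equations around a vertex `x` of a layer is the type-A equation
`A` centred at `x`. -/
def CentersA (D : QuadEq) (A : FCQuad) : Prop :=
  ∀ {a b c d x va vb vc vd xa xb xc xd : ℂ},
    D.edge a x va ≠ 0 → D.edge b x vb ≠ 0 → D.edge c x vc ≠ 0 → D.edge d x vd ≠ 0 →
    D.q b c x vb vc xa = 0 → D.q b d x vb vd xb = 0 → D.q a c x va vc xc = 0 →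
    D.q a d x va vd xd = 0 → A x xa xb xc xd (a, b) (c, d) = 0

/-- The product of the two lower and two vertical quad equations around a vertex `x` of the lower
layer is the type-C equation `C` centred at `x`. -/
def CentersLower {L U : QuadEq} (V : VertEq L U) (C : FCQuad) : Prop :=
  ∀ {a b c d x va vb vc vd xa xb xc xd : ℂ},
    V.edgeL a x va ≠ 0 → L.edge b x vb ≠ 0 → L.edge c x vc ≠ 0 → L.edge d x vd ≠ 0 →
    L.q b c x vb vc xa = 0 → L.q b d x vb vd xb = 0 → V.q a c x vc va xc = 0 →
    V.q a d x vd va xd = 0 → C x xa xb xc xd (a, b) (c, d) = 0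

/-- The product of the two upper and two vertical quad equations around a vertex `x` of the upper
layer is the type-C equation `C` centred at `x`. -/
def CentersUpper {L U : QuadEq} (V : VertEq L U) (C : FCQuad) : Prop :=
  ∀ {a b c d x va vb vc vd xa xb xc xd : ℂ},
    V.edgeU a x va ≠ 0 → U.edge b x vb ≠ 0 → U.edge c x vc ≠ 0 → U.edge d x vd ≠ 0 →
    U.q b c x vb vc xa = 0 → U.q b d x vb vd xb = 0 → V.q a c xc va vc x = 0 →
    V.q a d xd va vd x = 0 → C x xa xb xc xd (a, b) (c, d) = 0

/-! ### The face-centered cube inside a six-dimensional cube -/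

/-- Vertices of the six-dimensional cube `{0,1}⁶` with directions `α₁, α₂, β₁, β₂, γ₁, γ₂` that do
not involve `β₁, β₂`, together with the parameters of the other four directions: `r, s, g, h` are
`α₁, α₂, γ₁, γ₂`. A vertex is given by the set of directions in which its coordinate is `1`:
`x = ∅`, `a = {α₂}`, `u = {α₁}`, `c = {γ₁}`, `d = {γ₂}`, `zn = {α₂,γ₁}`, `zs = {α₁,γ₁}`,
`y = {γ₁,γ₂}`, `k = {α₂,γ₁,γ₂}`, `l = {α₁,γ₁,γ₂}`. The even ones are variables of the
face-centered cube, the odd ones are auxiliary. -/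
structure Spine where
  (r s g h x a u c d zn zs y k l : ℂ)

/-- Vertices of the six-dimensional cube that involve one of `β₁, β₂`, with parameter `t`. With `β`
denoting that direction: `b = {β}`, `xa = {α₂,β}`, `xc = {α₁,β}`, `p = {β,γ₁}`, `z = {β,γ₂}`,
`m = {α₂,β,γ₁}`, `m' = {α₂,β,γ₂}`, `n = {β,γ₁,γ₂}`, `e = {α₁,β,γ₁}`, `e' = {α₁,β,γ₂}`,
`ya = {α₂,β,γ₁,γ₂}`, `yc = {α₁,β,γ₁,γ₂}`. -/
structure Side where
  (t b xa xc p z m m' n e e' ya yc : ℂ)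

/-- Defining equations and nondegeneracy conditions for the vertices in `P` and `S`: each vertex
beyond the initial ones is determined by one quad equation, and the vanishing of no slope or edge
factor obstructs the consistency arguments. -/
structure Block {L U : QuadEq} (V : VertEq L U) (P : Spine) (S : Side) : Prop where
  xa : L.q P.s S.t P.x P.a S.b S.xa = 0
  xc : V.q P.r S.t P.x S.b P.u S.xc = 0
  zn : L.q P.s P.g P.x P.a P.c P.zn = 0
  zs : V.q P.r P.g P.x P.c P.u P.zs = 0
  y : L.q P.g P.h P.x P.c P.d P.y = 0
  k : L.q P.s P.h P.zn P.c P.k P.y = 0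
  l : V.q P.r P.h P.y P.c P.l P.zs = 0
  p : L.q S.t P.g P.x S.b P.c S.p = 0
  z : L.q S.t P.h P.x S.b P.d S.z = 0
  m : L.q P.s P.g S.xa S.b S.m S.p = 0
  m' : L.q P.s P.h S.xa S.b S.m' S.z = 0
  n : L.q P.g P.h S.p S.b S.n S.z = 0
  e : V.q P.r P.g S.p S.b S.e S.xc = 0
  e' : V.q P.r P.h S.z S.b S.e' S.xc = 0
  ya : L.q P.s P.h S.p S.m S.n S.ya = 0
  yc : V.q P.r P.h S.p S.n S.e S.yc = 0
  xa_ne : L.slopeY S.t P.s P.x S.b P.a ≠ 0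
  xc_ne : V.slopeY P.r S.t P.x S.b P.u ≠ 0
  zn_ne : L.slopeY P.s P.g P.x P.a P.c ≠ 0
  zn_ne' : L.slopeY P.g P.s P.x P.c P.a ≠ 0
  zs_ne : V.slopeY P.r P.g P.x P.c P.u ≠ 0
  y_ne : L.slopeY P.g P.h P.x P.c P.d ≠ 0
  k_ne : L.slopeV P.s P.h P.zn P.c P.y ≠ 0
  k_ne' : L.slopeV P.h P.s P.y P.c P.zn ≠ 0
  l_ne : V.slopeU P.r P.h P.y P.c P.zs ≠ 0
  p_ne : L.slopeY S.t P.g P.x S.b P.c ≠ 0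
  z_ne : L.slopeY S.t P.h P.x S.b P.d ≠ 0
  m_ne : L.slopeV P.s P.g S.xa S.b S.p ≠ 0
  m_ne' : L.slopeV P.g P.s S.p S.b S.xa ≠ 0
  m'_ne : L.slopeV P.s P.h S.xa S.b S.z ≠ 0
  m'_ne' : L.slopeV P.h P.s S.z S.b S.xa ≠ 0
  n_ne : L.slopeV P.g P.h S.p S.b S.z ≠ 0
  e_ne : V.slopeU P.r P.g S.p S.b S.xc ≠ 0
  e'_ne : V.slopeU P.r P.h S.z S.b S.xc ≠ 0
  ya_ne : L.slopeY P.s P.h S.p S.m S.n ≠ 0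
  ya_ne' : L.slopeY P.h P.s S.p S.n S.m ≠ 0
  yc_ne : V.slopeY P.r P.h S.p S.n S.e ≠ 0
  p_m_ne : L.slopeV S.t P.s S.p P.c P.zn ≠ 0
  p_n_ne : L.slopeV S.t P.h S.p P.c P.y ≠ 0
  p_e_ne : V.slopeU P.r S.t S.p P.c P.zs ≠ 0
  x_a : L.edge P.s P.x P.a ≠ 0
  x_b : L.edge S.t P.x S.b ≠ 0
  x_u : V.edgeL P.r P.x P.u ≠ 0
  y_k : L.edge P.s P.y P.k ≠ 0
  y_n : L.edge S.t P.y S.n ≠ 0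
  y_l : V.edgeL P.r P.y P.l ≠ 0
  zn_a : L.edge P.g P.zn P.a ≠ 0
  zn_k : L.edge P.h P.zn P.k ≠ 0
  zn_m : L.edge S.t P.zn S.m ≠ 0
  z_b : L.edge P.h S.z S.b ≠ 0
  z_n : L.edge P.g S.z S.n ≠ 0
  z_m' : L.edge P.s S.z S.m' ≠ 0
  z_e' : V.edgeL P.r S.z S.e' ≠ 0
  xa_b : L.edge P.s S.xa S.b ≠ 0
  xa_a : L.edge S.t S.xa P.a ≠ 0
  xa_m : L.edge P.g S.xa S.m ≠ 0
  xa_m' : L.edge P.h S.xa S.m' ≠ 0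
  ya_m : L.edge P.h S.ya S.m ≠ 0
  ya_m' : L.edge P.g S.ya S.m' ≠ 0
  ya_n : L.edge P.s S.ya S.n ≠ 0
  ya_k : L.edge S.t S.ya P.k ≠ 0
  xc_u : U.edge S.t S.xc P.u ≠ 0
  xc_e : U.edge P.g S.xc S.e ≠ 0
  xc_e' : U.edge P.h S.xc S.e' ≠ 0
  xc_b : V.edgeU P.r S.xc S.b ≠ 0
  zs_u : U.edge P.g P.zs P.u ≠ 0
  zs_l : U.edge P.h P.zs P.l ≠ 0
  zs_e : U.edge S.t P.zs S.e ≠ 0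
  yc_e : U.edge P.h S.yc S.e ≠ 0
  yc_e' : U.edge P.g S.yc S.e' ≠ 0
  yc_l : U.edge S.t S.yc P.l ≠ 0
  yc_n : V.edgeU P.r S.yc S.n ≠ 0

namespace Block

variable {L U : QuadEq} {V : VertEq L U} {P : Spine} {S T : Side}

theorem xa_zn (H : Block V P S) : L.q S.t P.g S.xa P.a S.m P.zn = 0 :=
  L.black (L.swap H.xa) H.xa_ne H.p H.p_ne H.zn H.zn_ne H.m H.m_ne

theorem p_zn (H : Block V P S) : L.q S.t P.s S.p P.c S.m P.zn = 0 :=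
  L.black H.p H.p_ne (L.swap H.xa) H.xa_ne (L.swap H.zn) H.zn_ne' (L.swap (L.flip H.m)) H.m_ne'

theorem p_y (H : Block V P S) : L.q S.t P.h S.p P.c S.n P.y = 0 :=
  L.black H.p H.p_ne H.z H.z_ne H.y H.y_ne H.n H.n_ne

theorem p_zs_and_xc_zs (H : Block V P S) :
    V.q P.r S.t S.p P.c S.e P.zs = 0 ∧ U.q S.t P.g S.xc P.u S.e P.zs = 0 :=
  V.black H.p H.p_ne H.xc H.xc_ne H.zs H.zs_ne H.e H.e_ne

theorem xa_ya (H : Block V P S) : L.q P.g P.h S.xa S.m S.m' S.ya = 0 :=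
  L.white (L.swap (L.flip H.m)) H.m_ne' H.n H.n_ne H.m' H.m'_ne H.ya H.ya_ne

theorem z_ya (H : Block V P S) : L.q P.g P.s S.z S.n S.m' S.ya = 0 :=
  L.white H.n H.n_ne (L.swap (L.flip H.m)) H.m_ne' (L.swap (L.flip H.m')) H.m'_ne'
    (L.swap H.ya) H.ya_ne'

theorem zn_ya (H : Block V P S) : L.q S.t P.h P.zn S.m P.k S.ya = 0 :=
  L.white H.p_zn H.p_m_ne H.p_y H.p_n_ne H.k H.k_ne H.ya H.ya_ne

theorem y_ya (H : Block V P S) : L.q S.t P.s P.y S.n P.k S.ya = 0 :=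
  L.white H.p_y H.p_n_ne H.p_zn H.p_m_ne (L.swap (L.flip H.k)) H.k_ne' (L.swap H.ya) H.ya_ne'

theorem z_yc_and_xc_yc (H : Block V P S) :
    V.q P.r P.g S.z S.n S.e' S.yc = 0 ∧ U.q P.g P.h S.xc S.e S.e' S.yc = 0 :=
  V.white H.n H.n_ne H.e H.e_ne H.e' H.e'_ne H.yc H.yc_ne

theorem y_yc_and_zs_yc (H : Block V P S) :
    V.q P.r S.t P.y S.n P.l S.yc = 0 ∧ U.q S.t P.h P.zs S.e P.l S.yc = 0 :=
  V.white H.p_y H.p_n_ne H.p_zs_and_xc_zs.1 H.p_e_ne H.l H.l_ne H.yc H.yc_ne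

variable {A A' C C' : FCQuad}

/-- All fourteen equations of the face-centered cube follow from the quad equations of the
six-dimensional cube, since each of the fourteen vertices is the centre of four squares. -/
theorem fourteenEquations (HA : CentersA L A) (HA' : CentersA U A') (HC : CentersLower V C)
    (HC' : CentersUpper V C') (H : Block V P S) (K : Block V P T) :
    FourteenEquations A A' C C' P.r P.s S.t T.t P.g P.h P.x S.xa T.xa S.xc T.xc
      P.y S.ya T.ya S.yc T.yc P.zn T.z P.zs S.z := by
  refine ⟨⟨?_, ?_, ?_, ?_, ?_, ?_⟩, ?_, ?_, ?_, ?_, ?_, ?_, ?_, ?_⟩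
  · exact HC H.x_u H.x_a H.x_b K.x_b H.xa K.xa H.xc K.xc
  · exact HC H.y_l H.y_k H.y_n K.y_n (L.swap H.y_ya) (L.swap K.y_ya) H.y_yc_and_zs_yc.1
      K.y_yc_and_zs_yc.1
  · exact HC H.z_e' H.z_m' H.z_n H.z_b (L.swap H.z_ya) (L.flip H.m') H.z_yc_and_xc_yc.1 H.e'
  · exact HC K.z_e' K.z_m' K.z_n K.z_b (L.swap K.z_ya) (L.flip K.m') K.z_yc_and_xc_yc.1 K.e'
  · exact HA H.zn_a H.zn_k H.zn_m K.zn_m (L.swap H.zn_ya) (L.swap K.zn_ya)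
      (L.swap (L.flip H.xa_zn)) (L.swap (L.flip K.xa_zn))
  · exact HA' H.zs_u H.zs_l H.zs_e K.zs_e (U.swap H.y_yc_and_zs_yc.2) (U.swap K.y_yc_and_zs_yc.2)
      (U.swap (U.flip H.p_zs_and_xc_zs.2)) (U.swap (U.flip K.p_zs_and_xc_zs.2))
  · exact HA H.xa_a H.xa_m' H.xa_b H.xa_m (L.swap H.m') (L.swap H.xa_ya)
      (L.swap (L.flip H.xa)) H.xa_zn
  · exact HA K.xa_a K.xa_m' K.xa_b K.xa_m (L.swap K.m') (L.swap K.xa_ya)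
      (L.swap (L.flip K.xa)) K.xa_zn
  · exact HC' H.xc_b H.xc_e H.xc_u H.xc_e' (U.swap H.p_zs_and_xc_zs.2) H.z_yc_and_xc_yc.2
      H.xc H.e'
  · exact HC' K.xc_b K.xc_e K.xc_e' K.xc_u K.z_yc_and_xc_yc.2 (U.swap K.p_zs_and_xc_zs.2)
      K.e' K.xc
  · exact HA H.ya_k H.ya_m' H.ya_n H.ya_m (L.flip H.z_ya) (L.flip H.xa_ya)
      (L.flip H.y_ya) (L.flip H.zn_ya)
  · exact HA K.ya_k K.ya_m' K.ya_n K.ya_m (L.flip K.z_ya) (L.flip K.xa_ya)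
      (L.flip K.y_ya) (L.flip K.zn_ya)
  · exact HC' H.yc_n H.yc_e H.yc_e' H.yc_l (U.swap (U.flip H.z_yc_and_xc_yc.2))
      (U.swap (U.flip H.y_yc_and_zs_yc.2)) H.z_yc_and_xc_yc.1 H.y_yc_and_zs_yc.1
  · exact HC' K.yc_n K.yc_e K.yc_e' K.yc_l (U.swap (U.flip K.z_yc_and_xc_yc.2))
      (U.swap (U.flip K.y_yc_and_zs_yc.2)) K.z_yc_and_xc_yc.1 K.y_yc_and_zs_yc.1

end Block

/-! ### Extending a lattice point to generic initial values -/

/-- A generically defined rational family of spines that is regular at `o`, with value `P`. -/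
structure Spine.RegAt {N : ℕ} (o : Fin N → ℂ) (F : (Fin N → ℂ) → Spine) (P : Spine) : Prop where
  r : _root_.RegAt o (fun v => (F v).r) P.r
  s : _root_.RegAt o (fun v => (F v).s) P.s
  g : _root_.RegAt o (fun v => (F v).g) P.g
  h : _root_.RegAt o (fun v => (F v).h) P.h
  x : _root_.RegAt o (fun v => (F v).x) P.x
  a : _root_.RegAt o (fun v => (F v).a) P.a
  u : _root_.RegAt o (fun v => (F v).u) P.u
  c : _root_.RegAt o (fun v => (F v).c) P.c
  d : _root_.RegAt o (fun v => (F v).d) P.d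
  zn : _root_.RegAt o (fun v => (F v).zn) P.zn
  zs : _root_.RegAt o (fun v => (F v).zs) P.zs
  y : _root_.RegAt o (fun v => (F v).y) P.y
  k : _root_.RegAt o (fun v => (F v).k) P.k
  l : _root_.RegAt o (fun v => (F v).l) P.l

/-- A generically defined rational family of sides that is regular at `o`, with value `S`. -/
structure Side.RegAt {N : ℕ} (o : Fin N → ℂ) (G : (Fin N → ℂ) → Side) (S : Side) : Prop where
  t : _root_.RegAt o (fun v => (G v).t) S.t
  b : _root_.RegAt o (fun v => (G v).b) S.b
  xa : _root_.RegAt o (fun v => (G v).xa) S.xa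
  xc : _root_.RegAt o (fun v => (G v).xc) S.xc
  p : _root_.RegAt o (fun v => (G v).p) S.p
  z : _root_.RegAt o (fun v => (G v).z) S.z
  m : _root_.RegAt o (fun v => (G v).m) S.m
  m' : _root_.RegAt o (fun v => (G v).m') S.m'
  n : _root_.RegAt o (fun v => (G v).n) S.n
  e : _root_.RegAt o (fun v => (G v).e) S.e
  e' : _root_.RegAt o (fun v => (G v).e') S.e'
  ya : _root_.RegAt o (fun v => (G v).ya) S.ya
  yc : _root_.RegAt o (fun v => (G v).yc) S.yc

/-- The nondegeneracy conditions of a block are generic: for rational families it suffices that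
they hold at one point. -/
theorem Block.eventually {L U : QuadEq} {V : VertEq L U} {N : ℕ} {p : Fin N → ℂ}
    {F : (Fin N → ℂ) → Spine} {G : (Fin N → ℂ) → Side} {P : Spine} {S : Side}
    (hF : Spine.RegAt p F P) (hG : Side.RegAt p G S) (H : Block V P S)
    (h_xa : ∀ᶠ v in genericFilter N, L.q (F v).s (G v).t (F v).x (F v).a (G v).b (G v).xa = 0)
    (h_xc : ∀ᶠ v in genericFilter N, V.q (F v).r (G v).t (F v).x (G v).b (F v).u (G v).xc = 0)
    (h_zn : ∀ᶠ v in genericFilter N, L.q (F v).s (F v).g (F v).x (F v).a (F v).c (F v).zn = 0)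
    (h_zs : ∀ᶠ v in genericFilter N, V.q (F v).r (F v).g (F v).x (F v).c (F v).u (F v).zs = 0)
    (h_y : ∀ᶠ v in genericFilter N, L.q (F v).g (F v).h (F v).x (F v).c (F v).d (F v).y = 0)
    (h_k : ∀ᶠ v in genericFilter N, L.q (F v).s (F v).h (F v).zn (F v).c (F v).k (F v).y = 0)
    (h_l : ∀ᶠ v in genericFilter N, V.q (F v).r (F v).h (F v).y (F v).c (F v).l (F v).zs = 0)
    (h_p : ∀ᶠ v in genericFilter N, L.q (G v).t (F v).g (F v).x (G v).b (F v).c (G v).p = 0)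
    (h_z : ∀ᶠ v in genericFilter N, L.q (G v).t (F v).h (F v).x (G v).b (F v).d (G v).z = 0)
    (h_m : ∀ᶠ v in genericFilter N, L.q (F v).s (F v).g (G v).xa (G v).b (G v).m (G v).p = 0)
    (h_m2 : ∀ᶠ v in genericFilter N, L.q (F v).s (F v).h (G v).xa (G v).b (G v).m' (G v).z = 0)
    (h_n : ∀ᶠ v in genericFilter N, L.q (F v).g (F v).h (G v).p (G v).b (G v).n (G v).z = 0)
    (h_e : ∀ᶠ v in genericFilter N, V.q (F v).r (F v).g (G v).p (G v).b (G v).e (G v).xc = 0)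
    (h_e2 : ∀ᶠ v in genericFilter N, V.q (F v).r (F v).h (G v).z (G v).b (G v).e' (G v).xc = 0)
    (h_ya : ∀ᶠ v in genericFilter N, L.q (F v).s (F v).h (G v).p (G v).m (G v).n (G v).ya = 0)
    (h_yc : ∀ᶠ v in genericFilter N, V.q (F v).r (F v).h (G v).p (G v).n (G v).e (G v).yc = 0) :
    ∀ᶠ v in genericFilter N, Block V (F v) (G v) := by
  filter_upwards [h_xa, h_xc, h_zn, h_zs, h_y, h_k, h_l, h_p, h_z, h_m, h_m2, h_n, h_e, h_e2, h_ya, h_yc,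
    L.eventually_slopeY hG.t hF.s hF.x hG.b hF.a H.xa_ne,
    V.eventually_slopeY hF.r hG.t hF.x hG.b hF.u H.xc_ne,
    L.eventually_slopeY hF.s hF.g hF.x hF.a hF.c H.zn_ne,
    L.eventually_slopeY hF.g hF.s hF.x hF.c hF.a H.zn_ne',
    V.eventually_slopeY hF.r hF.g hF.x hF.c hF.u H.zs_ne,
    L.eventually_slopeY hF.g hF.h hF.x hF.c hF.d H.y_ne,
    L.eventually_slopeV hF.s hF.h hF.zn hF.c hF.y H.k_ne,
    L.eventually_slopeV hF.h hF.s hF.y hF.c hF.zn H.k_ne',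
    V.eventually_slopeU hF.r hF.h hF.y hF.c hF.zs H.l_ne,
    L.eventually_slopeY hG.t hF.g hF.x hG.b hF.c H.p_ne,
    L.eventually_slopeY hG.t hF.h hF.x hG.b hF.d H.z_ne,
    L.eventually_slopeV hF.s hF.g hG.xa hG.b hG.p H.m_ne,
    L.eventually_slopeV hF.g hF.s hG.p hG.b hG.xa H.m_ne',
    L.eventually_slopeV hF.s hF.h hG.xa hG.b hG.z H.m'_ne,
    L.eventually_slopeV hF.h hF.s hG.z hG.b hG.xa H.m'_ne',
    L.eventually_slopeV hF.g hF.h hG.p hG.b hG.z H.n_ne,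
    V.eventually_slopeU hF.r hF.g hG.p hG.b hG.xc H.e_ne,
    V.eventually_slopeU hF.r hF.h hG.z hG.b hG.xc H.e'_ne,
    L.eventually_slopeY hF.s hF.h hG.p hG.m hG.n H.ya_ne,
    L.eventually_slopeY hF.h hF.s hG.p hG.n hG.m H.ya_ne',
    V.eventually_slopeY hF.r hF.h hG.p hG.n hG.e H.yc_ne,
    L.eventually_slopeV hG.t hF.s hG.p hF.c hF.zn H.p_m_ne,
    L.eventually_slopeV hG.t hF.h hG.p hF.c hF.y H.p_n_ne,
    V.eventually_slopeU hF.r hG.t hG.p hF.c hF.zs H.p_e_ne,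
    L.eventually_edge hF.s hF.x hF.a H.x_a,
    L.eventually_edge hG.t hF.x hG.b H.x_b,
    V.eventually_edgeL hF.r hF.x hF.u H.x_u,
    L.eventually_edge hF.s hF.y hF.k H.y_k,
    L.eventually_edge hG.t hF.y hG.n H.y_n,
    V.eventually_edgeL hF.r hF.y hF.l H.y_l,
    L.eventually_edge hF.g hF.zn hF.a H.zn_a,
    L.eventually_edge hF.h hF.zn hF.k H.zn_k,
    L.eventually_edge hG.t hF.zn hG.m H.zn_m,
    L.eventually_edge hF.h hG.z hG.b H.z_b,
    L.eventually_edge hF.g hG.z hG.n H.z_n,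
    L.eventually_edge hF.s hG.z hG.m' H.z_m',
    V.eventually_edgeL hF.r hG.z hG.e' H.z_e',
    L.eventually_edge hF.s hG.xa hG.b H.xa_b,
    L.eventually_edge hG.t hG.xa hF.a H.xa_a,
    L.eventually_edge hF.g hG.xa hG.m H.xa_m,
    L.eventually_edge hF.h hG.xa hG.m' H.xa_m',
    L.eventually_edge hF.h hG.ya hG.m H.ya_m,
    L.eventually_edge hF.g hG.ya hG.m' H.ya_m',
    L.eventually_edge hF.s hG.ya hG.n H.ya_n,
    L.eventually_edge hG.t hG.ya hF.k H.ya_k,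
    U.eventually_edge hG.t hG.xc hF.u H.xc_u,
    U.eventually_edge hF.g hG.xc hG.e H.xc_e,
    U.eventually_edge hF.h hG.xc hG.e' H.xc_e',
    V.eventually_edgeU hF.r hG.xc hG.b H.xc_b,
    U.eventually_edge hF.g hF.zs hF.u H.zs_u,
    U.eventually_edge hF.h hF.zs hF.l H.zs_l,
    U.eventually_edge hG.t hF.zs hG.e H.zs_e,
    U.eventually_edge hF.h hG.yc hG.e H.yc_e,
    U.eventually_edge hF.g hG.yc hG.e' H.yc_e',
    U.eventually_edge hG.t hG.yc hF.l H.yc_l,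
    V.eventually_edgeU hF.r hG.yc hG.n H.yc_n] with v
  intros
  constructor <;> assumption

/-- One side of the cube extends to nearby generic values: given the spine and the entries
`t`, `b`, `xa`, `xc`, `z` of the side as rational functions, the other vertices of the side are
solved for one at a time from affine equations, and `Block` holds generically. -/
theorem Block.exists_side {L U : QuadEq} {V : VertEq L U} {N : ℕ} {o : Fin N → ℂ}
    {F : (Fin N → ℂ) → Spine} {P : Spine} {S : Side} (hF : Spine.RegAt o F P) (H : Block V P S)
    {t b xa xc z : (Fin N → ℂ) → ℂ} (ht : RegAt o t S.t) (hb : RegAt o b S.b)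
    (hxa : RegAt o xa S.xa) (hxc : RegAt o xc S.xc) (hz : RegAt o z S.z)
    (exa : ∀ᶠ v in genericFilter N, L.q (F v).s (t v) (F v).x (F v).a (b v) (xa v) = 0)
    (exc : ∀ᶠ v in genericFilter N, V.q (F v).r (t v) (F v).x (b v) (F v).u (xc v) = 0)
    (ezn : ∀ᶠ v in genericFilter N, L.q (F v).s (F v).g (F v).x (F v).a (F v).c (F v).zn = 0)
    (ezs : ∀ᶠ v in genericFilter N, V.q (F v).r (F v).g (F v).x (F v).c (F v).u (F v).zs = 0)
    (ey : ∀ᶠ v in genericFilter N, L.q (F v).g (F v).h (F v).x (F v).c (F v).d (F v).y = 0)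
    (ek : ∀ᶠ v in genericFilter N, L.q (F v).s (F v).h (F v).zn (F v).c (F v).k (F v).y = 0)
    (el : ∀ᶠ v in genericFilter N, V.q (F v).r (F v).h (F v).y (F v).c (F v).l (F v).zs = 0)
    (ez : ∀ᶠ v in genericFilter N, L.q (t v) (F v).h (F v).x (b v) (F v).d (z v) = 0) :
    ∃ G : (Fin N → ℂ) → Side, Side.RegAt o G S ∧
      (∀ v, (G v).t = t v ∧ (G v).xa = xa v ∧ (G v).xc = xc v ∧ (G v).z = z v) ∧
      ∀ᶠ v in genericFilter N, Block V (F v) (G v) := by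
  obtain ⟨p, hp, ep⟩ := L.exists_y ht hF.g hF.x hb hF.c H.p H.p_ne
  obtain ⟨m, hm, em⟩ := L.exists_v hF.s hF.g hxa hb hp H.m H.m_ne
  obtain ⟨m', hm', em'⟩ := L.exists_v hF.s hF.h hxa hb hz H.m' H.m'_ne
  obtain ⟨n, hn, en⟩ := L.exists_v hF.g hF.h hp hb hz H.n H.n_ne
  obtain ⟨e, he, ee⟩ := V.exists_u hF.r hF.g hp hb hxc H.e H.e_ne
  obtain ⟨e', he', ee'⟩ := V.exists_u hF.r hF.h hz hb hxc H.e' H.e'_ne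
  obtain ⟨ya, hya, eya⟩ := L.exists_y hF.s hF.h hp hm hn H.ya H.ya_ne
  obtain ⟨yc, hyc, eyc⟩ := V.exists_y hF.r hF.h hp hn he H.yc H.yc_ne
  have hG : Side.RegAt o (fun v => ⟨t v, b v, xa v, xc v, p v, z v, m v, m' v, n v, e v, e' v,
      ya v, yc v⟩) S := ⟨ht, hb, hxa, hxc, hp, hz, hm, hm', hn, he, he', hya, hyc⟩
  exact ⟨_, hG, fun v => ⟨rfl, rfl, rfl, rfl⟩,
    Block.eventually hF hG H exa exc ezn ezs ey ek el ep ez em em' en ee ee' eya eyc⟩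

/-- A single nondegenerate solution of the quad equations on the six-dimensional cube, at which
each equation used in the definition of consistency has nonvanishing slope in its unknown. -/
structure LatticeWitness {L U : QuadEq} (V : VertEq L U) (A A' C C' : FCQuad) (P : Spine)
    (S T : Side) : Prop where
  side : Block V P S
  side' : Block V P T
  r_ne : P.r ≠ 0
  s_ne : P.s ≠ 0
  g_ne : P.g ≠ 0
  h_ne : P.h ≠ 0
  t_ne : S.t ≠ 0
  t'_ne : T.t ≠ 0
  b_ne : L.slopeV P.s S.t P.x P.a S.xa ≠ 0
  b'_ne : L.slopeV P.s T.t P.x P.a T.xa ≠ 0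
  u_ne : V.slopeU P.r S.t P.x S.b S.xc ≠ 0
  c_ne : L.slopeV P.s P.g P.x P.a P.zn ≠ 0
  d_ne : L.slopeV S.t P.h P.x S.b S.z ≠ 0
  ya_unique : A S.xa S.z 1 P.x P.zn (S.t, P.h) (P.s, P.g)
    - A S.xa S.z 0 P.x P.zn (S.t, P.h) (P.s, P.g) ≠ 0
  xd_unique : C P.x S.xa T.xa S.xc 1 (P.r, P.s) (S.t, T.t)
    - C P.x S.xa T.xa S.xc 0 (P.r, P.s) (S.t, T.t) ≠ 0
  yc_unique : C S.z S.ya S.xa 1 S.xc (P.r, P.s) (P.g, P.h)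
    - C S.z S.ya S.xa 0 S.xc (P.r, P.s) (P.g, P.h) ≠ 0
  yb_unique : A P.zn S.ya 1 S.xa T.xa (P.g, P.h) (S.t, T.t)
    - A P.zn S.ya 0 S.xa T.xa (P.g, P.h) (S.t, T.t) ≠ 0
  y_unique : A S.ya S.z S.xa 1 P.zn (S.t, P.g) (P.s, P.h)
    - A S.ya S.z S.xa 0 P.zn (S.t, P.g) (P.s, P.h) ≠ 0
  ze_xb_unique : A T.xa 1 T.ya P.x P.zn (T.t, P.h) (P.s, P.g)
    - A T.xa 0 T.ya P.x P.zn (T.t, P.h) (P.s, P.g) ≠ 0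
  ze_yb_unique : A T.ya 1 T.xa P.y P.zn (T.t, P.g) (P.s, P.h)
    - A T.ya 0 T.xa P.y P.zn (T.t, P.g) (P.s, P.h) ≠ 0
  zs_yc_unique : C' S.yc S.xc 1 S.z P.y (P.r, P.h) (P.g, S.t)
    - C' S.yc S.xc 0 S.z P.y (P.r, P.h) (P.g, S.t) ≠ 0
  zs_xc_unique : C' S.xc 1 S.yc P.x S.z (P.r, P.g) (S.t, P.h)
    - C' S.xc 0 S.yc P.x S.z (P.r, P.g) (S.t, P.h) ≠ 0
  yd_ze_unique : C T.z T.ya T.xa 1 T.xc (P.r, P.s) (P.g, P.h)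
    - C T.z T.ya T.xa 0 T.xc (P.r, P.s) (P.g, P.h) ≠ 0
  yd_zs_unique : A' P.zs S.yc 1 S.xc T.xc (P.g, P.h) (S.t, T.t)
    - A' P.zs S.yc 0 S.xc T.xc (P.g, P.h) (S.t, T.t) ≠ 0
  yd_y_unique : C P.y S.ya T.ya S.yc 1 (P.r, P.s) (S.t, T.t)
    - C P.y S.ya T.ya S.yc 0 (P.r, P.s) (S.t, T.t) ≠ 0
  yd_xd_unique : C' T.xc 1 P.zs T.z P.x (P.r, P.g) (P.h, T.t)
    - C' T.xc 0 P.zs T.z P.x (P.r, P.g) (P.h, T.t) ≠ 0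

theorem eq_zero_iff_of_affine {f : ℂ → ℂ} {t₀ : ℂ} (hf : ∀ t, f t = f 0 + t * (f 1 - f 0))
    (h0 : f t₀ = 0) (hs : f 1 - f 0 ≠ 0) (t : ℂ) : f t = 0 ↔ t = t₀ := by
  refine ⟨fun h => ?_, fun h => h ▸ h0⟩
  have e : (t - t₀) * (f 1 - f 0) = 0 := by linear_combination h - h0 - hf t + hf t₀
  exact sub_eq_zero.1 ((mul_eq_zero.1 e).resolve_right hs)

/-- Consistency around the face-centered cube follows from a lattice of quad equations whose
vertex equations are the given ones, as soon as there is one nondegenerate solution. Given generic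
initial values, the auxiliary value `a` is frozen at its value in that solution, and all other
vertices are determined rationally from it. -/
theorem LatticeWitness.cafcc {L U : QuadEq} {V : VertEq L U} {A A' C C' : FCQuad} {P : Spine}
    {S T : Side} (W : LatticeWitness V A A' C C' P S T) (HA : A.IsRegular) (HA' : A'.IsRegular)
    (HC : C.IsRegular) (HC' : C'.IsRegular) (cA : CentersA L A) (cA' : CentersA U A')
    (cC : CentersLower V C) (cC' : CentersUpper V C') : CAFCC A A' C C' := by
  let o : Fin 12 → ℂ := ![P.r, P.s, S.t, T.t, P.g, P.h, P.x, S.xa, T.xa, S.xc, P.zn, S.z]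
  have hr : RegAt o (fun v => v 0) P.r := RegAt.coord 0
  have hs : RegAt o (fun v => v 1) P.s := RegAt.coord 1
  have ht : RegAt o (fun v => v 2) S.t := RegAt.coord 2
  have ht' : RegAt o (fun v => v 3) T.t := RegAt.coord 3
  have hg : RegAt o (fun v => v 4) P.g := RegAt.coord 4
  have hh : RegAt o (fun v => v 5) P.h := RegAt.coord 5
  have hx : RegAt o (fun v => v 6) P.x := RegAt.coord 6
  have hxa : RegAt o (fun v => v 7) S.xa := RegAt.coord 7
  have hxb : RegAt o (fun v => v 8) T.xa := RegAt.coord 8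
  have hxc : RegAt o (fun v => v 9) S.xc := RegAt.coord 9
  have hzn : RegAt o (fun v => v 10) P.zn := RegAt.coord 10
  have hzw : RegAt o (fun v => v 11) S.z := RegAt.coord 11
  have ha : RegAt o (fun _ => P.a) P.a := RegAt.const _
  obtain ⟨b, hb, eb⟩ := L.exists_v hs ht hx ha hxa W.side.xa W.b_ne
  obtain ⟨b', hb', eb'⟩ := L.exists_v hs ht' hx ha hxb W.side'.xa W.b'_ne
  obtain ⟨u, hu, eu⟩ := V.exists_u hr ht hx hb hxc W.side.xc W.u_ne
  obtain ⟨c, hc, ec⟩ := L.exists_v hs hg hx ha hzn W.side.zn W.c_ne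
  obtain ⟨d, hd, ed⟩ := L.exists_v ht hh hx hb hzw W.side.z W.d_ne
  obtain ⟨xd, hxd, exd⟩ := V.exists_y hr ht' hx hb' hu W.side'.xc W.side'.xc_ne
  obtain ⟨ze, hze, eze⟩ := L.exists_y ht' hh hx hb' hd W.side'.z W.side'.z_ne
  obtain ⟨zs, hzs, ezs⟩ := V.exists_y hr hg hx hc hu W.side.zs W.side.zs_ne
  obtain ⟨y, hy, ey⟩ := L.exists_y hg hh hx hc hd W.side.y W.side.y_ne
  obtain ⟨k, hk, ek⟩ := L.exists_v hs hh hzn hc hy W.side.k W.side.k_ne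
  obtain ⟨l, hl, el⟩ := V.exists_u hr hh hy hc hzs W.side.l W.side.l_ne
  have hF : Spine.RegAt o (fun v => ⟨v 0, v 1, v 4, v 5, v 6, P.a, u v,
    c v, d v, v 10, zs v, y v, k v, l v⟩) P :=
    ⟨hr, hs, hg, hh, hx, ha, hu, hc, hd, hzn, hzs, hy, hk, hl⟩
  obtain ⟨G, hG, eG, bG⟩ := W.side.exists_side hF ht hb hxa hxc hzw eb eu ec ezs ey ek el ed
  obtain ⟨K, hK, eK, bK⟩ := W.side'.exists_side hF ht' hb' hxb hxd hze eb' exd ec ezs ey ek el eze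
  rw [CAFCC, ← eventually_genericFilter]
  filter_upwards [bG, bK,
    ((HA.reg hG.xa hG.z (.const 1) hF.x hF.zn hG.t hF.h hF.s hF.g W.t_ne W.h_ne W.s_ne W.g_ne).sub
      (HA.reg hG.xa hG.z (.const 0) hF.x hF.zn hG.t hF.h hF.s hF.g
      W.t_ne W.h_ne W.s_ne W.g_ne)).eventually_ne_zero W.ya_unique,
    ((HC.reg hF.x hG.xa hK.xa hG.xc (.const 1) hF.r hF.s hG.t hK.t W.r_ne W.s_ne W.t_ne W.t'_ne).sub
      (HC.reg hF.x hG.xa hK.xa hG.xc (.const 0) hF.r hF.s hG.t hK.t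
      W.r_ne W.s_ne W.t_ne W.t'_ne)).eventually_ne_zero W.xd_unique,
    ((HC.reg hG.z hG.ya hG.xa (.const 1) hG.xc hF.r hF.s hF.g hF.h W.r_ne W.s_ne W.g_ne W.h_ne).sub
      (HC.reg hG.z hG.ya hG.xa (.const 0) hG.xc hF.r hF.s hF.g hF.h
      W.r_ne W.s_ne W.g_ne W.h_ne)).eventually_ne_zero W.yc_unique,
    ((HA.reg hF.zn hG.ya (.const 1) hG.xa hK.xa hF.g hF.h hG.t hK.t W.g_ne W.h_ne W.t_ne
        W.t'_ne).sub
      (HA.reg hF.zn hG.ya (.const 0) hG.xa hK.xa hF.g hF.h hG.t hK.t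
      W.g_ne W.h_ne W.t_ne W.t'_ne)).eventually_ne_zero W.yb_unique,
    ((HA.reg hG.ya hG.z hG.xa (.const 1) hF.zn hG.t hF.g hF.s hF.h W.t_ne W.g_ne W.s_ne W.h_ne).sub
      (HA.reg hG.ya hG.z hG.xa (.const 0) hF.zn hG.t hF.g hF.s hF.h
      W.t_ne W.g_ne W.s_ne W.h_ne)).eventually_ne_zero W.y_unique,
    ((HA.reg hK.xa (.const 1) hK.ya hF.x hF.zn hK.t hF.h hF.s hF.g W.t'_ne W.h_ne W.s_ne W.g_ne).sub
      (HA.reg hK.xa (.const 0) hK.ya hF.x hF.zn hK.t hF.h hF.s hF.g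
      W.t'_ne W.h_ne W.s_ne W.g_ne)).eventually_ne_zero W.ze_xb_unique,
    ((HA.reg hK.ya (.const 1) hK.xa hF.y hF.zn hK.t hF.g hF.s hF.h W.t'_ne W.g_ne W.s_ne W.h_ne).sub
      (HA.reg hK.ya (.const 0) hK.xa hF.y hF.zn hK.t hF.g hF.s hF.h
      W.t'_ne W.g_ne W.s_ne W.h_ne)).eventually_ne_zero W.ze_yb_unique,
    ((HC'.reg hG.yc hG.xc (.const 1) hG.z hF.y hF.r hF.h hF.g hG.t W.r_ne W.h_ne W.g_ne W.t_ne).sub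
      (HC'.reg hG.yc hG.xc (.const 0) hG.z hF.y hF.r hF.h hF.g hG.t
      W.r_ne W.h_ne W.g_ne W.t_ne)).eventually_ne_zero W.zs_yc_unique,
    ((HC'.reg hG.xc (.const 1) hG.yc hF.x hG.z hF.r hF.g hG.t hF.h W.r_ne W.g_ne W.t_ne W.h_ne).sub
      (HC'.reg hG.xc (.const 0) hG.yc hF.x hG.z hF.r hF.g hG.t hF.h
      W.r_ne W.g_ne W.t_ne W.h_ne)).eventually_ne_zero W.zs_xc_unique,
    ((HC.reg hK.z hK.ya hK.xa (.const 1) hK.xc hF.r hF.s hF.g hF.h W.r_ne W.s_ne W.g_ne W.h_ne).sub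
      (HC.reg hK.z hK.ya hK.xa (.const 0) hK.xc hF.r hF.s hF.g hF.h
      W.r_ne W.s_ne W.g_ne W.h_ne)).eventually_ne_zero W.yd_ze_unique,
    ((HA'.reg hF.zs hG.yc (.const 1) hG.xc hK.xc hF.g hF.h hG.t hK.t W.g_ne W.h_ne W.t_ne
        W.t'_ne).sub
      (HA'.reg hF.zs hG.yc (.const 0) hG.xc hK.xc hF.g hF.h hG.t hK.t
      W.g_ne W.h_ne W.t_ne W.t'_ne)).eventually_ne_zero W.yd_zs_unique,
    ((HC.reg hF.y hG.ya hK.ya hG.yc (.const 1) hF.r hF.s hG.t hK.t W.r_ne W.s_ne W.t_ne W.t'_ne).sub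
      (HC.reg hF.y hG.ya hK.ya hG.yc (.const 0) hF.r hF.s hG.t hK.t
      W.r_ne W.s_ne W.t_ne W.t'_ne)).eventually_ne_zero W.yd_y_unique,
    ((HC'.reg hK.xc (.const 1) hF.zs hK.z hF.x hF.r hF.g hF.h hK.t W.r_ne W.g_ne W.h_ne W.t'_ne).sub
      (HC'.reg hK.xc (.const 0) hF.zs hK.z hF.x hF.r hF.g hF.h hK.t
      W.r_ne W.g_ne W.h_ne W.t'_ne)).eventually_ne_zero W.yd_xd_unique]
    with v H I n0 n1 n2 n3 n4 n5 n6 n7 n8 n9 n10 n11 n12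
  have E := H.fourteenEquations cA cA' cC cC' I
  obtain ⟨e1, e2, e3, e4⟩ := eG v
  obtain ⟨i1, i2, i3, i4⟩ := eK v
  simp only [e1, e2, e3, e4, i1, i2, i3, i4] at E n0 n1 n2 n3 n4 n5 n6 n7 n8 n9 n10 n11 n12
  obtain ⟨⟨f1, f2, f3, f4, f5, f6⟩, f7, f8, f9, f10, f11, f12, f13, f14⟩ := id E
  exact ⟨xd v, y v, (G v).ya, (K v).ya, (G v).yc, (K v).yc, ze v, zs v, E,
    ⟨eq_zero_iff_of_affine (fun t => HA.affine_b _ _ t _ _ _ _) f7 n0,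
      eq_zero_iff_of_affine (fun t => HC.affine_d _ _ _ _ t _ _) f1 n1⟩,
    ⟨eq_zero_iff_of_affine (fun t => HC.affine_c _ _ _ t _ _ _) f3 n2,
      eq_zero_iff_of_affine (fun t => HA.affine_b _ _ t _ _ _ _) f5 n3,
      eq_zero_iff_of_affine (fun t => HA.affine_c _ _ _ t _ _ _) f11 n4⟩,
    ⟨eq_zero_iff_of_affine (fun t => HA.affine_a _ t _ _ _ _ _) f8 n5,
      eq_zero_iff_of_affine (fun t => HA.affine_a _ t _ _ _ _ _) f12 n6⟩,
    ⟨eq_zero_iff_of_affine (fun t => HC'.affine_b _ _ t _ _ _ _) f13 n7,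
      eq_zero_iff_of_affine (fun t => HC'.affine_a _ t _ _ _ _ _) f9 n8⟩,
    ⟨eq_zero_iff_of_affine (fun t => HC.affine_c _ _ _ t _ _ _) f4 n9,
      eq_zero_iff_of_affine (fun t => HA'.affine_b _ _ t _ _ _ _) f6 n10,
      eq_zero_iff_of_affine (fun t => HC.affine_d _ _ _ _ t _ _) f2 n11,
      eq_zero_iff_of_affine (fun t => HC'.affine_a _ t _ _ _ _ _) f10 n12⟩, f14⟩

/-! ### The quad equations -/

theorem eq_div_of_affine {q S t : ℂ} (h : q + t * S = 0) (hS : S ≠ 0) : t = -q / S := by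
  rw [eq_div_iff hS]
  linear_combination h

/-- Consistency around a cube is proved for every quad equation with this lemma: once three faces
are solved for the three vertices that they determine, the other faces through the last vertex `z`
are proportional as affine equations in `z`. -/
theorem affine_transfer {q S T R z : ℂ} (h : q + z * S = 0) (hS : S ≠ 0) (e : S * T = R * q) :
    T + z * R = 0 := by
  refine (mul_eq_zero.1 ?_).resolve_left hS
  linear_combination e + R * h

/-- The lattice potential Korteweg-de Vries equation `(u - v) * (x - y) = k * (s - t)`, which is
`H1` in the classification of Adler, Bobenko and Suris. It sums over the squares
around `x` to a relation between the quotients `(s - t) / (x - y)`. -/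
def quadH1 (k : ℂ) : QuadEq where
  q s t x u v y := (v - u) * (y - x) - k * (s - t)
  slopeY := fun _ _ _ u v => v - u
  slopeV := fun _ _ x _ y => y - x
  edge := fun _ _ _ => 1
  eq_y _ _ _ _ _ _ := by ring
  eq_v _ _ _ _ _ _ := by ring
  swap h := by linear_combination -h
  flip h := by linear_combination h
  reg _ _ _ _ _ _ := by
    apply_rules [RegAt.const, RegAt.add, RegAt.sub, RegAt.mul, RegAt.pow, RegAt.neg]
  reg_edge _ _ _ := by
    apply_rules [RegAt.const, RegAt.add, RegAt.sub, RegAt.mul, RegAt.pow, RegAt.neg]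
  cube_black a b c x u v w xab xac xbc z h1 n1 h2 n2 h3 n3 h4 n4 := by
    refine affine_transfer h4 n4 ?_
    generalize e1 : v - u = d1 at h1 n1
    generalize e2 : w - u = d2 at h2 n2
    generalize e3 : w - v = d3 at h3 n3
    rw [eq_div_of_affine h1 n1, eq_div_of_affine h2 n2, eq_div_of_affine h3 n3]
    field_simp
    subst e1 e2 e3
    ring
  cube_white a b c v x y z wab wac wbc p h1 n1 h2 n2 h3 n3 h4 n4 := by
    refine affine_transfer h4 n4 ?_
    generalize e1 : y - x = d1 at h1 n1
    generalize e2 : z - x = d2 at h2 n2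
    generalize e3 : z - y = d3 at h3 n3
    rw [eq_div_of_affine h1 n1, eq_div_of_affine h2 n2, eq_div_of_affine h3 n3]
    field_simp
    subst e1 e2 e3
    ring

/-- The equation `H2` in the classification of Adler, Bobenko and Suris. It says that
`(x - y + s - t) / (x - y - s + t)` equals `(x + s + u) / (x + t + v)`. -/
def quadH2 : QuadEq where
  q s t x u v y := (v - u) * (y - x) - (s - t) * (x + y + u + v + s + t)
  slopeY := fun s t _ u v => v - u - (s - t)
  slopeV := fun s t x _ y => y - x - (s - t)
  edge := fun s x v => x + s + v
  eq_y _ _ _ _ _ _ := by ring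
  eq_v _ _ _ _ _ _ := by ring
  swap h := by linear_combination -h
  flip h := by linear_combination h
  reg _ _ _ _ _ _ := by
    apply_rules [RegAt.const, RegAt.add, RegAt.sub, RegAt.mul, RegAt.pow, RegAt.neg]
  reg_edge _ _ _ := by
    apply_rules [RegAt.const, RegAt.add, RegAt.sub, RegAt.mul, RegAt.pow, RegAt.neg]
  cube_black a b c x u v w xab xac xbc z h1 n1 h2 n2 h3 n3 h4 n4 := by
    refine affine_transfer h4 n4 ?_
    generalize e1 : v - u - (a - b) = d1 at h1 n1
    generalize e2 : w - u - (a - c) = d2 at h2 n2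
    generalize e3 : w - v - (b - c) = d3 at h3 n3
    rw [eq_div_of_affine h1 n1, eq_div_of_affine h2 n2, eq_div_of_affine h3 n3]
    field_simp
    subst e1 e2 e3
    ring
  cube_white a b c v x y z wab wac wbc p h1 n1 h2 n2 h3 n3 h4 n4 := by
    refine affine_transfer h4 n4 ?_
    generalize e1 : y - x - (a - b) = d1 at h1 n1
    generalize e2 : z - x - (a - c) = d2 at h2 n2
    generalize e3 : z - y - (b - c) = d3 at h3 n3
    rw [eq_div_of_affine h1 n1, eq_div_of_affine h2 n2, eq_div_of_affine h3 n3]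
    field_simp
    subst e1 e2 e3
    ring

/-- The quad equation saying that `(x - y + s - t) / (x - y - s + t)` equals `v / u`. -/
def quadM1 : QuadEq where
  q s t x u v y := u * (x - y + s - t) - v * (x - y - s + t)
  slopeY := fun _ _ _ u v => v - u
  slopeV := fun s t x _ y => y - x + s - t
  edge := fun _ _ v => v
  eq_y _ _ _ _ _ _ := by ring
  eq_v _ _ _ _ _ _ := by ring
  swap h := by linear_combination -h
  flip h := by linear_combination h
  reg _ _ _ _ _ _ := by
    apply_rules [RegAt.const, RegAt.add, RegAt.sub, RegAt.mul, RegAt.pow, RegAt.neg]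
  reg_edge _ _ _ := by
    apply_rules [RegAt.const, RegAt.add, RegAt.sub, RegAt.mul, RegAt.pow, RegAt.neg]
  cube_black a b c x u v w xab xac xbc z h1 n1 h2 n2 h3 n3 h4 n4 := by
    refine affine_transfer h4 n4 ?_
    generalize e1 : v - u = d1 at h1 n1
    generalize e2 : w - u = d2 at h2 n2
    generalize e3 : w - v = d3 at h3 n3
    rw [eq_div_of_affine h1 n1, eq_div_of_affine h2 n2, eq_div_of_affine h3 n3]
    field_simp
    subst e1 e2 e3
    ring
  cube_white a b c v x y z wab wac wbc p h1 n1 h2 n2 h3 n3 h4 n4 := by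
    refine affine_transfer h4 n4 ?_
    generalize e1 : y - x + a - b = d1 at h1 n1
    generalize e2 : z - x + a - c = d2 at h2 n2
    generalize e3 : z - y + b - c = d3 at h3 n3
    rw [eq_div_of_affine h1 n1, eq_div_of_affine h2 n2, eq_div_of_affine h3 n3]
    field_simp
    subst e1 e2 e3
    ring

/-- The quad equation saying that `(s * x - t * y) / (t * x - s * y)` equals `v / u`. -/
def quadM3 : QuadEq where
  q s t x u v y := u * (s * x - t * y) - v * (t * x - s * y)
  slopeY := fun s t _ u v => s * v - t * u
  slopeV := fun s t x _ y => s * y - t * x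
  edge := fun s x v => s * x * v
  eq_y _ _ _ _ _ _ := by ring
  eq_v _ _ _ _ _ _ := by ring
  swap h := by linear_combination -h
  flip h := by linear_combination h
  reg _ _ _ _ _ _ := by
    apply_rules [RegAt.const, RegAt.add, RegAt.sub, RegAt.mul, RegAt.pow, RegAt.neg]
  reg_edge _ _ _ := by
    apply_rules [RegAt.const, RegAt.add, RegAt.sub, RegAt.mul, RegAt.pow, RegAt.neg]
  cube_black a b c x u v w xab xac xbc z h1 n1 h2 n2 h3 n3 h4 n4 := by
    refine affine_transfer h4 n4 ?_
    generalize e1 : a * v - b * u = d1 at h1 n1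
    generalize e2 : a * w - c * u = d2 at h2 n2
    generalize e3 : b * w - c * v = d3 at h3 n3
    rw [eq_div_of_affine h1 n1, eq_div_of_affine h2 n2, eq_div_of_affine h3 n3]
    field_simp
    subst e1 e2 e3
    ring
  cube_white a b c v x y z wab wac wbc p h1 n1 h2 n2 h3 n3 h4 n4 := by
    refine affine_transfer h4 n4 ?_
    generalize e1 : a * y - b * x = d1 at h1 n1
    generalize e2 : a * z - c * x = d2 at h2 n2
    generalize e3 : b * z - c * y = d3 at h3 n3
    rw [eq_div_of_affine h1 n1, eq_div_of_affine h2 n2, eq_div_of_affine h3 n3]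
    field_simp
    subst e1 e2 e3
    ring

/-- A form of the equation `H3` in the classification of Adler, Bobenko and Suris. It says that
`(s * x - t * y) / (t * x - s * y)` equals `(s * u * x - 1) * t / (s * (t * v * x - 1))`. -/
def quadH3 : QuadEq where
  q s t x u v y := s * t * (x * (s * v - t * u) + y * (s * u - t * v)) - (s ^ 2 - t ^ 2)
  slopeY := fun s t _ u v => s * t * (s * u - t * v)
  slopeV := fun s t x _ y => s * t * (s * x - t * y)
  edge := fun s x v => s * x * (s * v * x - 1)
  eq_y _ _ _ _ _ _ := by ring
  eq_v _ _ _ _ _ _ := by ring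
  swap h := by linear_combination -h
  flip h := by linear_combination h
  reg _ _ _ _ _ _ := by
    apply_rules [RegAt.const, RegAt.add, RegAt.sub, RegAt.mul, RegAt.pow, RegAt.neg]
  reg_edge _ _ _ := by
    apply_rules [RegAt.const, RegAt.add, RegAt.sub, RegAt.mul, RegAt.pow, RegAt.neg]
  cube_black a b c x u v w xab xac xbc z h1 n1 h2 n2 h3 n3 h4 n4 := by
    refine affine_transfer h4 n4 ?_
    generalize e1 : a * b * (a * u - b * v) = d1 at h1 n1
    generalize e2 : a * c * (a * u - c * w) = d2 at h2 n2
    generalize e3 : b * c * (b * v - c * w) = d3 at h3 n3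
    rw [eq_div_of_affine h1 n1, eq_div_of_affine h2 n2, eq_div_of_affine h3 n3]
    field_simp
    subst e1 e2 e3
    ring
  cube_white a b c v x y z wab wac wbc p h1 n1 h2 n2 h3 n3 h4 n4 := by
    refine affine_transfer h4 n4 ?_
    generalize e1 : a * b * (a * x - b * y) = d1 at h1 n1
    generalize e2 : a * c * (a * x - c * z) = d2 at h2 n2
    generalize e3 : b * c * (b * y - c * z) = d3 at h3 n3
    rw [eq_div_of_affine h1 n1, eq_div_of_affine h2 n2, eq_div_of_affine h3 n3]
    field_simp
    subst e1 e2 e3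
    ring

/-- A quad equation that factorizes over a square root `r` of `x`, see `quadSqrt_legs`: it says that
`((r - s + t) ^ 2 - y) / ((r + s - t) ^ 2 - y)` is a product of factors attached to the edges `xu`
and `xv`. -/
def quadSqrt : QuadEq where
  q s t x u v y := (u + s - (v + t)) * (y - (x + (s - t) ^ 2)) - 2 * (s - t) * ((u + s) * (v + t) - x)
  slopeY := fun s t _ u v => u + s - (v + t)
  slopeV := fun s t x u y => x - y + (s - t) ^ 2 - 2 * (s - t) * (u + s)
  edge := fun s x v => x * ((v + s) ^ 2 - x)
  eq_y _ _ _ _ _ _ := by ring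
  eq_v _ _ _ _ _ _ := by ring
  swap h := by linear_combination -h
  flip h := by linear_combination h
  reg _ _ _ _ _ _ := by
    apply_rules [RegAt.const, RegAt.add, RegAt.sub, RegAt.mul, RegAt.pow, RegAt.neg]
  reg_edge _ _ _ := by
    apply_rules [RegAt.const, RegAt.add, RegAt.sub, RegAt.mul, RegAt.pow, RegAt.neg]
  cube_black a b c x u v w xab xac xbc z h1 n1 h2 n2 h3 n3 h4 n4 := by
    refine affine_transfer h4 n4 ?_
    generalize e1 : u + a - (v + b) = d1 at h1 n1
    generalize e2 : u + a - (w + c) = d2 at h2 n2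
    generalize e3 : v + b - (w + c) = d3 at h3 n3
    rw [eq_div_of_affine h1 n1, eq_div_of_affine h2 n2, eq_div_of_affine h3 n3]
    field_simp
    subst e1 e2 e3
    ring
  cube_white a b c v x y z wab wac wbc p h1 n1 h2 n2 h3 n3 h4 n4 := by
    refine affine_transfer h4 n4 ?_
    generalize e1 : x - y + (a - b) ^ 2 - 2 * (a - b) * (v + a) = d1 at h1 n1
    generalize e2 : x - z + (a - c) ^ 2 - 2 * (a - c) * (v + a) = d2 at h2 n2
    generalize e3 : y - z + (b - c) ^ 2 - 2 * (b - c) * (v + b) = d3 at h3 n3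
    rw [eq_div_of_affine h1 n1, eq_div_of_affine h2 n2, eq_div_of_affine h3 n3]
    field_simp
    subst e1 e2 e3
    ring

/-- A quad equation that factorizes over a root `r` of `x = (r + r⁻¹) / 2`, see
`quadJoukowski_legs`: it says that
`(t ^ 2 + s ^ 2 * r ^ 2 - 2 * s * t * r * y) / (s ^ 2 + t ^ 2 * r ^ 2 - 2 * s * t * r * y)` is a
product of factors attached to the edges `xu` and `xv`. -/
def quadJoukowski : QuadEq where
  q s t x u v y := (u * v + s * t) * (s ^ 2 - t ^ 2) + 2 * s * t * (y * (t * u - s * v) - x * (s * u - t * v))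
  slopeY := fun s t _ u v => 2 * s * t * (t * u - s * v)
  slopeV := fun s t x u y => u * (s ^ 2 - t ^ 2) + 2 * s * t * (t * x - s * y)
  edge := fun s x v => s * (x ^ 2 - 1) * (v ^ 2 + s ^ 2 - 2 * v * s * x)
  eq_y _ _ _ _ _ _ := by ring
  eq_v _ _ _ _ _ _ := by ring
  swap h := by linear_combination -h
  flip h := by linear_combination h
  reg _ _ _ _ _ _ := by
    apply_rules [RegAt.const, RegAt.add, RegAt.sub, RegAt.mul, RegAt.pow, RegAt.neg]
  reg_edge _ _ _ := by
    apply_rules [RegAt.const, RegAt.add, RegAt.sub, RegAt.mul, RegAt.pow, RegAt.neg]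
  cube_black a b c x u v w xab xac xbc z h1 n1 h2 n2 h3 n3 h4 n4 := by
    refine affine_transfer h4 n4 ?_
    generalize e1 : 2 * a * b * (b * u - a * v) = d1 at h1 n1
    generalize e2 : 2 * a * c * (c * u - a * w) = d2 at h2 n2
    generalize e3 : 2 * b * c * (c * v - b * w) = d3 at h3 n3
    rw [eq_div_of_affine h1 n1, eq_div_of_affine h2 n2, eq_div_of_affine h3 n3]
    field_simp
    subst e1 e2 e3
    ring
  cube_white a b c v x y z wab wac wbc p h1 n1 h2 n2 h3 n3 h4 n4 := by
    refine affine_transfer h4 n4 ?_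
    generalize e1 : v * (a ^ 2 - b ^ 2) + 2 * a * b * (b * x - a * y) = d1 at h1 n1
    generalize e2 : v * (a ^ 2 - c ^ 2) + 2 * a * c * (c * x - a * z) = d2 at h2 n2
    generalize e3 : v * (b ^ 2 - c ^ 2) + 2 * b * c * (c * y - b * z) = d3 at h3 n3
    rw [eq_div_of_affine h1 n1, eq_div_of_affine h2 n2, eq_div_of_affine h3 n3]
    field_simp
    subst e1 e2 e3
    ring

/-! ### The vertical equations -/

/-- The vertical equation between a layer carrying `quadJoukowski` and one carrying `quadH3`. -/
def vertJoukowskiH3 : VertEq quadJoukowski quadH3 where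
  q := fun r t x v u y => t * r * u * (y * v - r) - r * v - t ^ 2 * y + 2 * x * r * t
  slopeY := fun r t _ v u => t * (r * u * v - t)
  slopeU := fun r t _ v y => t * r * (y * v - r)
  edgeL := fun r x u => r * (r ^ 2 * u ^ 2 + 1 - 2 * x * r * u)
  edgeU := fun r y v => r * y * (y * v - r)
  eq_y _ _ _ _ _ _ := by ring
  eq_u _ _ _ _ _ _ := by ring
  reg _ _ _ _ _ _ := by
    apply_rules [RegAt.const, RegAt.add, RegAt.sub, RegAt.mul, RegAt.pow, RegAt.neg]
  reg_edgeL _ _ _ := by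
    apply_rules [RegAt.const, RegAt.add, RegAt.sub, RegAt.mul, RegAt.pow, RegAt.neg]
  reg_edgeU _ _ _ := by
    apply_rules [RegAt.const, RegAt.add, RegAt.sub, RegAt.mul, RegAt.pow, RegAt.neg]
  cube_black r a b x u v m xab ya yb z h1 n1 h2 n2 h3 n3 h4 n4 := by
    simp only [quadH3, quadJoukowski] at *
    refine ⟨affine_transfer h4 n4 ?_, affine_transfer h4 n4 ?_⟩
    all_goals generalize e1 : 2 * a * b * (b * u - a * v) = d1 at h1 n1
    all_goals generalize e2 : a * (r * m * u - a) = d2 at h2 n2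
    all_goals generalize e3 : b * (r * m * v - b) = d3 at h3 n3
    all_goals rw [eq_div_of_affine h1 n1, eq_div_of_affine h2 n2, eq_div_of_affine h3 n3]
    all_goals field_simp
    all_goals subst e1 e2 e3
    all_goals ring
  cube_white r a b v xa xb y w ua ub z h1 n1 h2 n2 h3 n3 h4 n4 := by
    simp only [quadH3, quadJoukowski] at *
    refine ⟨affine_transfer h4 n4 ?_, affine_transfer h4 n4 ?_⟩
    all_goals generalize e1 : v * (a ^ 2 - b ^ 2) + 2 * a * b * (b * xa - a * xb) = d1 at h1 n1
    all_goals generalize e2 : a * r * (y * v - r) = d2 at h2 n2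
    all_goals generalize e3 : b * r * (y * v - r) = d3 at h3 n3
    all_goals rw [eq_div_of_affine h1 n1, eq_div_of_affine h2 n2, eq_div_of_affine h3 n3]
    all_goals field_simp
    all_goals subst e1 e2 e3
    all_goals ring

/-- The equation `vertJoukowskiH3` with the two layers interchanged. -/
def vertH3Joukowski : VertEq quadH3 quadJoukowski where
  q := fun r t x v u y => t * r * v * (x * u - r) - r * u - t ^ 2 * x + 2 * y * r * t
  slopeY := fun r t _ _ _ => 2 * r * t
  slopeU := fun r t x v _ => r * (t * v * x - 1)
  edgeL := fun r x u => r * x * (x * u - r)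
  edgeU := fun r y v => r * (r ^ 2 * v ^ 2 + 1 - 2 * y * r * v)
  eq_y _ _ _ _ _ _ := by ring
  eq_u _ _ _ _ _ _ := by ring
  reg _ _ _ _ _ _ := by
    apply_rules [RegAt.const, RegAt.add, RegAt.sub, RegAt.mul, RegAt.pow, RegAt.neg]
  reg_edgeL _ _ _ := by
    apply_rules [RegAt.const, RegAt.add, RegAt.sub, RegAt.mul, RegAt.pow, RegAt.neg]
  reg_edgeU _ _ _ := by
    apply_rules [RegAt.const, RegAt.add, RegAt.sub, RegAt.mul, RegAt.pow, RegAt.neg]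
  cube_black r a b x u v m xab ya yb z h1 n1 h2 n2 h3 n3 h4 n4 := by
    simp only [quadH3, quadJoukowski] at *
    refine ⟨affine_transfer h4 n4 ?_, affine_transfer h4 n4 ?_⟩
    all_goals generalize e1 : a * b * (a * u - b * v) = d1 at h1 n1
    all_goals generalize e2 : 2 * r * a = d2 at h2 n2
    all_goals generalize e3 : 2 * r * b = d3 at h3 n3
    all_goals rw [eq_div_of_affine h1 n1, eq_div_of_affine h2 n2, eq_div_of_affine h3 n3]
    all_goals field_simp
    all_goals subst e1 e2 e3
    all_goals ring
  cube_white r a b v xa xb y w ua ub z h1 n1 h2 n2 h3 n3 h4 n4 := by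
    simp only [quadH3, quadJoukowski] at *
    refine ⟨affine_transfer h4 n4 ?_, affine_transfer h4 n4 ?_⟩
    all_goals generalize e1 : a * b * (a * xa - b * xb) = d1 at h1 n1
    all_goals generalize e2 : r * (a * v * xa - 1) = d2 at h2 n2
    all_goals generalize e3 : r * (b * v * xb - 1) = d3 at h3 n3
    all_goals rw [eq_div_of_affine h1 n1, eq_div_of_affine h2 n2, eq_div_of_affine h3 n3]
    all_goals field_simp
    all_goals subst e1 e2 e3
    all_goals ring

/-- An inhomogeneous vertical equation between two layers carrying `quadM3`. -/
def vertM3 : VertEq quadM3 quadM3 where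
  q := fun r t x v u y => u * v * (t * x * y - r) - t
  slopeY := fun _ t x v u => u * v * t * x
  slopeU := fun r t x v y => v * (t * x * y - r)
  edgeL := fun r _ u => r * u
  edgeU := fun r _ v => r * v
  eq_y _ _ _ _ _ _ := by ring
  eq_u _ _ _ _ _ _ := by ring
  reg _ _ _ _ _ _ := by
    apply_rules [RegAt.const, RegAt.add, RegAt.sub, RegAt.mul, RegAt.pow, RegAt.neg]
  reg_edgeL _ _ _ := by
    apply_rules [RegAt.const, RegAt.add, RegAt.sub, RegAt.mul, RegAt.pow, RegAt.neg]
  reg_edgeU _ _ _ := by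
    apply_rules [RegAt.const, RegAt.add, RegAt.sub, RegAt.mul, RegAt.pow, RegAt.neg]
  cube_black r a b x u v m xab ya yb z h1 n1 h2 n2 h3 n3 h4 n4 := by
    simp only [quadM3] at *
    refine ⟨affine_transfer h4 n4 ?_, affine_transfer h4 n4 ?_⟩
    all_goals generalize e1 : a * v - b * u = d1 at h1 n1
    all_goals generalize e2 : m * u * a * x = d2 at h2 n2
    all_goals generalize e3 : m * v * b * x = d3 at h3 n3
    all_goals rw [eq_div_of_affine h1 n1, eq_div_of_affine h2 n2, eq_div_of_affine h3 n3]
    all_goals field_simp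
    all_goals subst e1 e2 e3
    all_goals ring
  cube_white r a b v xa xb y w ua ub z h1 n1 h2 n2 h3 n3 h4 n4 := by
    simp only [quadM3] at *
    refine ⟨affine_transfer h4 n4 ?_, affine_transfer h4 n4 ?_⟩
    all_goals generalize e1 : a * xb - b * xa = d1 at h1 n1
    all_goals generalize e2 : v * (a * xa * y - r) = d2 at h2 n2
    all_goals generalize e3 : v * (b * xb * y - r) = d3 at h3 n3
    all_goals rw [eq_div_of_affine h1 n1, eq_div_of_affine h2 n2, eq_div_of_affine h3 n3]
    all_goals field_simp
    all_goals subst e1 e2 e3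
    all_goals ring

/-- The homogeneous vertical equation between two layers carrying `quadM3`. -/
def vertM3Hom : VertEq quadM3 quadM3 where
  q := fun _ _ x v u y => x * u - y * v
  slopeY := fun _ _ _ v _ => -v
  slopeU := fun _ _ x _ _ => x
  edgeL := fun _ x u => x * u
  edgeU := fun _ y v => y * v
  eq_y _ _ _ _ _ _ := by ring
  eq_u _ _ _ _ _ _ := by ring
  reg _ _ _ _ _ _ := by
    apply_rules [RegAt.const, RegAt.add, RegAt.sub, RegAt.mul, RegAt.pow, RegAt.neg]
  reg_edgeL _ _ _ := by
    apply_rules [RegAt.const, RegAt.add, RegAt.sub, RegAt.mul, RegAt.pow, RegAt.neg]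
  reg_edgeU _ _ _ := by
    apply_rules [RegAt.const, RegAt.add, RegAt.sub, RegAt.mul, RegAt.pow, RegAt.neg]
  cube_black r a b x u v m xab ya yb z h1 n1 h2 n2 h3 n3 h4 n4 := by
    simp only [quadM3] at *
    refine ⟨affine_transfer h4 n4 ?_, affine_transfer h4 n4 ?_⟩
    all_goals generalize e1 : a * v - b * u = d1 at h1 n1
    all_goals generalize e2 : -u = d2 at h2 n2
    all_goals generalize e3 : -v = d3 at h3 n3
    all_goals rw [eq_div_of_affine h1 n1, eq_div_of_affine h2 n2, eq_div_of_affine h3 n3]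
    all_goals field_simp
    all_goals subst e1 e2 e3
    all_goals ring
  cube_white r a b v xa xb y w ua ub z h1 n1 h2 n2 h3 n3 h4 n4 := by
    simp only [quadM3] at *
    refine ⟨affine_transfer h4 n4 ?_, affine_transfer h4 n4 ?_⟩
    all_goals generalize e1 : a * xb - b * xa = d1 at h1 n1
    all_goals rw [eq_div_of_affine h1 n1, eq_div_of_affine h2 n2, eq_div_of_affine h3 n3]
    all_goals field_simp
    all_goals subst e1
    all_goals ring

/-- The vertical equation between a layer carrying `quadSqrt` and one carrying `quadH2`. -/
def vertSqrtH2 : VertEq quadSqrt quadH2 where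
  q := fun r t x v u y => (y - r + t) * (v + t) - (u + r) * (y - r - v) - x
  slopeY := fun r t _ v u => v + t - u - r
  slopeU := fun r _ _ v y => -(y - r - v)
  edgeL := fun r x u => (u + r) ^ 2 - x
  edgeU := fun r y v => v - y + r
  eq_y _ _ _ _ _ _ := by ring
  eq_u _ _ _ _ _ _ := by ring
  reg _ _ _ _ _ _ := by
    apply_rules [RegAt.const, RegAt.add, RegAt.sub, RegAt.mul, RegAt.pow, RegAt.neg]
  reg_edgeL _ _ _ := by
    apply_rules [RegAt.const, RegAt.add, RegAt.sub, RegAt.mul, RegAt.pow, RegAt.neg]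
  reg_edgeU _ _ _ := by
    apply_rules [RegAt.const, RegAt.add, RegAt.sub, RegAt.mul, RegAt.pow, RegAt.neg]
  cube_black r a b x u v m xab ya yb z h1 n1 h2 n2 h3 n3 h4 n4 := by
    simp only [quadH2, quadSqrt] at *
    refine ⟨affine_transfer h4 n4 ?_, affine_transfer h4 n4 ?_⟩
    all_goals generalize e1 : u + a - (v + b) = d1 at h1 n1
    all_goals generalize e2 : u + a - m - r = d2 at h2 n2
    all_goals generalize e3 : v + b - m - r = d3 at h3 n3
    all_goals rw [eq_div_of_affine h1 n1, eq_div_of_affine h2 n2, eq_div_of_affine h3 n3]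
    all_goals field_simp
    all_goals subst e1 e2 e3
    all_goals ring
  cube_white r a b v xa xb y w ua ub z h1 n1 h2 n2 h3 n3 h4 n4 := by
    simp only [quadH2, quadSqrt] at *
    refine ⟨affine_transfer h4 n4 ?_, affine_transfer h4 n4 ?_⟩
    all_goals generalize e1 : xa - xb + (a - b) ^ 2 - 2 * (a - b) * (v + a) = d1 at h1 n1
    all_goals generalize e2 : -(y - r - v) = d2 at h2 n2
    all_goals generalize e3 : -(y - r - v) = d3 at h3 n3
    all_goals rw [eq_div_of_affine h1 n1, eq_div_of_affine h2 n2, eq_div_of_affine h3 n3]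
    all_goals field_simp
    all_goals subst e1 e2 e3
    all_goals ring

/-- The equation `vertSqrtH2` with the two layers interchanged. -/
def vertH2Sqrt : VertEq quadH2 quadSqrt where
  q := fun r t x v u y => (x - r + t) * (u + t) - (v + r) * (x - r - u) - y
  slopeY := fun _ _ _ _ _ => (-1 : ℂ)
  slopeU := fun _ t x v _ => x + t + v
  edgeL := fun r x u => u - x + r
  edgeU := fun r y v => (v + r) ^ 2 - y
  eq_y _ _ _ _ _ _ := by ring
  eq_u _ _ _ _ _ _ := by ring
  reg _ _ _ _ _ _ := by
    apply_rules [RegAt.const, RegAt.add, RegAt.sub, RegAt.mul, RegAt.pow, RegAt.neg]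
  reg_edgeL _ _ _ := by
    apply_rules [RegAt.const, RegAt.add, RegAt.sub, RegAt.mul, RegAt.pow, RegAt.neg]
  reg_edgeU _ _ _ := by
    apply_rules [RegAt.const, RegAt.add, RegAt.sub, RegAt.mul, RegAt.pow, RegAt.neg]
  cube_black r a b x u v m xab ya yb z h1 n1 h2 n2 h3 n3 h4 n4 := by
    simp only [quadH2, quadSqrt] at *
    refine ⟨affine_transfer h4 n4 ?_, affine_transfer h4 n4 ?_⟩
    all_goals generalize e1 : v - u - (a - b) = d1 at h1 n1
    all_goals rw [eq_div_of_affine h1 n1, eq_div_of_affine h2 n2, eq_div_of_affine h3 n3]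
    all_goals field_simp
    all_goals subst e1
    all_goals ring
  cube_white r a b v xa xb y w ua ub z h1 n1 h2 n2 h3 n3 h4 n4 := by
    simp only [quadH2, quadSqrt] at *
    refine ⟨affine_transfer h4 n4 ?_, affine_transfer h4 n4 ?_⟩
    all_goals generalize e1 : xb - xa - (a - b) = d1 at h1 n1
    all_goals generalize e2 : xa + a + v = d2 at h2 n2
    all_goals generalize e3 : xb + b + v = d3 at h3 n3
    all_goals rw [eq_div_of_affine h1 n1, eq_div_of_affine h2 n2, eq_div_of_affine h3 n3]
    all_goals field_simp
    all_goals subst e1 e2 e3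
    all_goals ring

/-- The vertical equation between two layers carrying `quadM1`. -/
def vertM1 : VertEq quadM1 quadM1 where
  q := fun r t x v u y => u * v * (x + y - r + t) - 1
  slopeY := fun _ _ _ v u => u * v
  slopeU := fun r t x v y => v * (x + y - r + t)
  edgeL := fun _ _ u => u
  edgeU := fun _ _ v => v
  eq_y _ _ _ _ _ _ := by ring
  eq_u _ _ _ _ _ _ := by ring
  reg _ _ _ _ _ _ := by
    apply_rules [RegAt.const, RegAt.add, RegAt.sub, RegAt.mul, RegAt.pow, RegAt.neg]
  reg_edgeL _ _ _ := by
    apply_rules [RegAt.const, RegAt.add, RegAt.sub, RegAt.mul, RegAt.pow, RegAt.neg]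
  reg_edgeU _ _ _ := by
    apply_rules [RegAt.const, RegAt.add, RegAt.sub, RegAt.mul, RegAt.pow, RegAt.neg]
  cube_black r a b x u v m xab ya yb z h1 n1 h2 n2 h3 n3 h4 n4 := by
    simp only [quadM1] at *
    refine ⟨affine_transfer h4 n4 ?_, affine_transfer h4 n4 ?_⟩
    all_goals generalize e1 : v - u = d1 at h1 n1
    all_goals generalize e2 : m * u = d2 at h2 n2
    all_goals generalize e3 : m * v = d3 at h3 n3
    all_goals rw [eq_div_of_affine h1 n1, eq_div_of_affine h2 n2, eq_div_of_affine h3 n3]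
    all_goals field_simp
    all_goals subst e1 e2 e3
    all_goals ring
  cube_white r a b v xa xb y w ua ub z h1 n1 h2 n2 h3 n3 h4 n4 := by
    simp only [quadM1] at *
    refine ⟨affine_transfer h4 n4 ?_, affine_transfer h4 n4 ?_⟩
    all_goals generalize e1 : xb - xa + a - b = d1 at h1 n1
    all_goals generalize e2 : v * (xa + y - r + a) = d2 at h2 n2
    all_goals generalize e3 : v * (xb + y - r + b) = d3 at h3 n3
    all_goals rw [eq_div_of_affine h1 n1, eq_div_of_affine h2 n2, eq_div_of_affine h3 n3]
    all_goals field_simp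
    all_goals subst e1 e2 e3
    all_goals ring

/-- The vertical equation between a layer carrying `quadH1` and one carrying `quadH2`. -/
def vertH1H2 : VertEq (quadH1 1) quadH2 where
  q := fun _ t x v u y => 2 * x * v - y - t - u
  slopeY := fun _ _ _ _ _ => (-1 : ℂ)
  slopeU := fun _ _ _ _ _ => (-1 : ℂ)
  edgeL := fun _ _ _ => 1
  edgeU := fun _ _ v => v
  eq_y _ _ _ _ _ _ := by ring
  eq_u _ _ _ _ _ _ := by ring
  reg _ _ _ _ _ _ := by
    apply_rules [RegAt.const, RegAt.add, RegAt.sub, RegAt.mul, RegAt.pow, RegAt.neg]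
  reg_edgeL _ _ _ := by
    apply_rules [RegAt.const, RegAt.add, RegAt.sub, RegAt.mul, RegAt.pow, RegAt.neg]
  reg_edgeU _ _ _ := by
    apply_rules [RegAt.const, RegAt.add, RegAt.sub, RegAt.mul, RegAt.pow, RegAt.neg]
  cube_black r a b x u v m xab ya yb z h1 n1 h2 n2 h3 n3 h4 n4 := by
    simp only [quadH1, quadH2] at *
    refine ⟨affine_transfer h4 n4 ?_, affine_transfer h4 n4 ?_⟩
    all_goals generalize e1 : v - u = d1 at h1 n1
    all_goals rw [eq_div_of_affine h1 n1, eq_div_of_affine h2 n2, eq_div_of_affine h3 n3]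
    all_goals field_simp
    all_goals subst e1
    all_goals ring
  cube_white r a b v xa xb y w ua ub z h1 n1 h2 n2 h3 n3 h4 n4 := by
    simp only [quadH1, quadH2] at *
    refine ⟨affine_transfer h4 n4 ?_, affine_transfer h4 n4 ?_⟩
    all_goals generalize e1 : xb - xa = d1 at h1 n1
    all_goals rw [eq_div_of_affine h1 n1, eq_div_of_affine h2 n2, eq_div_of_affine h3 n3]
    all_goals field_simp
    all_goals subst e1
    all_goals ring

/-- The equation `vertH1H2` with the two layers interchanged. -/
def vertH2H1 : VertEq quadH2 (quadH1 1) where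
  q := fun _ t x v u y => 2 * y * u - x - t - v
  slopeY := fun _ _ _ _ u => 2 * u
  slopeU := fun _ _ _ _ y => 2 * y
  edgeL := fun _ _ u => u
  edgeU := fun _ _ _ => 1
  eq_y _ _ _ _ _ _ := by ring
  eq_u _ _ _ _ _ _ := by ring
  reg _ _ _ _ _ _ := by
    apply_rules [RegAt.const, RegAt.add, RegAt.sub, RegAt.mul, RegAt.pow, RegAt.neg]
  reg_edgeL _ _ _ := by
    apply_rules [RegAt.const, RegAt.add, RegAt.sub, RegAt.mul, RegAt.pow, RegAt.neg]
  reg_edgeU _ _ _ := by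
    apply_rules [RegAt.const, RegAt.add, RegAt.sub, RegAt.mul, RegAt.pow, RegAt.neg]
  cube_black r a b x u v m xab ya yb z h1 n1 h2 n2 h3 n3 h4 n4 := by
    simp only [quadH1, quadH2] at *
    refine ⟨affine_transfer h4 n4 ?_, affine_transfer h4 n4 ?_⟩
    all_goals generalize e1 : v - u - (a - b) = d1 at h1 n1
    all_goals generalize e2 : 2 * m = d2 at h2 n2
    all_goals generalize e3 : 2 * m = d3 at h3 n3
    all_goals rw [eq_div_of_affine h1 n1, eq_div_of_affine h2 n2, eq_div_of_affine h3 n3]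
    all_goals field_simp
    all_goals subst e1 e2 e3
    all_goals ring
  cube_white r a b v xa xb y w ua ub z h1 n1 h2 n2 h3 n3 h4 n4 := by
    simp only [quadH1, quadH2] at *
    refine ⟨affine_transfer h4 n4 ?_, affine_transfer h4 n4 ?_⟩
    all_goals generalize e1 : xb - xa - (a - b) = d1 at h1 n1
    all_goals generalize e2 : 2 * y = d2 at h2 n2
    all_goals generalize e3 : 2 * y = d3 at h3 n3
    all_goals rw [eq_div_of_affine h1 n1, eq_div_of_affine h2 n2, eq_div_of_affine h3 n3]
    all_goals field_simp
    all_goals subst e1 e2 e3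
    all_goals ring

/-- The linear vertical equation between two layers carrying `quadH1`, with different constants `k`. -/
def vertH1 : VertEq (quadH1 1) (quadH1 2) where
  q := fun _ _ x v u y => y + 2 * v - 2 * x - 2 * u
  slopeY := fun _ _ _ _ _ => (1 : ℂ)
  slopeU := fun _ _ _ _ _ => (-2 : ℂ)
  edgeL := fun _ _ _ => 1
  edgeU := fun _ _ _ => 1
  eq_y _ _ _ _ _ _ := by ring
  eq_u _ _ _ _ _ _ := by ring
  reg _ _ _ _ _ _ := by
    apply_rules [RegAt.const, RegAt.add, RegAt.sub, RegAt.mul, RegAt.pow, RegAt.neg]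
  reg_edgeL _ _ _ := by
    apply_rules [RegAt.const, RegAt.add, RegAt.sub, RegAt.mul, RegAt.pow, RegAt.neg]
  reg_edgeU _ _ _ := by
    apply_rules [RegAt.const, RegAt.add, RegAt.sub, RegAt.mul, RegAt.pow, RegAt.neg]
  cube_black r a b x u v m xab ya yb z h1 n1 h2 n2 h3 n3 h4 n4 := by
    simp only [quadH1] at *
    refine ⟨affine_transfer h4 n4 ?_, affine_transfer h4 n4 ?_⟩
    all_goals generalize e1 : v - u = d1 at h1 n1
    all_goals rw [eq_div_of_affine h1 n1, eq_div_of_affine h2 n2, eq_div_of_affine h3 n3]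
    all_goals field_simp
    all_goals subst e1
    all_goals ring
  cube_white r a b v xa xb y w ua ub z h1 n1 h2 n2 h3 n3 h4 n4 := by
    simp only [quadH1] at *
    refine ⟨affine_transfer h4 n4 ?_, affine_transfer h4 n4 ?_⟩
    all_goals generalize e1 : xb - xa = d1 at h1 n1
    all_goals rw [eq_div_of_affine h1 n1, eq_div_of_affine h2 n2, eq_div_of_affine h3 n3]
    all_goals field_simp
    all_goals subst e1
    all_goals ring

/-! ### Square roots -/

theorem sq_csqrt (x : ℂ) : Complex.sqrt x ^ 2 = x := by
  have := Complex.cpow_nat_inv_pow x (n := 2) two_ne_zero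
  rwa [Nat.cast_ofNat] at this

theorem xbar_sq_add_one (x : ℂ) : xbar x ^ 2 + 1 = 2 * xbar x * x := by
  have := sq_csqrt (x ^ 2 - 1)
  rw [xbar]
  linear_combination this

theorem xbar_ne_zero (x : ℂ) : xbar x ≠ 0 := fun h => by
  have := xbar_sq_add_one x
  rw [h] at this
  norm_num at this

theorem eq_div_xbar (x : ℂ) : x = (xbar x ^ 2 + 1) / (2 * xbar x) := by
  have := xbar_ne_zero x
  rw [xbar_sq_add_one]
  field_simp

theorem xbar_sq_sub_one_ne_zero {x : ℂ} (hx : x ^ 2 - 1 ≠ 0) : xbar x ^ 2 - 1 ≠ 0 := fun h => by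
  refine hx ?_
  have h1 := xbar_sq_add_one x
  have h2 : xbar x * (x - xbar x) = 0 := by linear_combination -h1 / 2 - h / 2
  have h3 := (mul_eq_zero.1 h2).resolve_left (xbar_ne_zero x)
  linear_combination h + (x + xbar x) * h3

/-! ### Equations centred at a vertex -/

/-- Four quad equations around a vertex, each of them written as `P Q' D = Q P' N` with factors
`P`, `Q` attached to the edges at the vertex, multiply to an equation without these factors. -/
theorem legs_product {Pa Qa Pb Qb Pc Qc Pd Qd Na Da Nb Db Nc Dc Nd Dd : ℂ}
    (ha : Pa * Qa ≠ 0) (hb : Pb * Qb ≠ 0) (hc : Pc * Qc ≠ 0) (hd : Pd * Qd ≠ 0)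
    (h1 : Pb * Qc * Da = Qb * Pc * Na) (h2 : Pb * Qd * Db = Qb * Pd * Nb)
    (h3 : Pa * Qc * Dc = Qa * Pc * Nc) (h4 : Pa * Qd * Dd = Qa * Pd * Nd) :
    Na * Nd * (Db * Dc) - Da * Dd * (Nb * Nc) = 0 := by
  refine (mul_eq_zero.1 ?_).resolve_left (mul_ne_zero (mul_ne_zero ha hb) (mul_ne_zero hc hd))
  have h : Qb * Pc * Na * (Qa * Pd * Nd) * (Pb * Qd * Db) * (Pa * Qc * Dc)
      = Pb * Qc * Da * (Pa * Qd * Dd) * (Qb * Pd * Nb) * (Qa * Pc * Nc) := by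
    rw [h1, h2, h3, h4]
  linear_combination h

theorem quadH1_centersA {k : ℂ} (hk : k ≠ 0) : CentersA (quadH1 k) (polyA2 0 0) := by
  intro a b c d x va vb vc vd xa xb xc xd _ _ _ _ h1 h2 h3 h4
  simp only [quadH1] at h1 h2 h3 h4
  refine (mul_eq_zero.1 ?_).resolve_left hk
  rw [← polyA2_00_cleared]
  linear_combination -(x - xb) * (x - xc) * (x - xd) * h1 + (x - xa) * (x - xc) * (x - xd) * h2
    + (x - xa) * (x - xb) * (x - xd) * h3 - (x - xa) * (x - xb) * (x - xc) * h4

theorem quadH2_centersA : CentersA quadH2 (polyA2 1 0) := by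
  intro a b c d x va vb vc vd xa xb xc xd ha hb hc hd h1 h2 h3 h4
  simp only [quadH2] at *
  have e {s t u v y : ℂ} (h : (v - u) * (y - x) - (s - t) * (x + y + u + v + s + t) = 0) :
      1 * (x + t + v) * (x - y + s - t) = (x + s + u) * 1 * -(-x + y + s - t) := by
    linear_combination -h
  have := legs_product (by rwa [one_mul]) (by rwa [one_mul]) (by rwa [one_mul])
    (by rwa [one_mul]) (e h1) (e h2) (e h3) (e h4)
  linear_combination -this / 2 + polyA2_10_cleared x xa xb xc xd a b c d / 2

theorem quadM1_centersA : CentersA quadM1 (polyA2 1 0) := by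
  intro a b c d x va vb vc vd xa xb xc xd ha hb hc hd h1 h2 h3 h4
  simp only [quadM1] at *
  have e {s t u v y : ℂ} (h : u * (x - y + s - t) - v * (x - y - s + t) = 0) :
      u * 1 * (x - y + s - t) = 1 * v * -(-x + y + s - t) := by
    linear_combination h
  have := legs_product (by rwa [mul_one]) (by rwa [mul_one]) (by rwa [mul_one])
    (by rwa [mul_one]) (e h1) (e h2) (e h3) (e h4)
  linear_combination -this / 2 + polyA2_10_cleared x xa xb xc xd a b c d / 2

theorem quadM3_centersA : CentersA quadM3 (polyA3 0) := by
  intro a b c d x va vb vc vd xa xb xc xd ha hb hc hd h1 h2 h3 h4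
  simp only [quadM3, mul_ne_zero_iff] at *
  obtain ⟨⟨ha0, hx⟩, ha⟩ := ha
  obtain ⟨⟨hb0, -⟩, hb⟩ := hb
  obtain ⟨⟨hc0, -⟩, hc⟩ := hc
  obtain ⟨⟨hd0, -⟩, hd⟩ := hd
  have e {s t u v y : ℂ} (h : u * (s * x - t * y) - v * (t * x - s * y) = 0) :
      u * 1 * (s * x - t * y) = 1 * v * (t * x - s * y) := by
    linear_combination h
  have := legs_product (by rwa [mul_one]) (by rwa [mul_one]) (by rwa [mul_one])
    (by rwa [mul_one]) (e h1) (e h2) (e h3) (e h4)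
  rw [polyA3_zero_cleared x xa xb xc xd a b c d ha0 hb0 hc0 hd0] at this
  exact (mul_eq_zero.1 this).resolve_left (by simp [*])

/-- The leg form of the quad equation `quadH3`. -/
theorem quadH3_legs {s t x u v y : ℂ} (h : quadH3.q s t x u v y = 0) :
    s * (t * v * x - 1) * (s * x - t * y) = (s * u * x - 1) * t * (t * x - s * y) := by
  simp only [quadH3] at h
  linear_combination x * h

theorem quadH3_centersA : CentersA quadH3 (polyA3 0) := by
  intro a b c d x va vb vc vd xa xb xc xd ha hb hc hd h1 h2 h3 h4
  have E {s v : ℂ} (h : quadH3.edge s x v ≠ 0) : s ≠ 0 ∧ x ≠ 0 ∧ s * (s * v * x - 1) ≠ 0 := by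
    simp only [quadH3, mul_ne_zero_iff] at h ⊢
    tauto
  have := legs_product (E ha).2.2 (E hb).2.2 (E hc).2.2 (E hd).2.2
    (quadH3_legs h1) (quadH3_legs h2) (quadH3_legs h3) (quadH3_legs h4)
  rw [polyA3_zero_cleared x xa xb xc xd a b c d (E ha).1 (E hb).1 (E hc).1 (E hd).1] at this
  exact (mul_eq_zero.1 this).resolve_left (by simp [(E ha).1, (E hb).1, (E hc).1, (E hd).1, (E ha).2.1])

theorem quadSqrt_legs {r s t x u v y : ℂ} (hr : r ^ 2 = x) (h : quadSqrt.q s t x u v y = 0) :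
    (u + s + r) * (v + t - r) * ((r - s + t) ^ 2 - y)
      = (u + s - r) * (v + t + r) * ((r + s - t) ^ 2 - y) := by
  subst hr
  simp only [quadSqrt] at h
  linear_combination 2 * r * h

theorem quadSqrt_edge {r s x v : ℂ} (hr : r ^ 2 = x) (h : quadSqrt.edge s x v ≠ 0) :
    x ≠ 0 ∧ (v + s + r) * (v + s - r) ≠ 0 := by
  simp only [quadSqrt] at h
  refine ⟨left_ne_zero_of_mul h, ?_⟩
  convert right_ne_zero_of_mul h using 1
  rw [← hr]
  ring

theorem quadSqrt_centersA : CentersA quadSqrt (polyA2 1 1) := by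
  intro a b c d x va vb vc vd xa xb xc xd ha hb hc hd h1 h2 h3 h4
  have hr := sq_csqrt x
  have hr0 : Complex.sqrt x ≠ 0 := fun h => (quadSqrt_edge hr ha).1 (by rw [← hr, h]; norm_num)
  have := legs_product (quadSqrt_edge hr ha).2 (quadSqrt_edge hr hb).2 (quadSqrt_edge hr hc).2
    (quadSqrt_edge hr hd).2 (quadSqrt_legs hr h1) (quadSqrt_legs hr h2) (quadSqrt_legs hr h3)
    (quadSqrt_legs hr h4)
  rw [polyA2_11_cleared x xa xb xc xd a b c d _ hr] at this
  exact (mul_eq_zero.1 this).resolve_left (by simp [hr0])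

theorem quadJoukowski_legs {r s t x u v y : ℂ} (hr : r ^ 2 + 1 = 2 * r * x)
    (h : quadJoukowski.q s t x u v y = 0) :
    (r * u - s) * (v - r * t) * (t ^ 2 + s ^ 2 * r ^ 2 - 2 * s * t * r * y)
      = (u - r * s) * (r * v - t) * (s ^ 2 + t ^ 2 * r ^ 2 - 2 * s * t * r * y) := by
  simp only [quadJoukowski] at h
  linear_combination r * (r ^ 2 - 1) * h - (r ^ 2 - 1) * s * t * (s * u - t * v) * hr

theorem quadJoukowski_edge {r s x v : ℂ} (hr : r ^ 2 + 1 = 2 * r * x) (hr0 : r ≠ 0)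
    (h : quadJoukowski.edge s x v ≠ 0) :
    s ≠ 0 ∧ x ^ 2 - 1 ≠ 0 ∧ (r * v - s) * (v - r * s) ≠ 0 := by
  simp only [quadJoukowski, mul_ne_zero_iff] at h
  refine ⟨h.1.1, h.1.2, ?_⟩
  convert mul_ne_zero hr0 h.2 using 1
  linear_combination -(s * v) * hr

theorem quadJoukowski_centersA : CentersA quadJoukowski (polyA3 1) := by
  intro a b c d x va vb vc vd xa xb xc xd ha hb hc hd h1 h2 h3 h4
  have hr := xbar_sq_add_one x
  have hr0 := xbar_ne_zero x
  obtain ⟨ha0, hx, ha⟩ := quadJoukowski_edge hr hr0 ha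
  obtain ⟨hb0, -, hb⟩ := quadJoukowski_edge hr hr0 hb
  obtain ⟨hc0, -, hc⟩ := quadJoukowski_edge hr hr0 hc
  obtain ⟨hd0, -, hd⟩ := quadJoukowski_edge hr hr0 hd
  have := legs_product ha hb hc hd (quadJoukowski_legs hr h1) (quadJoukowski_legs hr h2)
    (quadJoukowski_legs hr h3) (quadJoukowski_legs hr h4)
  have h := polyA3_one_cleared x xa xb xc xd a b c d (xbar x) ha0 hb0 hc0 hd0 hr0 (eq_div_xbar x)
  refine (mul_eq_zero.1 (h.symm.trans this)).resolve_left ?_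
  have := xbar_sq_sub_one_ne_zero hx
  simp [*]

theorem quadH2_legs {s t x u v y : ℂ} (h : quadH2.q s t x u v y = 0) :
    1 * (x + t + v) * (x - y + s - t) = (x + s + u) * 1 * -(-x + y + s - t) := by
  simp only [quadH2] at h
  linear_combination -h

theorem quadM1_legs {s t x u v y : ℂ} (h : quadM1.q s t x u v y = 0) :
    u * 1 * (x - y + s - t) = 1 * v * -(-x + y + s - t) := by
  simp only [quadM1] at h
  linear_combination h

theorem quadM3_legs {s t x u v y : ℂ} (h : quadM3.q s t x u v y = 0) :
    u * 1 * (s * x - t * y) = 1 * v * (t * x - s * y) := by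
  simp only [quadM3] at h
  linear_combination h

theorem vertJoukowskiH3_centersLower :
    CentersLower vertJoukowskiH3 (polyC3 (1 / 2) (1 / 2) 0) := by
  intro a b c d x va vb vc vd xa xb xc xd ha hb hc hd h1 h2 h3 h4
  have hr := xbar_sq_add_one x
  have hr0 := xbar_ne_zero x
  have hx := eq_div_xbar x
  generalize xbar x = r at hr hr0 hx
  obtain ⟨hb0, -, hb⟩ := quadJoukowski_edge hr hr0 hb
  obtain ⟨hc0, hx1, hc⟩ := quadJoukowski_edge hr hr0 hc
  obtain ⟨hd0, -, hd⟩ := quadJoukowski_edge hr hr0 hd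
  simp only [vertJoukowskiH3, mul_ne_zero_iff] at ha
  obtain ⟨ha0, ha⟩ := ha
  have ha' : (a * va - r) * r * (r * a * va - 1) ≠ 0 := by
    convert mul_ne_zero (mul_ne_zero hr0 hr0) ha using 1
    linear_combination -(r * a * va) * hr
  have e {t v y : ℂ} (h : vertJoukowskiH3.q a t x v va y = 0) :
      (a * va - r) * r * (v - r * t) * (t * y - a * r)
        = (r * a * va - 1) * (r * v - t) * (t * r * y - a) := by
    simp only [vertJoukowskiH3] at h
    linear_combination r * (1 - r ^ 2) * h + (1 - r ^ 2) * a * t * hr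
  have := legs_product ha' hb hc hd (quadJoukowski_legs hr h1) (quadJoukowski_legs hr h2)
    (e h3) (e h4)
  have h := polyC3_hh0_cleared x xa xb xc xd a b c d r ha0 hb0 hc0 hd0 hr0 hx
  refine (mul_eq_zero.1 (h.symm.trans ?_)).resolve_left ?_
  · linear_combination this
  · have hr1 : r ^ 2 - 1 ≠ 0 := fun h1 => hx1 (by
      have h2 : r * (x - r) = 0 := by linear_combination -hr / 2 - h1 / 2
      linear_combination h1 + (x + r) * (mul_eq_zero.1 h2).resolve_left hr0)
    simp [*]

theorem vertH3Joukowski_centersUpper :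
    CentersUpper vertH3Joukowski (polyC3 (1 / 2) (1 / 2) 0) :=
  vertJoukowskiH3_centersLower

theorem vertH3Joukowski_centersLower :
    CentersLower vertH3Joukowski (polyC3 (1 / 2) 0 (1 / 2)) := by
  intro a b c d x va vb vc vd xa xb xc xd ha hb hc hd h1 h2 h3 h4
  have E {s v : ℂ} (h : quadH3.edge s x v ≠ 0) : s ≠ 0 ∧ x ≠ 0 ∧ s * (s * v * x - 1) ≠ 0 := by
    simp only [quadH3, mul_ne_zero_iff] at h ⊢
    tauto
  simp only [vertH3Joukowski, mul_ne_zero_iff] at ha h3 h4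
  obtain ⟨⟨ha0, hx⟩, ha⟩ := ha
  have e {t v y : ℂ} (ht : t ≠ 0) (h : vertH3Joukowski.q a t x v va y = 0) :
      (x * va - a) * (t * v * x - 1) * 1 = 1 * t * (t / a * x ^ 2 + a / t - 2 * x * y) := by
    simp only [vertH3Joukowski] at h
    field_simp
    linear_combination x * h
  have := legs_product (by rwa [mul_one]) (E hb).2.2 (E hc).2.2 (E hd).2.2
    (quadH3_legs h1) (quadH3_legs h2) (e (E hc).1 h3) (e (E hd).1 h4)
  have h := polyC3_h0h_cleared x xa xb xc xd a b c d ha0 (E hc).1 (E hd).1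
  refine ((mul_eq_zero (a := -2 * x)).1 ?_).resolve_left (by simp [hx])
  linear_combination this - h

theorem vertJoukowskiH3_centersUpper :
    CentersUpper vertJoukowskiH3 (polyC3 (1 / 2) 0 (1 / 2)) :=
  vertH3Joukowski_centersLower

theorem vertM3_centersLower : CentersLower vertM3 (polyC3 1 0 0) := by
  intro a b c d x va vb vc vd xa xb xc xd ha hb hc hd h1 h2 h3 h4
  simp only [vertM3, quadM3, mul_ne_zero_iff] at ha hb hc hd
  have e {t v y : ℂ} (ht : t ≠ 0) (h : vertM3.q a t x v va y = 0) :
      1 * 1 * 1 = va * v * (x * y - a / t) := by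
    simp only [vertM3] at h
    field_simp
    linear_combination -h
  have := legs_product (by simpa using ha.2) (by simpa using hb.2) (by simpa using hc.2)
    (by simpa using hd.2) (quadM3_legs h1) (quadM3_legs h2) (e hc.1.1 h3) (e hd.1.1 h4)
  have h := polyC3_100_cleared x xa xb xc xd a b c d ha.1 hc.1.1 hd.1.1
  refine ((mul_eq_zero (a := x)).1 ?_).resolve_left hb.1.2
  linear_combination this - h

theorem vertM3_centersUpper : CentersUpper vertM3 (polyC3 1 0 0) := by
  intro a b c d x va vb vc vd xa xb xc xd ha hb hc hd h1 h2 h3 h4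
  refine vertM3_centersLower ha hb hc hd h1 h2 ?_ ?_
  all_goals
    simp only [vertM3] at h3 h4 ⊢
    first | linear_combination h3 | linear_combination h4

theorem vertM3Hom_centersLower : CentersLower vertM3Hom (polyC3 0 0 0) := by
  intro a b c d x va vb vc vd xa xb xc xd ha hb hc hd h1 h2 h3 h4
  simp only [vertM3Hom, quadM3, mul_ne_zero_iff] at ha hb hc hd
  have e {t v y : ℂ} (h : vertM3Hom.q a t x v va y = 0) : x * va * 1 * 1 = 1 * v * y := by
    simp only [vertM3Hom] at h
    linear_combination h
  have := legs_product (by simpa using ha) (by simpa using hb.2) (by simpa using hc.2)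
    (by simpa using hd.2) (quadM3_legs h1) (quadM3_legs h2) (e h3) (e h4)
  linear_combination this - polyC3_000_cleared x xa xb xc xd a b c d

theorem vertM3Hom_centersUpper : CentersUpper vertM3Hom (polyC3 0 0 0) := by
  intro a b c d x va vb vc vd xa xb xc xd ha hb hc hd h1 h2 h3 h4
  refine vertM3Hom_centersLower ha hb hc hd h1 h2 ?_ ?_
  all_goals
    simp only [vertM3Hom] at h3 h4 ⊢
    first | linear_combination -h3 | linear_combination -h4

theorem vertSqrtH2_centersLower : CentersLower vertSqrtH2 (polyC2 1 1 0) := by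
  intro a b c d x va vb vc vd xa xb xc xd ha hb hc hd h1 h2 h3 h4
  have hr := sq_csqrt x
  generalize Complex.sqrt x = r at hr
  have hr0 : r ≠ 0 := fun h => (quadSqrt_edge hr hb).1 (by rw [← hr, h]; norm_num)
  have e {t v y : ℂ} (h : vertSqrtH2.q a t x v va y = 0) :
      (va + a + r) * (v + t - r) * (y + r - a + t)
        = (va + a - r) * (v + t + r) * (y - r - a + t) := by
    simp only [vertSqrtH2] at h
    linear_combination 2 * r * h - 2 * r * hr
  have := legs_product (by convert ha using 1; simp only [vertSqrtH2]; rw [← hr]; ring)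
    (quadSqrt_edge hr hb).2 (quadSqrt_edge hr hc).2 (quadSqrt_edge hr hd).2
    (quadSqrt_legs hr h1) (quadSqrt_legs hr h2) (e h3) (e h4)
  have h := polyC2_110_cleared x xa xb xc xd a b c d r hr
  refine ((mul_eq_zero (a := 2 * r)).1 ?_).resolve_left (by simp [hr0])
  linear_combination this - h

theorem vertH2Sqrt_centersUpper : CentersUpper vertH2Sqrt (polyC2 1 1 0) :=
  vertSqrtH2_centersLower

theorem vertH2Sqrt_centersLower : CentersLower vertH2Sqrt (polyC2 1 0 1) := by
  intro a b c d x va vb vc vd xa xb xc xd ha hb hc hd h1 h2 h3 h4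
  simp only [vertH2Sqrt, quadH2] at ha hb hc hd
  have e {t v y : ℂ} (h : vertH2Sqrt.q a t x v va y = 0) :
      (va - x + a) * (x + t + v) * 1 = 1 * 1 * (y - (x - a + t) ^ 2) := by
    simp only [vertH2Sqrt] at h
    linear_combination h
  have := legs_product (by rwa [mul_one])
    (by rwa [one_mul]) (by rwa [one_mul]) (by rwa [one_mul]) (quadH2_legs h1) (quadH2_legs h2)
    (e h3) (e h4)
  linear_combination this + polyC2_101_cleared x xa xb xc xd a b c d

theorem vertSqrtH2_centersUpper : CentersUpper vertSqrtH2 (polyC2 1 0 1) :=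
  vertH2Sqrt_centersLower

theorem vertM1_centersLower : CentersLower vertM1 (polyC2 1 0 0) := by
  intro a b c d x va vb vc vd xa xb xc xd ha hb hc hd h1 h2 h3 h4
  simp only [vertM1, quadM1] at ha hb hc hd
  have e {t v y : ℂ} (h : vertM1.q a t x v va y = 0) :
      1 * 1 * 1 = va * v * (x + y - a + t) := by
    simp only [vertM1] at h
    linear_combination -h
  have := legs_product (by rwa [one_mul]) (by rwa [mul_one]) (by rwa [mul_one])
    (by rwa [mul_one]) (quadM1_legs h1) (quadM1_legs h2) (e h3) (e h4)
  linear_combination this + polyC2_100_cleared x xa xb xc xd a b c d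

theorem vertM1_centersUpper : CentersUpper vertM1 (polyC2 1 0 0) := by
  intro a b c d x va vb vc vd xa xb xc xd ha hb hc hd h1 h2 h3 h4
  refine vertM1_centersLower ha hb hc hd h1 h2 ?_ ?_
  all_goals
    simp only [vertM1] at h3 h4 ⊢
    first | linear_combination h3 | linear_combination h4

theorem vertH1H2_centersLower : CentersLower vertH1H2 (polyC2 0 0 0) := by
  intro a b c d x va vb vc vd xa xb xc xd _ _ _ _ h1 h2 h3 h4
  simp only [quadH1, vertH1H2] at h1 h2 h3 h4
  linear_combination polyC2_000_cleared x xa xb xc xd a b c d + 2 * x * (x - xb) * h1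
    - 2 * x * (x - xa) * h2 + (x - xa) * (x - xb) * (h3 - h4)

theorem vertH2H1_centersUpper : CentersUpper vertH2H1 (polyC2 0 0 0) :=
  vertH1H2_centersLower

theorem vertH2H1_centersLower : CentersLower vertH2H1 (polyC1 1) := by
  intro a b c d x va vb vc vd xa xb xc xd ha hb hc hd h1 h2 h3 h4
  simp only [vertH2H1, quadH2] at ha hb hc hd
  have e {t v y : ℂ} (h : vertH2H1.q a t x v va y = 0) :
      1 * (x + t + v) * 1 = (2 * va) * 1 * y := by
    simp only [vertH2H1] at h
    linear_combination -h
  have := legs_product (by simpa using ha) (by rwa [one_mul]) (by rwa [one_mul])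
    (by rwa [one_mul]) (quadH2_legs h1) (quadH2_legs h2) (e h3) (e h4)
  linear_combination -this - polyC1_1_cleared x xa xb xc xd a b c d

theorem vertH1H2_centersUpper : CentersUpper vertH1H2 (polyC1 1) :=
  vertH2H1_centersLower

theorem vertH1_centersLower : CentersLower vertH1 (polyC1 0) := by
  intro a b c d x va vb vc vd xa xb xc xd _ _ _ _ h1 h2 h3 h4
  simp only [quadH1, vertH1] at h1 h2 h3 h4
  linear_combination polyC1_0_cleared x xa xb xc xd a b c d + 2 * (x - xb) * h1
    - 2 * (x - xa) * h2 + (x - xa) * (x - xb) * (h3 - h4)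

theorem vertH1_centersUpper : CentersUpper vertH1 (polyC1 0) := by
  intro a b c d x va vb vc vd xa xb xc xd _ _ _ _ h1 h2 h3 h4
  simp only [quadH1, vertH1] at h1 h2 h3 h4
  linear_combination polyC1_0_cleared x xa xb xc xd a b c d + (x - xb) * h1
    - (x - xa) * h2 - (x - xa) * (x - xb) * (h3 - h4) / 2

/-! ### Regularity of the face-centered quad equations -/

set_option linter.unreachableTactic false
set_option linter.unusedTactic false

theorem TypeA.isRegular (A : TypeA) : A.poly.IsRegular := by
  constructor
  case reg =>
    intros
    cases A
    all_goals
      simp only [TypeA.poly, polyA3, polyA2]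
      repeat' with_reducible first
        | assumption
        | apply RegAt.const
        | apply RegAt.add
        | apply RegAt.sub
        | apply RegAt.mul
        | apply RegAt.pow
        | apply RegAt.div
      all_goals exact mul_ne_zero ‹_› ‹_›
  all_goals
    intros
    cases A <;> simp only [TypeA.poly, polyA3, polyA2] <;> push_cast <;> ring

theorem TypeC.isRegular (C : TypeC) : C.poly.IsRegular := by
  constructor
  case reg =>
    intros
    cases C
    all_goals
      simp only [TypeC.poly, polyC3, polyC2, polyC1]
      repeat' with_reducible first
        | assumption
        | apply RegAt.const
        | apply RegAt.add
        | apply RegAt.sub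
        | apply RegAt.mul
        | apply RegAt.pow
        | apply RegAt.neg
        | apply RegAt.inv
        | apply RegAt.div
      all_goals first
        | exact two_ne_zero
        | exact mul_ne_zero (mul_ne_zero (mul_ne_zero two_ne_zero ‹_›) ‹_›) ‹_›
  all_goals
    intros
    cases C <;> simp only [TypeC.poly, polyC3, polyC2, polyC1] <;> push_cast <;> ring

/-! ### Nondegenerate lattice solutions -/

/-- The numbers are the fields of `Spine` and of the two `Side`s, in the order of declaration. -/
theorem latticeWitness_vertJoukowskiH3 :
    LatticeWitness vertJoukowskiH3 TypeA.A3_1.poly TypeA.A3_0.poly TypeC.C3_hh0.poly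
      TypeC.C3_h0h.poly
      ⟨-1, -2, -3, 1, 2, -2, 1, -2, 2, 1 / 12, 13 / 15, -1 / 3, -2, 3⟩
      ⟨1 / 2, -3, -163 / 56, 22 / 5, -45 / 16, 89 / 32, 19 / 8, -13 / 6, -11 / 5, -13 / 8,
      17 / 16, -187 / 216, 202 / 183⟩
      ⟨4, 2, -1 / 4, -3 / 4, -1 / 3, 1 / 2, -2, 2, 2, 9 / 2, -7 / 2, -31 / 12, -11 / 60⟩ := by
  constructor
  case side | side' => constructor <;> norm_num [vertJoukowskiH3, quadH3, quadJoukowski]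
  all_goals norm_num [vertJoukowskiH3, quadH3, quadJoukowski, TypeA.poly, TypeC.poly, polyA3,
    polyC3]

theorem latticeWitness_vertH3Joukowski :
    LatticeWitness vertH3Joukowski TypeA.A3_0.poly TypeA.A3_1.poly TypeC.C3_h0h.poly
      TypeC.C3_hh0.poly
      ⟨-2, -3, 1, 1 / 2, 3, 3, 1 / 2, 2, 3, -73 / 33, -4, -9, -39 / 7, -5 / 16⟩
      ⟨2, 1 / 2, -13 / 6, -9 / 4, 9, 27, -39 / 10, -39 / 8, 13 / 6, -2 / 7, -13 / 46, 43 / 13,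
      -19 / 24⟩
      ⟨-1, 2, -5 / 3, -3, -3, -3, -3, -51 / 13, -3, -1 / 2, -11 / 32, 22 / 9, 41 / 8⟩ := by
  constructor
  case side | side' => constructor <;> norm_num [vertH3Joukowski, quadH3, quadJoukowski]
  all_goals norm_num [vertH3Joukowski, quadH3, quadJoukowski, TypeA.poly, TypeC.poly, polyA3,
    polyC3]

theorem latticeWitness_vertM3 :
    LatticeWitness vertM3 TypeA.A3_0.poly TypeA.A3_0.poly TypeC.C3_100.poly TypeC.C3_100.poly
      ⟨2, -1, -3, 6, -3, -1, -3, 1, -1, -3, 1 / 3, -3, -1, -3 / 4⟩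
      ⟨-4, -1, 3, 1 / 18, -3, 3, -1, 1, -1, -2, 6, 3, -5 / 18⟩
      ⟨3, 2, -15, -1 / 6, 3, -12 / 5, 1, -7 / 11, 1, 3, 15 / 2, -3, 2 / 9⟩ := by
  constructor
  case side | side' => constructor <;> norm_num [vertM3, quadM3]
  all_goals norm_num [vertM3, quadM3, TypeA.poly, TypeC.poly, polyA3, polyC3]

theorem latticeWitness_vertM3Hom :
    LatticeWitness vertM3Hom TypeA.A3_0.poly TypeA.A3_0.poly TypeC.C3_000.poly TypeC.C3_000.poly
      ⟨-4, -2, -3, 6, -4, -2, 5, -2, -2, 4, 10, 4, 2, -5⟩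
      ⟨1, 2, -4, -10, -4, -4, -2, -2, -2, 5, 5, 4, 10⟩
      ⟨5, -2, 4, 10, 4, 4, 2, 2, 2, -5, -5, -4, -10⟩ := by
  constructor
  case side | side' => constructor <;> norm_num [vertM3Hom, quadM3]
  all_goals norm_num [vertM3Hom, quadM3, TypeA.poly, TypeC.poly, polyA3, polyC3]

theorem latticeWitness_vertSqrtH2 :
    LatticeWitness vertSqrtH2 TypeA.A2_11.poly TypeA.A2_10.poly TypeC.C2_110.poly TypeC.C2_101.poly
      ⟨5, -1, -2, 2, 3, 5, -1, 5, -1, 22, 16, 19, 3, 7⟩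
      ⟨-3, -1, -5 / 2, 45 / 8, -2 / 7, 14, 14 / 3, -2, -5 / 3, -16 / 7, -12, 6, 7 / 2⟩
      ⟨1, 4, 75, -13, 48, 3, -1, 5, 32 / 7, -1, -1 / 2, 71 / 5, 103 / 9⟩ := by
  constructor
  case side | side' => constructor <;> norm_num [vertSqrtH2, quadH2, quadSqrt]
  all_goals norm_num [vertSqrtH2, quadH2, quadSqrt, TypeA.poly, TypeC.poly, polyA2, polyC2]

theorem latticeWitness_vertH2Sqrt :
    LatticeWitness vertH2Sqrt TypeA.A2_10.poly TypeA.A2_11.poly TypeC.C2_101.poly TypeC.C2_110.poly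
      ⟨1, 2, 6, 3, -3, 4, -2, -2, 3, 5, 6, 3, 7, -11 / 4⟩
      ⟨-2, 4, -5, 34, -3, -11 / 2, -4 / 3, -1, -7 / 11, 2 / 7, 8, -5 / 4, -19 / 11⟩
      ⟨-1, 3, -9 / 2, 23, -3, -5, -19 / 11, 0, -6 / 5, -5 / 6, 8, -3 / 7, -14 / 5⟩ := by
  constructor
  case side | side' => constructor <;> norm_num [vertH2Sqrt, quadH2, quadSqrt]
  all_goals norm_num [vertH2Sqrt, quadH2, quadSqrt, TypeA.poly, TypeC.poly, polyA2, polyC2]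

theorem latticeWitness_vertM1 :
    LatticeWitness vertM1 TypeA.A2_10.poly TypeA.A2_10.poly TypeC.C2_100.poly TypeC.C2_100.poly
      ⟨-2, 5, 3, 2, -1, 2, 1, -4, 2, -5 / 3, -17 / 4, -2 / 3, 2, 3 / 11⟩
      ⟨1, 1, 11, -1, 1 / 5, 2, 16 / 11, 2, 2 / 7, 5 / 21, 1 / 5, 14 / 3, 21 / 2⟩
      ⟨4, 6, -3, -29 / 6, -4 / 5, 3, 2 / 7, 2, 7 / 2, -5 / 19, 1 / 13, -13 / 3, -30 / 7⟩ := by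
  constructor
  case side | side' => constructor <;> norm_num [vertM1, quadM1]
  all_goals norm_num [vertM1, quadM1, TypeA.poly, TypeC.poly, polyA2, polyC2]

theorem latticeWitness_vertH1H2 :
    LatticeWitness vertH1H2 TypeA.A2_00.poly TypeA.A2_10.poly TypeC.C2_000.poly TypeC.C1_1.poly
      ⟨1, -4, 3, 4, -2, -3, -2, -1, -3, -11 / 2, 3, -3 / 2, -3, -4⟩
      ⟨-1, 3, -5 / 2, -9, -1, -7 / 6, -5 / 3, -3, 9, 0, -2, -7 / 4, -22⟩
      ⟨-3, 3, -13 / 6, -7, -1 / 2, -5 / 6, -6 / 5, -3, 6, 1, -2, -29 / 18, -11⟩ := by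
  constructor
  case side | side' => constructor <;> norm_num [vertH1H2, quadH1, quadH2]
  all_goals norm_num [vertH1H2, quadH1, quadH2, TypeA.poly, TypeC.poly, polyA2, polyC1, polyC2]

theorem latticeWitness_vertH2H1 :
    LatticeWitness vertH2H1 TypeA.A2_10.poly TypeA.A2_00.poly TypeC.C1_1.poly TypeC.C2_000.poly
      ⟨-1, 4, -4, -2, -2, 4, -2, 2, 2, -18 / 5, 1, 4, 26, 2⟩
      ⟨3, 1, -4, -1 / 2, 1 / 3, -2, 51 / 11, 4, -33, 8 / 3, 3, 58 / 15, -13 / 2⟩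
      ⟨2, 4, -12, -1, -2, -10 / 3, -20, -8, 14, 1, 2 / 3, -26 / 7, 5⟩ := by
  constructor
  case side | side' => constructor <;> norm_num [vertH2H1, quadH1, quadH2]
  all_goals norm_num [vertH2H1, quadH1, quadH2, TypeA.poly, TypeC.poly, polyA2, polyC1, polyC2]

theorem latticeWitness_vertH1 :
    LatticeWitness vertH1 TypeA.A2_00.poly TypeA.A2_00.poly TypeC.C1_0.poly TypeC.C1_0.poly
      ⟨5, 4, -2, 6, 6, -1, 3, 3, -1, 15 / 2, 12, 8, -1, 1⟩
      ⟨3, -2, 5, 22, 7, 3, 1, -1, 0, 2, 6, 9, 18⟩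
      ⟨-3, 2, 25 / 3, 14, 5, 9, 1 / 5, -1, 0, 4, 0, 15, 18⟩ := by
  constructor
  case side | side' => constructor <;> norm_num [vertH1, quadH1]
  all_goals norm_num [vertH1, quadH1, TypeA.poly, TypeC.poly, polyA2, polyC1]

/-! ### Four-leg forms -/

theorem RegAt.eventually_ne_zero_self {n : ℕ} {p : Fin n → ℂ} {g : (Fin n → ℂ) → ℂ}
    (hp : g p ≠ 0) (hg : RegAt p g (g p)) : ∀ᶠ v in genericFilter n, g v ≠ 0 :=
  hg.eventually_ne_zero hp

/-- Nondegeneracy conditions at an edge: legs at `x` with corner variable `y` and parameters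
`α`, `β` have nonzero numerator and denominator. -/
structure LegGeneric (x y α β : ℂ) : Prop where
  x_ne : x ≠ 0
  x_sq_ne : x ^ 2 - 1 ≠ 0
  y_ne : y ≠ 0
  α_ne : α ≠ 0
  β_ne : β ≠ 0
  sub_ne : α - β ≠ 0
  sq_sub_ne : α ^ 2 - β ^ 2 ≠ 0
  xy_ne : x - y ≠ 0
  num_mul_ne : β * x - α * y ≠ 0
  den_mul_ne : α * x - β * y ≠ 0
  num_add_ne : -x + y + α - β ≠ 0
  den_add_ne : x - y + α - β ≠ 0
  biquadratic_mul_ne : α ^ 4 + β ^ 4 + α ^ 2 * β ^ 2 * (4 * x ^ 2 - 2)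
    - 4 * α * β * x * y * (α ^ 2 + β ^ 2) + 4 * α ^ 2 * β ^ 2 * y ^ 2 ≠ 0
  biquadratic_add_ne : (x + (α - β) ^ 2 - y) ^ 2 - 4 * (α - β) ^ 2 * x ≠ 0
  leg_100_ne : x * y - α / β ≠ 0
  leg_h0h_ne : β / α * x ^ 2 + α / β - 2 * x * y ≠ 0
  leg_hh0_ne : β ^ 2 * y ^ 2 + α ^ 2 - 2 * α * β * x * y ≠ 0
  leg_add_100_ne : x + y - α + β ≠ 0
  leg_add_110_ne : (y - α + β) ^ 2 - x ≠ 0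
  leg_add_101_ne : y - (x - α + β) ^ 2 ≠ 0

theorem legGeneric_iff {x y α β : ℂ} : LegGeneric x y α β ↔
    x ≠ 0 ∧ x ^ 2 - 1 ≠ 0 ∧ y ≠ 0 ∧ α ≠ 0 ∧ β ≠ 0 ∧ α - β ≠ 0 ∧ α ^ 2 - β ^ 2 ≠ 0 ∧ x - y ≠ 0 ∧
    β * x - α * y ≠ 0 ∧ α * x - β * y ≠ 0 ∧ -x + y + α - β ≠ 0 ∧ x - y + α - β ≠ 0 ∧ α ^ 4 + β ^
    4 + α ^ 2 * β ^ 2 * (4 * x ^ 2 - 2) - 4 * α * β * x * y * (α ^ 2 + β ^ 2) + 4 * α ^ 2 * β ^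
    2 * y ^ 2 ≠ 0 ∧ (x + (α - β) ^ 2 - y) ^ 2 - 4 * (α - β) ^ 2 * x ≠ 0 ∧ x * y - α / β ≠ 0 ∧ β
    / α * x ^ 2 + α / β - 2 * x * y ≠ 0 ∧ β ^ 2 * y ^ 2 + α ^ 2 - 2 * α * β * x * y ≠ 0 ∧ x + y
    - α + β ≠ 0 ∧ (y - α + β) ^ 2 - x ≠ 0 ∧ y - (x - α + β) ^ 2 ≠ 0 :=
  ⟨fun ⟨h0, h1, h2, h3, h4, h5, h6, h7, h8, h9, h10, h11, h12, h13, h14, h15,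
      h16, h17, h18, h19⟩ =>
    ⟨h0, h1, h2, h3, h4, h5, h6, h7, h8, h9, h10, h11, h12, h13, h14, h15,
      h16, h17, h18, h19⟩,
  fun ⟨h0, h1, h2, h3, h4, h5, h6, h7, h8, h9, h10, h11, h12, h13, h14, h15,
      h16, h17, h18, h19⟩ =>
    ⟨h0, h1, h2, h3, h4, h5, h6, h7, h8, h9, h10, h11, h12, h13, h14, h15,
      h16, h17, h18, h19⟩⟩

theorem LegGeneric.eventually {n : ℕ} {p : Fin n → ℂ} {i j k l : Fin n}
    (h : LegGeneric (p i) (p j) (p k) (p l)) :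
    ∀ᶠ v in genericFilter n, LegGeneric (v i) (v j) (v k) (v l) := by
  simp only [legGeneric_iff, eventually_and]
  obtain ⟨h0, h1, h2, h3, h4, h5, h6, h7, h8, h9, h10, h11, h12, h13, h14, h15, h16, h17, h18,
    h19⟩ := h
  refine ⟨?_, ?_, ?_, ?_, ?_, ?_, ?_, ?_, ?_, ?_, ?_, ?_, ?_, ?_, ?_, ?_, ?_, ?_, ?_, ?_⟩
  all_goals
    refine RegAt.eventually_ne_zero_self (p := p) (by assumption) ?_
    repeat' with_reducible first
      | assumption
      | apply RegAt.coord
      | apply RegAt.const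
      | apply RegAt.neg
      | apply RegAt.add
      | apply RegAt.sub
      | apply RegAt.mul
      | apply RegAt.pow
      | apply RegAt.div

/-- Nondegeneracy of the three given legs, of the parameters of the fourth one, and of the sum of
the three given legs `(α - β) / (x - y)`. -/
structure FourLegGeneric (x xa xb xc a b c d : ℂ) : Prop where
  leg_a : LegGeneric x xa b c
  leg_b : LegGeneric x xb b d
  leg_c : LegGeneric x xc a c
  leg_d : LegGeneric x xc a d
  sum_ne : (b - c) * ((x - xb) * (x - xc)) - (b - d) * ((x - xa) * (x - xc))
    - (a - c) * ((x - xa) * (x - xb)) ≠ 0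

theorem eventually_fourLegGeneric : ∀ᶠ v in genericFilter 8,
    FourLegGeneric (v 0) (v 1) (v 2) (v 3) (v 4) (v 5) (v 6) (v 7) := by
  have h : FourLegGeneric 2 3 5 23 4 7 13 19 := by
    constructor
    case sum_ne => norm_num
    all_goals constructor <;> norm_num
  let p : Fin 8 → ℂ := ![2, 3, 5, 23, 4, 7, 13, 19]
  have hs : ∀ᶠ v in genericFilter 8, (v 5 - v 6) * ((v 0 - v 2) * (v 0 - v 3))
      - (v 5 - v 7) * ((v 0 - v 1) * (v 0 - v 3))
      - (v 4 - v 6) * ((v 0 - v 1) * (v 0 - v 2)) ≠ 0 := by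
    refine RegAt.eventually_ne_zero_self (p := p) h.sum_ne ?_
    repeat' with_reducible first
      | apply RegAt.coord
      | apply RegAt.sub
      | apply RegAt.mul
  filter_upwards [LegGeneric.eventually (p := p) (i := 0) (j := 1) (k := 5) (l := 6) h.leg_a,
    LegGeneric.eventually (p := p) (i := 0) (j := 2) (k := 5) (l := 7) h.leg_b,
    LegGeneric.eventually (p := p) (i := 0) (j := 3) (k := 4) (l := 6) h.leg_c,
    LegGeneric.eventually (p := p) (i := 0) (j := 3) (k := 4) (l := 7) h.leg_d, hs]
    with v ha hb hc hd hs
  exact ⟨ha, hb, hc, hd, hs⟩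

theorem hasFourLegFormC_of_generic {Q : FCQuad} {k : LegForm} {a c : LegFun}
    (h : ∀ {x xa xb xc α₁ α₂ β₁ β₂ : ℂ}, FourLegGeneric x xa xb xc α₁ α₂ β₁ β₂ → ∀ xd : ℂ,
      FourLegEq k a c x xa xb xc xd (α₁, α₂) (β₁, β₂) ↔ Q x xa xb xc xd (α₁, α₂) (β₁, β₂) = 0) :
    HasFourLegFormC Q k a c := by
  rw [HasFourLegFormC, ← eventually_genericFilter]
  filter_upwards [eventually_fourLegGeneric] with v hv xd
  exact (h hv xd).symm

/-- Clearing denominators in a multiplicative four-leg equation. The leg at `x_d` may have a zero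
denominator, but then its numerator is nonzero, and both sides fail: the quotient by zero is zero
rather than one. -/
theorem fourLeg_mult_iff {Na Da Nb Db Nc Dc Nd Dd K q : ℂ} (hNa : Na ≠ 0) (hDa : Da ≠ 0)
    (hNb : Nb ≠ 0) (hDb : Db ≠ 0) (hNc : Nc ≠ 0) (hDc : Dc ≠ 0) (hd : Dd = 0 → Nd ≠ 0)
    (hK : K ≠ 0) (hq : Na * Nd * (Db * Dc) - Da * Dd * (Nb * Nc) = K * q) :
    Na / Da * (Nd / Dd) / (Nb / Db * (Nc / Dc)) = 1 ↔ q = 0 := by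
  have e : q = 0 ↔ K * q = 0 := by simp [hK]
  rw [e, ← hq]
  by_cases hDd : Dd = 0
  · have := hd hDd
    simp [*]
  · rw [div_mul_div_comm, div_mul_div_comm, div_div_div_eq, div_eq_one_iff_eq (by simp [*]),
      sub_eq_zero]

theorem fourLeg_mult_iff_of_polynomial {Na Da Nb Db Nc Nd K q : ℂ} (hNa : Na ≠ 0) (hDa : Da ≠ 0)
    (hNb : Nb ≠ 0) (hDb : Db ≠ 0) (hNc : Nc ≠ 0) (hK : K ≠ 0)
    (hq : Na * Nd * Db - Da * (Nb * Nc) = K * q) :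
    Na / Da * Nd / (Nb / Db * Nc) = 1 ↔ q = 0 := by
  have := fourLeg_mult_iff hNa hDa hNb hDb hNc one_ne_zero (Nd := Nd) (Dd := 1) (by simp) hK
    (by simpa using hq)
  simpa using this

namespace LegGeneric

variable {x y α β : ℂ}

theorem joukowski_leg_ne (h : LegGeneric x y α β) :
    α ^ 2 + β ^ 2 * xbar x ^ 2 - 2 * α * β * xbar x * y ≠ 0 ∧
      β ^ 2 + α ^ 2 * xbar x ^ 2 - 2 * α * β * xbar x * y ≠ 0 := by
  have hs := xbar_sq_add_one x
  rw [← mul_ne_zero_iff]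
  convert mul_ne_zero (pow_ne_zero 2 (xbar_ne_zero x)) h.biquadratic_mul_ne using 1
  linear_combination (α ^ 2 * β ^ 2 * (1 + xbar x ^ 2 + 2 * x * xbar x)
    - 2 * α * β * xbar x * y * (α ^ 2 + β ^ 2)) * hs

theorem sqrt_leg_ne (h : LegGeneric x y α β) :
    (Complex.sqrt x + α - β) ^ 2 - y ≠ 0 ∧ (Complex.sqrt x - α + β) ^ 2 - y ≠ 0 := by
  have hs := sq_csqrt x
  rw [← mul_ne_zero_iff]
  convert h.biquadratic_add_ne using 1
  linear_combination (Complex.sqrt x ^ 2 + x - 2 * (α - β) ^ 2 - 2 * y) * hs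

theorem joukowski_short_leg_ne (h : LegGeneric x y α β) :
    β * xbar x * y - α ≠ 0 ∧ β * y - α * xbar x ≠ 0 := by
  have hs := xbar_sq_add_one x
  rw [← mul_ne_zero_iff]
  convert mul_ne_zero (xbar_ne_zero x) h.leg_hh0_ne using 1
  linear_combination -α * β * y * hs

theorem sqrt_short_leg_ne (h : LegGeneric x y α β) :
    y - Complex.sqrt x - α + β ≠ 0 ∧ y + Complex.sqrt x - α + β ≠ 0 := by
  have hs := sq_csqrt x
  rw [← mul_ne_zero_iff]
  convert h.leg_add_110_ne using 1
  linear_combination -hs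

theorem sqrt_ne (h : LegGeneric x y α β) : Complex.sqrt x ≠ 0 := fun h0 => h.x_ne (by
  rw [← sq_csqrt x, h0]
  norm_num)

end LegGeneric

theorem hasFourLegFormA_A3_0 :
    HasFourLegFormA (polyA3 0) .mult fun x y α β => (β * x - α * y) / (α * x - β * y) := by
  refine hasFourLegFormC_of_generic fun {x xa xb xc a b c d} h xd => ?_
  refine fourLeg_mult_iff h.leg_a.num_mul_ne h.leg_a.den_mul_ne h.leg_b.num_mul_ne
    h.leg_b.den_mul_ne h.leg_c.num_mul_ne h.leg_c.den_mul_ne (fun h1 h2 => ?_) ?_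
    (polyA3_zero_cleared x xa xb xc xd a b c d h.leg_c.α_ne h.leg_a.α_ne h.leg_a.β_ne h.leg_b.β_ne)
  · refine mul_ne_zero h.leg_d.x_ne h.leg_d.sq_sub_ne ?_
    linear_combination a * h1 - d * h2
  · simp [h.leg_c.α_ne, h.leg_a.α_ne, h.leg_a.β_ne, h.leg_b.β_ne, h.leg_a.x_ne]

theorem hasFourLegFormA_A3_1 :
    HasFourLegFormA (polyA3 1) .mult TypeC.C3_hh0.legA := by
  refine hasFourLegFormC_of_generic fun {x xa xb xc a b c d} h xd => ?_
  have hs := xbar_sq_sub_one_ne_zero h.leg_a.x_sq_ne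
  refine fourLeg_mult_iff h.leg_a.joukowski_leg_ne.1 h.leg_a.joukowski_leg_ne.2
    h.leg_b.joukowski_leg_ne.1 h.leg_b.joukowski_leg_ne.2 h.leg_c.joukowski_leg_ne.1
    h.leg_c.joukowski_leg_ne.2 (fun h1 h2 => ?_) ?_
    (polyA3_one_cleared x xa xb xc xd a b c d _ h.leg_c.α_ne h.leg_a.α_ne h.leg_a.β_ne
      h.leg_b.β_ne (xbar_ne_zero x) (eq_div_xbar x))
  · refine mul_ne_zero hs h.leg_d.sq_sub_ne ?_
    linear_combination h1 - h2
  · simp [h.leg_c.α_ne, h.leg_a.α_ne, h.leg_a.β_ne, h.leg_b.β_ne, xbar_ne_zero, hs]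

theorem hasFourLegFormA_A2_00 :
    HasFourLegFormA (polyA2 0 0) .add fun x y α β => (α - β) / (x - y) := by
  refine hasFourLegFormC_of_generic fun {x xa xb xc a b c d} h xd => ?_
  have ha := h.leg_a.xy_ne
  have hb := h.leg_b.xy_ne
  have hc := h.leg_c.xy_ne
  rw [← polyA2_00_cleared]
  change (b - c) / (x - xa) + (a - d) / (x - xd) - (b - d) / (x - xb) - (a - c) / (x - xc) = 0 ↔ _
  by_cases hd : x - xd = 0
  · -- the leg at `x_d` is the junk value `0`, and neither equation holds
    rw [hd, div_zero]
    refine iff_of_false (fun h0 => h.sum_ne ?_) (fun h0 => ?_)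
    · field_simp at h0
      linear_combination h0
    · exact mul_ne_zero h.leg_d.sub_ne (mul_ne_zero (mul_ne_zero ha hb) hc)
        (by linear_combination h0)
  · rw [← mul_eq_zero_iff_left (mul_ne_zero (mul_ne_zero ha hb) (mul_ne_zero hc hd))]
    field_simp

theorem hasFourLegFormA_A2_10 :
    HasFourLegFormA (polyA2 1 0) .mult fun x y α β => (-x + y + α - β) / (x - y + α - β) := by
  refine hasFourLegFormC_of_generic fun {x xa xb xc a b c d} h xd => ?_
  refine fourLeg_mult_iff h.leg_a.num_add_ne h.leg_a.den_add_ne h.leg_b.num_add_ne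
    h.leg_b.den_add_ne h.leg_c.num_add_ne h.leg_c.den_add_ne (fun h1 h2 => ?_) (by norm_num)
    (polyA2_10_cleared x xa xb xc xd a b c d)
  refine h.leg_d.sub_ne ?_
  linear_combination (h1 + h2) / 2

theorem hasFourLegFormA_A2_11 :
    HasFourLegFormA (polyA2 1 1) .mult TypeC.C2_110.legA := by
  refine hasFourLegFormC_of_generic fun {x xa xb xc a b c d} h xd => ?_
  have hs := h.leg_a.sqrt_ne
  refine fourLeg_mult_iff h.leg_a.sqrt_leg_ne.1 h.leg_a.sqrt_leg_ne.2 h.leg_b.sqrt_leg_ne.1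
    h.leg_b.sqrt_leg_ne.2 h.leg_c.sqrt_leg_ne.1 h.leg_c.sqrt_leg_ne.2 (fun h1 h2 => ?_)
    (by simp [hs]) (polyA2_11_cleared x xa xb xc xd a b c d _ (sq_csqrt x))
  refine mul_ne_zero hs h.leg_d.sub_ne ?_
  linear_combination (h2 - h1) / 4

theorem TypeC.hasFourLegFormC (C : TypeC) : HasFourLegFormC C.poly C.legForm C.legA C.legC := by
  refine hasFourLegFormC_of_generic fun {x xa xb xc a b c d} h xd => ?_
  have hx := h.leg_a.x_ne
  have ha := h.leg_c.α_ne
  have hb := h.leg_a.α_ne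
  have hc := h.leg_a.β_ne
  have hd := h.leg_b.β_ne
  cases C
  case C3_000 =>
    exact fourLeg_mult_iff_of_polynomial h.leg_a.num_mul_ne h.leg_a.den_mul_ne h.leg_b.num_mul_ne
      h.leg_b.den_mul_ne h.leg_c.y_ne one_ne_zero
      ((polyC3_000_cleared x xa xb xc xd a b c d).trans (one_mul _).symm)
  case C3_100 =>
    exact fourLeg_mult_iff_of_polynomial h.leg_a.num_mul_ne h.leg_a.den_mul_ne h.leg_b.num_mul_ne
      h.leg_b.den_mul_ne h.leg_c.leg_100_ne hx (polyC3_100_cleared x xa xb xc xd a b c d ha hc hd)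
  case C3_h0h =>
    exact fourLeg_mult_iff_of_polynomial h.leg_a.num_mul_ne h.leg_a.den_mul_ne h.leg_b.num_mul_ne
      h.leg_b.den_mul_ne h.leg_c.leg_h0h_ne (by simpa using hx)
      (polyC3_h0h_cleared x xa xb xc xd a b c d ha hc hd)
  case C3_hh0 =>
    have hs := xbar_sq_sub_one_ne_zero h.leg_a.x_sq_ne
    refine fourLeg_mult_iff h.leg_a.joukowski_leg_ne.1 h.leg_a.joukowski_leg_ne.2
      h.leg_b.joukowski_leg_ne.1 h.leg_b.joukowski_leg_ne.2 h.leg_c.joukowski_short_leg_ne.1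
      h.leg_c.joukowski_short_leg_ne.2 (fun h1 h2 => ?_) ?_
      (polyC3_hh0_cleared x xa xb xc xd a b c d _ ha hb hc hd (xbar_ne_zero x) (eq_div_xbar x))
    · refine mul_ne_zero ha hs ?_
      linear_combination h2 - xbar x * h1
    · simp [ha, hb, hc, hd, xbar_ne_zero, hs]
  case C2_000 =>
    have h1 := h.leg_a.xy_ne
    have h2 := h.leg_b.xy_ne
    have := polyC2_000_cleared x xa xb xc xd a b c d
    change (b - c) / (x - xa) + (a - d - xd) / (2 * x) - (b - d) / (x - xb)
      - (a - c - xc) / (2 * x) = 0 ↔ polyC2 0 0 0 x xa xb xc xd (a, b) (c, d) = 0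
    rw [← neg_eq_zero (a := polyC2 0 0 0 x xa xb xc xd (a, b) (c, d)), ← this]
    field_simp
    ring_nf
  case C2_100 =>
    exact fourLeg_mult_iff_of_polynomial h.leg_a.num_add_ne h.leg_a.den_add_ne h.leg_b.num_add_ne
      h.leg_b.den_add_ne h.leg_c.leg_add_100_ne (neg_ne_zero.2 one_ne_zero)
      ((polyC2_100_cleared x xa xb xc xd a b c d).trans (neg_one_mul _).symm)
  case C2_101 =>
    exact fourLeg_mult_iff_of_polynomial h.leg_a.num_add_ne h.leg_a.den_add_ne h.leg_b.num_add_ne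
      h.leg_b.den_add_ne h.leg_c.leg_add_101_ne (neg_ne_zero.2 one_ne_zero)
      ((polyC2_101_cleared x xa xb xc xd a b c d).trans (neg_one_mul _).symm)
  case C2_110 =>
    have hs := h.leg_a.sqrt_ne
    refine fourLeg_mult_iff h.leg_a.sqrt_leg_ne.1 h.leg_a.sqrt_leg_ne.2 h.leg_b.sqrt_leg_ne.1
      h.leg_b.sqrt_leg_ne.2 h.leg_c.sqrt_short_leg_ne.1 h.leg_c.sqrt_short_leg_ne.2
      (fun h1 h2 => hs ?_) (by simp [hs])
      (polyC2_110_cleared x xa xb xc xd a b c d _ (sq_csqrt x))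
    linear_combination (h1 - h2) / 2
  case C1_0 =>
    have h1 := h.leg_a.xy_ne
    have h2 := h.leg_b.xy_ne
    have := polyC1_0_cleared x xa xb xc xd a b c d
    change (b - c) / (x - xa) + xd / 2 - (b - d) / (x - xb) - xc / 2 = 0
      ↔ polyC1 0 x xa xb xc xd (a, b) (c, d) = 0
    rw [← neg_eq_zero (a := polyC1 0 x xa xb xc xd (a, b) (c, d)), ← this]
    field_simp
    ring_nf
  case C1_1 =>
    exact fourLeg_mult_iff_of_polynomial h.leg_a.num_add_ne h.leg_a.den_add_ne h.leg_b.num_add_ne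
      h.leg_b.den_add_ne h.leg_c.y_ne one_ne_zero
      ((polyC1_1_cleared x xa xb xc xd a b c d).trans (one_mul _).symm)

/-- The type-A equation with the same leg function as a given type-C equation. -/
def TypeC.partner : TypeC → TypeA
  | .C3_000 | .C3_100 | .C3_h0h => .A3_0
  | .C3_hh0 => .A3_1
  | .C2_000 | .C1_0 => .A2_00
  | .C2_100 | .C2_101 | .C1_1 => .A2_10
  | .C2_110 => .A2_11

theorem TypeC.hasFourLegFormA_partner (C : TypeC) :
    HasFourLegFormA C.partner.poly C.legForm C.legA := by
  cases C
  case C3_000 | C3_100 | C3_h0h => exact hasFourLegFormA_A3_0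
  case C3_hh0 => exact hasFourLegFormA_A3_1
  case C2_000 | C1_0 => exact hasFourLegFormA_A2_00
  case C2_100 | C2_101 | C1_1 => exact hasFourLegFormA_A2_10
  case C2_110 => exact hasFourLegFormA_A2_11

/-- Inequivalent type-A equations are told apart at a single point, where both are of degree one
in `x_d` and have different roots. -/
theorem TypeA.not_equivalent_of_resultant {A B : TypeA} {x xa xb xc a b c d : ℂ}
    (ha : a ≠ 0) (hb : b ≠ 0) (hc : c ≠ 0) (hd : d ≠ 0)
    (hs : A.poly x xa xb xc 1 (a, b) (c, d) - A.poly x xa xb xc 0 (a, b) (c, d) ≠ 0)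
    (hr : A.poly x xa xb xc 0 (a, b) (c, d) * B.poly x xa xb xc 1 (a, b) (c, d)
      - A.poly x xa xb xc 1 (a, b) (c, d) * B.poly x xa xb xc 0 (a, b) (c, d) ≠ 0) :
    ¬ A.poly.Equivalent B.poly := by
  intro h
  rw [FCQuad.Equivalent, ← eventually_genericFilter] at h
  let p : Fin 8 → ℂ := ![x, xa, xb, xc, a, b, c, d]
  have H (D : TypeA) (t : ℂ) :
      RegAt p (fun v => D.poly (v 0) (v 1) (v 2) (v 3) t (v 4, v 5) (v 6, v 7))
        (D.poly x xa xb xc t (a, b) (c, d)) :=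
    D.isRegular.reg (.coord 0) (.coord 1) (.coord 2) (.coord 3) (.const t) (.coord 4) (.coord 5)
      (.coord 6) (.coord 7) ha hb hc hd
  obtain ⟨v, hv, hs, hr⟩ := (h.and ((((H A 1).sub (H A 0)).eventually_ne_zero hs).and
    ((((H A 0).mul (H B 1)).sub ((H A 1).mul (H B 0))).eventually_ne_zero hr))).exists
  obtain ⟨t, ht⟩ : ∃ t, A.poly (v 0) (v 1) (v 2) (v 3) t (v 4, v 5) (v 6, v 7) = 0 := by
    refine ⟨-A.poly (v 0) (v 1) (v 2) (v 3) 0 (v 4, v 5) (v 6, v 7)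
      / (A.poly (v 0) (v 1) (v 2) (v 3) 1 (v 4, v 5) (v 6, v 7)
        - A.poly (v 0) (v 1) (v 2) (v 3) 0 (v 4, v 5) (v 6, v 7)), ?_⟩
    rw [A.isRegular.affine_d, div_mul_cancel₀ _ hs, add_neg_cancel]
  have ht' := (hv t).1 ht
  rw [A.isRegular.affine_d] at ht
  rw [B.isRegular.affine_d] at ht'
  refine hr ?_
  linear_combination
    (B.poly (v 0) (v 1) (v 2) (v 3) 1 (v 4, v 5) (v 6, v 7)
      - B.poly (v 0) (v 1) (v 2) (v 3) 0 (v 4, v 5) (v 6, v 7)) * ht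
    - (A.poly (v 0) (v 1) (v 2) (v 3) 1 (v 4, v 5) (v 6, v 7)
      - A.poly (v 0) (v 1) (v 2) (v 3) 0 (v 4, v 5) (v 6, v 7)) * ht'

theorem TypeA.eq_of_equivalent {A B : TypeA} (h : A.poly.Equivalent B.poly) : A = B := by
  by_contra hne
  refine TypeA.not_equivalent_of_resultant (x := 1) (xa := 0) (xb := 2) (xc := 1) (a := -1) (b := 1)
    (c := -2) (d := 2) (by norm_num) (by norm_num) (by norm_num) (by norm_num) ?_ ?_ h
  · cases A <;> norm_num [TypeA.poly, polyA3, polyA2]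
  · cases A <;> cases B <;> first
      | exact absurd rfl hne
      | norm_num [TypeA.poly, polyA3, polyA2]

theorem HasFourLegFormA.equivalent {Q R : FCQuad} {k : LegForm} {a : LegFun}
    (hQ : HasFourLegFormA Q k a) (hR : HasFourLegFormA R k a) : Q.Equivalent R := by
  rw [HasFourLegFormA, HasFourLegFormC, ← eventually_genericFilter] at hQ hR
  rw [FCQuad.Equivalent, ← eventually_genericFilter]
  filter_upwards [hQ, hR] with v h1 h2 xd
  rw [h1, h2]

theorem TypeC.fixedByLegs_partner (C : TypeC) : FixedByLegs C.partner C :=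
  ⟨C.hasFourLegFormC, C.hasFourLegFormA_partner,
    fun _ hB => TypeA.eq_of_equivalent (hB.equivalent C.hasFourLegFormA_partner),
    fun _ hQ => hQ.equivalent C.hasFourLegFormA_partner⟩

theorem theorem1 (A A' : TypeA) (C C' : TypeC) (hrow : (A, A', C, C') ∈ combinations) :
    FixedByLegs A C ∧ FixedByLegs A' C' ∧ CAFCC A.poly A'.poly C.poly C'.poly := by
  have hp : A = C.partner ∧ A' = C'.partner := by
    simp only [combinations, List.mem_cons, List.not_mem_nil, or_false, Prod.mk.injEq] at hrow
    rcases hrow with h | h | h | h | h | h | h | h | h | h <;> obtain ⟨rfl, rfl, rfl, rfl⟩ := h <;>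
      exact ⟨rfl, rfl⟩
  refine ⟨hp.1 ▸ C.fixedByLegs_partner, hp.2 ▸ C'.fixedByLegs_partner, ?_⟩
  simp only [combinations, List.mem_cons, List.not_mem_nil, or_false, Prod.mk.injEq] at hrow
  rcases hrow with h | h | h | h | h | h | h | h | h | h <;> obtain ⟨rfl, rfl, rfl, rfl⟩ := h
  · exact latticeWitness_vertJoukowskiH3.cafcc (TypeA.isRegular _) (TypeA.isRegular _)
      (TypeC.isRegular _) (TypeC.isRegular _) quadJoukowski_centersA quadH3_centersA
      vertJoukowskiH3_centersLower vertJoukowskiH3_centersUpper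
  · exact latticeWitness_vertH3Joukowski.cafcc (TypeA.isRegular _) (TypeA.isRegular _)
      (TypeC.isRegular _) (TypeC.isRegular _) quadH3_centersA quadJoukowski_centersA
      vertH3Joukowski_centersLower vertH3Joukowski_centersUpper
  · exact latticeWitness_vertM3.cafcc (TypeA.isRegular _) (TypeA.isRegular _)
      (TypeC.isRegular _) (TypeC.isRegular _) quadM3_centersA quadM3_centersA
      vertM3_centersLower vertM3_centersUpper
  · exact latticeWitness_vertM3Hom.cafcc (TypeA.isRegular _) (TypeA.isRegular _)
      (TypeC.isRegular _) (TypeC.isRegular _) quadM3_centersA quadM3_centersA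
      vertM3Hom_centersLower vertM3Hom_centersUpper
  · exact latticeWitness_vertSqrtH2.cafcc (TypeA.isRegular _) (TypeA.isRegular _)
      (TypeC.isRegular _) (TypeC.isRegular _) quadSqrt_centersA quadH2_centersA
      vertSqrtH2_centersLower vertSqrtH2_centersUpper
  · exact latticeWitness_vertH2Sqrt.cafcc (TypeA.isRegular _) (TypeA.isRegular _)
      (TypeC.isRegular _) (TypeC.isRegular _) quadH2_centersA quadSqrt_centersA
      vertH2Sqrt_centersLower vertH2Sqrt_centersUpper
  · exact latticeWitness_vertM1.cafcc (TypeA.isRegular _) (TypeA.isRegular _)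
      (TypeC.isRegular _) (TypeC.isRegular _) quadM1_centersA quadM1_centersA
      vertM1_centersLower vertM1_centersUpper
  · exact latticeWitness_vertH1H2.cafcc (TypeA.isRegular _) (TypeA.isRegular _)
      (TypeC.isRegular _) (TypeC.isRegular _) (quadH1_centersA one_ne_zero) quadH2_centersA
      vertH1H2_centersLower vertH1H2_centersUpper
  · exact latticeWitness_vertH2H1.cafcc (TypeA.isRegular _) (TypeA.isRegular _)
      (TypeC.isRegular _) (TypeC.isRegular _) quadH2_centersA (quadH1_centersA one_ne_zero)
      vertH2H1_centersLower vertH2H1_centersUpper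
  · exact latticeWitness_vertH1.cafcc (TypeA.isRegular _) (TypeA.isRegular _)
      (TypeC.isRegular _) (TypeC.isRegular _) (quadH1_centersA one_ne_zero)
      (quadH1_centersA two_ne_zero) vertH1_centersLower vertH1_centersUpper
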